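/- Let $p$ be a prime, $k$ an algebraically closed field of characteristic $p$, and $\mathcal{O}$ a discrete valuation ring which is a finite extension of the Witt ring $W(k)$, with residue field $\kappa=k$. Let $|\cdot|$ be the absolute value of $\mathcal{O}[\frac1p]$ with unit ball $\mathcal{O}$ and $|p|=p^{-1}$, and put $v_p(a)=-\log_p|a|$. For a series $x=\sum_{i\in\mathbb{Q}}x_it^i$ with coefficients in $\mathcal{O}[\frac1p]$ and for $r>0$, put $w_r(x)=\sup_i|x_i|p^{-ri}\in[0,\infty]$. Define the following rings, with the usual addition and multiplication of series. * $\Omega_{\mathrm{an}}$: the power series $x=\sum_{n\in\mathbb{Z}_{\ge0}}x_nt^n$ with $w_r(x)<\infty$ for all $r>0$ (equivalently $\liminf_{n\to\infty} v_p(x_n)/n\ge 0$). * $\Omega^{\mathrm{imm}}_{\mathrm{an}}$: the series $x=\sum_{n\in\mathbb{Q}_{\ge0}}x_nt^n$ such that for each $r\in\mathbb{R}$ the set $\{n:|x_n|>p^r\}$ is well-ordered, and such that $w_r(x)<\infty$ for all $r>0$. * $\Omega^{\mathrm{alg}}_{\mathrm{an}}$: the $x\in\Omega^{\mathrm{imm}}_{\mathrm{an}}$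 such that for every $j\in\mathbb{Q}$ the truncation $\sum_{i<j}x_it^i$ lies in $\Gamma^{\mathrm{alg}}[\frac1p]$. Here $\Gamma^{\mathrm{imm}}$ is the ring of series $\sum_{n\in\mathbb{Q}}x_nt^n$ with $x_n\in\mathcal{O}$ and all sets $\{n:|x_n|>p^r\}$ well-ordered; its residue field is the field $\kappa((t^{\mathbb{Q}}))$ of generalized power series. $K^{\mathrm{alg}}$ is the algebraic closure of $K=\kappa((t))$ in $\kappa((t^{\mathbb{Q}}))$, and $\Gamma^{\mathrm{alg}}=W(K^{\mathrm{alg}})\otimes_{W(k)}\mathcal{O}\subseteq\Gamma^{\mathrm{imm}}$ is the $p$-adic closure in $\Gamma^{\mathrm{imm}}$ of the $\mathcal{O}$-span of the Teichmüller lifts of the elements of $K^{\mathrm{alg}}$. Let $R$ be one of these three rings, with the Fréchet topology defined by the norms $w_r$, $r>0$. The Newton polygon of $x\in R$ is the lower boundary of the convex hull of the points lying on or above some $(i,v_p(x_i))$ with $x_i\ne0$. A slope of $x$ is a real number $s>0$ such that the Newton polygon of $x$ contains a nondegenerate segment of slope $-s$. An element of $R$ is pure of slope $s$ if its constant coefficient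 is nonzero and $s$ is its only slope. Let $x\in R$ be nonzero; if $R$ is $\Omega^{\mathrm{alg}}_{\mathrm{an}}$ or $\Omega^{\mathrm{imm}}_{\mathrm{an}}$, assume moreover that $x$ has a term of lowest exponent, i.e. that $\{i:x_i\neq0\}$ has a least element. Then $x$ has a slope factorization $$x=c\,t^j\prod_{i=1}^{N}y_i,\qquad N\in\{0,1,2,\dots\}\cup\{\infty\},$$ where $c$ is a unit of $R$, with $c=1$ unless $N=0$; $t^j\in R$; each $y_i\in R$ is pure of some slope $s_i$; the sequence $s_1,s_2,\dots$ is strictly decreasing; and, if $N=\infty$, then $s_i\to0$ and the product converges in the Fréchet topology of $R$ to an element of $R$. -/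

import Mathlib

open scoped ENNReal Topology

noncomputable section

namespace SlopeFact

/-! Throughout, `E` is the field `𝒪[1/p]`, with its absolute value, and a formal series
`∑ i, x i * t ^ i` with exponents in `ℚ` and coefficients in `E` is the function `x : ℚ → E`. -/

section Series

variable {E : Type*} [NormedField E]

/-- The product of two series: `(x y)_n = ∑ x_i y_{n-i}`, an infinite sum which converges in the
complete field `E` whenever `x` and `y` lie in one of the rings considered below. -/
def seriesMul (x y : ℚ → E) : ℚ → E := fun n => ∑' i : ℚ, x i * y (n - i)

/-- The monomial `t ^ j`. -/
def tPow (j : ℚ) : ℚ → E := Pi.single j 1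

/-- The series `1`. -/
def seriesOne : ℚ → E := tPow 0

/-- The product `y 0 * y 1 * ⋯ * y (n - 1)`. -/
def partialProd (y : ℕ → ℚ → E) : ℕ → ℚ → E
  | 0 => seriesOne
  | n + 1 => seriesMul (partialProd y n) (y n)

/-- The power `x ^ n`. -/
def seriesPow (x : ℚ → E) (n : ℕ) : ℚ → E := partialProd (fun _ => x) n

/-- The norm `w_r(x) = sup_i |x_i| p ^ (-r i)`, with values in `[0, ∞]`. -/
def w (p : ℕ) (r : ℝ) (x : ℚ → E) : ℝ≥0∞ :=
  ⨆ i : ℚ, ENNReal.ofReal (‖x i‖ * (p : ℝ) ^ (-(r * (i : ℝ))))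

/-- For every real `r`, the set of exponents `n` with `|x_n| > p ^ r` is well-ordered. -/
def WellOrderedSupports (p : ℕ) (x : ℚ → E) : Prop :=
  ∀ r : ℝ, {n : ℚ | (p : ℝ) ^ r < ‖x n‖}.IsWF

/-- The `p`-adic valuation of a nonzero element of `E`. -/
def vp (p : ℕ) (a : E) : ℝ := -Real.logb p ‖a‖

/-- The closed-upward convex region whose lower boundary is the Newton polygon of `x`: the convex
hull of the points lying on or above some point `(i, v_p(x_i))` with `x_i ≠ 0`. -/
def newtonRegion (p : ℕ) (x : ℚ → E) : Set (ℝ × ℝ) :=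
  convexHull ℝ {P | ∃ i : ℚ, x i ≠ 0 ∧ P.1 = (i : ℝ) ∧ vp p (x i) ≤ P.2}

/-- `s > 0` is a slope of `x` if a nondegenerate segment of slope `-s` is contained in the Newton
polygon of `x`: the segment `[P, Q]` lies in the region and the region lies above the line through
`P` and `Q`. -/
def IsSlope (p : ℕ) (x : ℚ → E) (s : ℝ) : Prop :=
  0 < s ∧ ∃ P ∈ newtonRegion p x, ∃ Q ∈ newtonRegion p x,
    P.1 < Q.1 ∧ Q.2 - P.2 = -s * (Q.1 - P.1) ∧
    ∀ Z ∈ newtonRegion p x, P.2 - s * (Z.1 - P.1) ≤ Z.2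

/-- `x` is pure of slope `s`: its constant coefficient is nonzero and `s` is its only slope. -/
def IsPureOfSlope (p : ℕ) (x : ℚ → E) (s : ℝ) : Prop :=
  x 0 ≠ 0 ∧ ∀ s' : ℝ, IsSlope p x s' ↔ s' = s

/-- `c` is a unit of the ring with underlying set `R`. -/
def IsUnitOf (R : Set (ℚ → E)) (c : ℚ → E) : Prop :=
  c ∈ R ∧ ∃ d ∈ R, seriesMul c d = seriesOne

/-- `x` has a slope factorization `x = c t^j ∏_{i < N} y_i` in `R`, where `N` is finite or `∞`:
`c` is a unit of `R`, equal to `1` unless there are no factors `y_i`; each `y_i` is an element of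
`R` that is pure of slope `s_i`; the `s_i` are strictly decreasing; and, if `N = ∞`, `s_i → 0` and
the partial products converge in the Fréchet topology of `R`, defined by the norms `w_r`. -/
def HasSlopeFactorization (p : ℕ) (R : Set (ℚ → E)) (x : ℚ → E) : Prop :=
  ∃ (N : ℕ∞) (c : ℚ → E) (j : ℚ) (y : ℕ → ℚ → E) (s : ℕ → ℝ) (P : ℚ → E),
    IsUnitOf R c ∧ (N ≠ 0 → c = seriesOne) ∧
    (tPow j : ℚ → E) ∈ R ∧
    (∀ i : ℕ, (i : ℕ∞) < N → y i ∈ R ∧ IsPureOfSlope p (y i) (s i)) ∧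
    (∀ i i' : ℕ, i < i' → (i' : ℕ∞) < N → s i' < s i) ∧
    (N = ⊤ → Filter.Tendsto s Filter.atTop (𝓝 0)) ∧
    P ∈ R ∧
    (∀ n : ℕ, N = n → P = partialProd y n) ∧
    (N = ⊤ → ∀ r : ℝ, 0 < r →
      Filter.Tendsto (fun n => w p r (partialProd y n - P)) Filter.atTop (𝓝 0)) ∧
    x = seriesMul c (seriesMul (tPow j) P)

/-- `Ω^imm_an`: the series with exponents in `ℚ_{≥ 0}` and coefficients in `𝒪[1/p]` such that the
sets `{n : |x_n| > p ^ r}` are well-ordered and `w_r(x) < ∞` for all `r > 0`. -/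
def OmegaImmAn (p : ℕ) (E : Type*) [NormedField E] : Set (ℚ → E) :=
  {x | (∀ n : ℚ, n < 0 → x n = 0) ∧ WellOrderedSupports p x ∧ ∀ r : ℝ, 0 < r → w p r x < ⊤}

/-- `Ω_an`: the power series `∑_{n ≥ 0} x_n t ^ n` with integral exponents, with coefficients in
`𝒪[1/p]`, and with `liminf v_p(x_n) / n ≥ 0`, that is, `w_r(x) < ∞` for all `r > 0`. -/
def OmegaAn (p : ℕ) (E : Type*) [NormedField E] : Set (ℚ → E) :=
  {x | (∀ n : ℚ, (¬ ∃ m : ℕ, n = m) → x n = 0) ∧ ∀ r : ℝ, 0 < r → w p r x < ⊤}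

end Series

section Alg

variable (p : ℕ) (O : Type*) [CommRing O] [IsLocalRing O]
  (E : Type*) [NormedField E] [Algebra O E]

/-- `Γ^imm`: the series with exponents in `ℚ` and coefficients in `𝒪` such that the sets
`{n : |x_n| > p ^ r}` are well-ordered. -/
def GammaImm : Set (ℚ → E) :=
  {x | (∀ n : ℚ, x n ∈ Set.range (algebraMap O E)) ∧ WellOrderedSupports p x}

/-- The inclusion of `κ((t))` into the field `κ((t^ℚ))` of generalized power series. -/
def laurentToHahn (κ : Type*) [Field κ] : LaurentSeries κ →+* HahnSeries ℚ κ :=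
  HahnSeries.embDomainRingHom (Int.castAddHom ℚ) Int.cast_injective
    (fun _ _ => Int.cast_le)

/-- `a` belongs to the algebraic closure `K^alg` of `K = κ((t))` in `κ((t^ℚ))`. -/
def IsAlgebraicHahn {κ : Type*} [Field κ] (a : HahnSeries ℚ κ) : Prop :=
  ∃ f : Polynomial (LaurentSeries κ), f ≠ 0 ∧ f.eval₂ (laurentToHahn κ) a = 0

/-- `a` is the reduction of the series `x` modulo the maximal ideal of `𝒪`. -/
def IsReduction {O : Type*} [CommRing O] [IsLocalRing O] {E : Type*} [NormedField E] [Algebra O E]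
    (x : ℚ → E) (a : HahnSeries ℚ (IsLocalRing.ResidueField O)) : Prop :=
  ∀ n : ℚ, ∃ b : O, algebraMap O E b = x n ∧ IsLocalRing.residue O b = a.coeff n

/-- The Teichmüller lifts in `Γ^imm` of the elements of `K^alg`: the elements of `Γ^imm` which
reduce into `K^alg` and have a `p ^ m`-th root in `Γ^imm` for every `m`. -/
def algTeichmuller : Set (ℚ → E) :=
  {u | u ∈ GammaImm p O E ∧
    (∀ m : ℕ, ∃ v ∈ GammaImm p O E, seriesPow v (p ^ m) = u) ∧
    ∃ a : HahnSeries ℚ (IsLocalRing.ResidueField O), IsReduction u a ∧ IsAlgebraicHahn a}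

/-- `Γ^alg`, the `p`-adically complete extension of `Γ` with residue field `K^alg`, as a subring of
`Γ^imm`. It is `W(K^alg) ⊗_{W(k)} 𝒪`, that is, the `p`-adic closure in `Γ^imm` of the `𝒪`-span of
the Teichmüller lifts of the elements of `K^alg`. -/
def GammaAlg : Set (ℚ → E) :=
  {x | x ∈ GammaImm p O E ∧ ∀ m : ℕ, ∃ z ∈ Submodule.span O (algTeichmuller p O E),
    ∀ n : ℚ, ‖x n - z n‖ ≤ ((p : ℝ) ^ m)⁻¹}

/-- `Ω^alg_an`: the elements `x` of `Ω^imm_an` such that for each `j`, the truncation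
`∑_{i < j} x_i t ^ i` lies in `Γ^alg_con[1/p]`. (The overconvergence condition defining
`Γ^alg_con` in `Γ^alg` concerns only the coefficients of negative index, which are zero here.) -/
def OmegaAlgAn : Set (ℚ → E) :=
  {x | x ∈ OmegaImmAn p E ∧ ∀ j : ℚ, ∃ m : ℕ,
    (fun i : ℚ => if i < j then (p : E) ^ m * x i else 0) ∈ GammaAlg p O E}

end Alg

end SlopeFact

end

/-!
The series of the three rings are those with nonnegative exponents and finite norms `w_r` which lie
in a space `C` of series: the series with integral exponents, all series, or the series whose
truncations lie in `Γ^alg[1/p]`. The factorization is carried out once, for any space `C` stable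
under products, truncations at `0` and limits for each norm `w_r`. Let `s` be the largest slope of
`x`, after division by the monomial of lowest exponent. A Wiener–Hopf factorization near the norm
`w_s`, found with the Banach fixed point theorem, splits off from `x` a polynomial `y` which is pure
of slope `s` and leaves a quotient with smaller slopes. Iterating, either the process stops at a
unit, or the slopes tend to `0` because the norm of `E` is discrete. In the second case the factors
are corrected by units, as in a Mittag-Leffler argument, to make the product converge.

For `Ω^alg_an` one has to show that the series whose truncations lie in `Γ^alg[1/p]` form such a
space `C`. The main point is that a truncation of a product `x y` is approximated by a combination
of products of truncations of `x` and `y`: the pairs of exponents `(i, k)` of large terms with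
`i + k ≥ j` form a subset of a product of well-ordered sets, which has finitely many minimal
elements.
-/

open scoped ENNReal Topology

noncomputable section

namespace SlopeFact

/-! ### The norms `w_r` and products of series -/

section Nonarchimedean

lemma tendsto_cofinite_zero_of_finite_lt {ι G : Type*} [SeminormedAddGroup G] {f : ι → G}
    (hf : ∀ ε : ℝ, 0 < ε → {i | ε < ‖f i‖}.Finite) : Filter.Tendsto f Filter.cofinite (𝓝 0) := by
  rw [NormedAddGroup.tendsto_nhds_zero]
  exact fun ε hε => Filter.eventually_cofinite.2 <| (hf (ε / 2) (half_pos hε)).subset fun i hi =>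
    (half_lt_self hε).trans_le (not_lt.1 hi)

section Tsum

variable {ι G : Type*} [NormedAddCommGroup G] [IsUltrametricDist G] {f : ι → G}

lemma norm_tsum_lt_of_forall_lt (hf : Filter.Tendsto f Filter.cofinite (𝓝 0)) {c : ℝ} (hc : 0 < c)
    (h : ∀ i, ‖f i‖ < c) : ‖∑' i, f i‖ < c := by
  have hfin : {i | ¬ ‖f i‖ < c / 2}.Finite := Filter.eventually_cofinite.1 <|
    (tendsto_zero_iff_norm_tendsto_zero.1 hf).eventually (gt_mem_nhds (half_pos hc))
  obtain ⟨d, hd0, hdc, hd⟩ : ∃ d, 0 ≤ d ∧ d < c ∧ ∀ i ∈ hfin.toFinset, ‖f i‖ ≤ d := by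
    rcases hfin.toFinset.eq_empty_or_nonempty with he | hne
    · exact ⟨0, le_rfl, hc, by rw [he]; simp⟩
    · obtain ⟨j, -, hmax⟩ := hfin.toFinset.exists_max_image (fun i => ‖f i‖) hne
      exact ⟨‖f j‖, norm_nonneg _, h j, hmax⟩
  refine (IsUltrametricDist.norm_tsum_le_of_forall_le_of_nonneg (le_max_of_le_left hd0)
    fun i => ?_).trans_lt (max_lt hdc (half_lt_self hc))
  by_cases hi : ‖f i‖ < c / 2
  · exact le_max_of_le_right hi.le
  · exact le_max_of_le_left (hd i (hfin.mem_toFinset.2 hi))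

variable [CompleteSpace G]

lemma norm_tsum_sub_sum_lt (hf : Filter.Tendsto f Filter.cofinite (𝓝 0)) {c : ℝ} (hc : 0 < c)
    (F : Finset ι) (h : ∀ i ∉ F, ‖f i‖ < c) : ‖∑' i, f i - ∑ i ∈ F, f i‖ < c := by
  have hsum := NonarchimedeanAddGroup.summable_of_tendsto_cofinite_zero hf
  rw [← hsum.sum_add_tsum_compl (s := F), add_sub_cancel_left]
  exact norm_tsum_lt_of_forall_lt (hf.comp Subtype.val_injective.tendsto_cofinite) hc
    fun i => h i i.2

lemma norm_tsum_eq_of_forall_ne_lt (hf : Filter.Tendsto f Filter.cofinite (𝓝 0)) {a : ι}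
    (ha : f a ≠ 0) (h : ∀ i ≠ a, ‖f i‖ < ‖f a‖) : ‖∑' i, f i‖ = ‖f a‖ := by
  have hlt : ‖∑' i, f i - f a‖ < ‖f a‖ := by
    simpa using norm_tsum_sub_sum_lt hf (norm_pos_iff.2 ha) {a} (by simpa using h)
  rw [← sub_add_cancel (∑' i, f i) (f a),
    IsUltrametricDist.norm_add_eq_max_of_norm_ne_norm hlt.ne, max_eq_right hlt.le]

end Tsum

lemma exists_pos_forall_lt_of_lt_mul {ι κ : Type*} {f : ι → ℝ} {g : κ → ℝ} {C D ε : ℝ}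
    (hf0 : ∀ i, 0 ≤ f i) (hg0 : ∀ j, 0 ≤ g j) (hf : ∀ i, f i ≤ C) (hg : ∀ j, g j ≤ D)
    (hε : 0 < ε) : ∃ δ > 0, ∀ i j, ε < f i * g j → δ < f i ∧ δ < g j := by
  have hM : 0 < |C| + |D| + 1 := by positivity
  refine ⟨ε / (|C| + |D| + 1), by positivity, fun i j hij => ?_⟩
  rw [div_lt_iff₀ hM, div_lt_iff₀ hM]
  have hfM : f i ≤ |C| + |D| + 1 := by linarith [hf i, le_abs_self C, abs_nonneg D]
  have hgM : g j ≤ |C| + |D| + 1 := by linarith [hg j, le_abs_self D, abs_nonneg C]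
  constructor
  · exact hij.trans_le (mul_le_mul_of_nonneg_left hgM (hf0 i))
  · exact hij.trans_le ((mul_comm _ _).trans_le (mul_le_mul_of_nonneg_left hfM (hg0 j)))

end Nonarchimedean

section Weight

/-- The weight `p ^ (-r n)` of the exponent `n` in the norm `w_r`. -/
def weight (p : ℕ) (r : ℝ) (n : ℚ) : ℝ := (p : ℝ) ^ (-(r * (n : ℝ)))

variable {p : ℕ} [hp : Fact p.Prime]

lemma one_lt_prime_cast : (1 : ℝ) < p := by exact_mod_cast hp.out.one_lt

lemma prime_cast_pos : (0 : ℝ) < p := zero_lt_one.trans one_lt_prime_cast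

lemma weight_pos (r : ℝ) (n : ℚ) : 0 < weight p r n := Real.rpow_pos_of_pos prime_cast_pos _

lemma weight_add (r : ℝ) (m n : ℚ) : weight p r (m + n) = weight p r m * weight p r n := by
  rw [weight, weight, weight, ← Real.rpow_add prime_cast_pos]
  push_cast
  ring_nf

@[simp] lemma weight_zero (p : ℕ) (r : ℝ) : weight p r 0 = 1 := by simp [weight]

@[simp] lemma weight_zero_left (p : ℕ) (n : ℚ) : weight p 0 n = 1 := by simp [weight]

lemma weight_le_weight {r s : ℝ} {m n : ℚ} (h : s * n ≤ r * m) : weight p r m ≤ weight p s n :=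
  Real.rpow_le_rpow_of_exponent_le one_lt_prime_cast.le (neg_le_neg h)

lemma weight_lt_weight {r s : ℝ} {m n : ℚ} (h : s * n < r * m) : weight p r m < weight p s n :=
  Real.rpow_lt_rpow_of_exponent_lt one_lt_prime_cast (neg_lt_neg h)

lemma tendsto_weight {ι : Type*} {l : Filter ι} {f : ι → ℝ} {g : ι → ℚ}
    (h : Filter.Tendsto (fun i => f i * g i) l Filter.atTop) :
    Filter.Tendsto (fun i => weight p (f i) (g i)) l (𝓝 0) :=
  (tendsto_rpow_atBot_of_base_gt_one _ one_lt_prime_cast).comp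
    (Filter.tendsto_neg_atTop_atBot.comp h)

lemma tendsto_weight_exponent_atTop {r : ℝ} (hr : 0 < r) :
    Filter.Tendsto (weight p r) Filter.atTop (𝓝 0) :=
  tendsto_weight <| (tendsto_ratCast_atTop_iff.2 Filter.tendsto_id).const_mul_atTop hr

lemma tendsto_weight_atTop {n : ℚ} (hn : 0 < n) :
    Filter.Tendsto (fun r => weight p r n) Filter.atTop (𝓝 0) :=
  tendsto_weight <| Filter.tendsto_id.atTop_mul_const (Rat.cast_pos.2 hn)

lemma weight_lt_one {r : ℝ} {n : ℚ} (h : 0 < r * n) : weight p r n < 1 := by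
  simpa using weight_lt_weight (p := p) (s := 0) (n := 0) (by simpa using h)

lemma weight_le_one {r : ℝ} {n : ℚ} (h : 0 ≤ r * n) : weight p r n ≤ 1 := by
  simpa using weight_le_weight (p := p) (s := 0) (n := 0) (by simpa using h)

end Weight

section TermNorm

variable {E : Type*} [NormedField E]

/-- The norm `|x_n| p ^ (-r n)` of the term of exponent `n` of `x`, whose supremum is `w_r(x)`. -/
def termNorm (p : ℕ) (r : ℝ) (x : ℚ → E) (n : ℚ) : ℝ := ‖x n‖ * weight p r n

/-- The bound `w_r(x) ≤ c`, as a statement about real numbers. -/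
def NormLE (p : ℕ) (r : ℝ) (x : ℚ → E) (c : ℝ) : Prop := ∀ n, termNorm p r x n ≤ c

@[simp] lemma termNorm_zero_left (p : ℕ) (x : ℚ → E) (n : ℚ) : termNorm p 0 x n = ‖x n‖ := by
  simp [termNorm]

@[simp] lemma termNorm_zero_exponent (p : ℕ) (r : ℝ) (x : ℚ → E) :
    termNorm p r x 0 = ‖x 0‖ := by
  simp [termNorm]

lemma termNorm_of_eq_zero (p : ℕ) (r : ℝ) {x : ℚ → E} {n : ℚ} (h : x n = 0) :
    termNorm p r x n = 0 := by
  simp [termNorm, h]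

lemma termNorm_neg (p : ℕ) (r : ℝ) (x : ℚ → E) (n : ℚ) :
    termNorm p r (-x) n = termNorm p r x n := by
  simp [termNorm]

lemma termNorm_smul (p : ℕ) (r : ℝ) (a : E) (x : ℚ → E) (n : ℚ) :
    termNorm p r (a • x) n = ‖a‖ * termNorm p r x n := by
  simp [termNorm, mul_assoc]

variable {p : ℕ} {r c d : ℝ} {x y : ℚ → E} {n : ℚ}

lemma NormLE.mono (h : NormLE p r x c) (hcd : c ≤ d) : NormLE p r x d := fun n => (h n).trans hcd

lemma NormLE.neg (h : NormLE p r x c) : NormLE p r (-x) c := fun n =>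
  (termNorm_neg p r x n).trans_le (h n)

lemma NormLE.smul (h : NormLE p r x c) (a : E) : NormLE p r (a • x) (‖a‖ * c) := fun n =>
  (termNorm_smul p r a x n).trans_le (mul_le_mul_of_nonneg_left (h n) (norm_nonneg a))

lemma normLE_zero (p : ℕ) (r : ℝ) : NormLE p r (0 : ℚ → E) 0 := fun _ =>
  (termNorm_of_eq_zero p r rfl).le

variable [Fact p.Prime]

lemma termNorm_nonneg (r : ℝ) (x : ℚ → E) (n : ℚ) : 0 ≤ termNorm p r x n :=
  mul_nonneg (norm_nonneg _) (weight_pos r n).le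

lemma termNorm_pos (h : x n ≠ 0) : 0 < termNorm p r x n :=
  mul_pos (norm_pos_iff.2 h) (weight_pos r n)

lemma termNorm_pos_iff : 0 < termNorm p r x n ↔ x n ≠ 0 :=
  ⟨fun h h0 => h.ne' (termNorm_of_eq_zero p r h0), termNorm_pos⟩

lemma norm_mul_mul_weight (r : ℝ) (x y : ℚ → E) (i n : ℚ) :
    ‖x i * y (n - i)‖ * weight p r n = termNorm p r x i * termNorm p r y (n - i) := by
  have hw : weight p r n = weight p r i * weight p r (n - i) := by
    rw [← weight_add, add_sub_cancel]
  rw [termNorm, termNorm, norm_mul, hw, mul_mul_mul_comm]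

lemma NormLE.nonneg (h : NormLE p r x c) : 0 ≤ c := (termNorm_nonneg r x 0).trans (h 0)

lemma eq_zero_of_forall_normLE (h : ∀ ε : ℝ, 0 < ε → NormLE p r x ε) : x = 0 := by
  funext n
  by_contra hn
  have hpos : 0 < termNorm p r x n := termNorm_pos hn
  exact (h _ (half_pos hpos) n).not_gt (half_lt_self hpos)

lemma normLE_single (q : ℚ) (a : E) :
    NormLE p r (Pi.single q a) (‖a‖ * weight p r q) := fun n => by
  rcases eq_or_ne n q with rfl | h
  · simp [termNorm]
  · rw [termNorm_of_eq_zero p r (by simp [h])]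
    exact mul_nonneg (norm_nonneg a) (weight_pos r q).le

lemma normLE_one (r : ℝ) : NormLE p r (seriesOne : ℚ → E) 1 := by
  simpa [seriesOne, tPow] using normLE_single (p := p) (r := r) 0 (1 : E)

variable [IsUltrametricDist E]

lemma termNorm_add_le (r : ℝ) (x y : ℚ → E) (n : ℚ) :
    termNorm p r (x + y) n ≤ max (termNorm p r x n) (termNorm p r y n) := by
  rw [termNorm, termNorm, termNorm, ← max_mul_of_nonneg _ _ (weight_pos r n).le]
  exact mul_le_mul_of_nonneg_right (IsUltrametricDist.norm_add_le_max _ _) (weight_pos r n).le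

lemma NormLE.add (hx : NormLE p r x c) (hy : NormLE p r y c) : NormLE p r (x + y) c := fun n =>
  (termNorm_add_le r x y n).trans (max_le (hx n) (hy n))

lemma NormLE.sub (hx : NormLE p r x c) (hy : NormLE p r y c) : NormLE p r (x - y) c :=
  sub_eq_add_neg x y ▸ hx.add hy.neg

end TermNorm

section GaussSpace

variable {p : ℕ} [Fact p.Prime] {E : Type*} [NormedField E] [IsUltrametricDist E]

/-- The space of the series with `w_r(x) < ∞` for which, for each `ε > 0`, the exponents of the
terms of norm larger than `ε` form a well-ordered set. On it the product of series is given by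
convergent sums. -/
def gaussSpace (p : ℕ) [Fact p.Prime] (E : Type*) [NormedField E] [IsUltrametricDist E] (r : ℝ) :
    Submodule E (ℚ → E) where
  carrier := {x | (∃ c, NormLE p r x c) ∧ ∀ ε : ℝ, 0 < ε → {n | ε < termNorm p r x n}.IsWF}
  zero_mem' := ⟨⟨0, normLE_zero p r⟩, fun ε hε => Set.isWF_empty.mono fun n hn =>
    hε.not_gt (lt_of_lt_of_le hn (normLE_zero p r n))⟩
  add_mem' := by
    rintro x y ⟨⟨c, hc⟩, hx⟩ ⟨⟨d, hd⟩, hy⟩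
    refine ⟨⟨max c d, (hc.mono (le_max_left _ _)).add (hd.mono (le_max_right _ _))⟩,
      fun ε hε => ((hx ε hε).union (hy ε hε)).mono fun n hn => ?_⟩
    exact lt_max_iff.1 (lt_of_lt_of_le hn (termNorm_add_le r x y n))
  smul_mem' := by
    rintro a x ⟨⟨c, hc⟩, hx⟩
    refine ⟨⟨_, hc.smul a⟩, fun ε hε => (hx (ε / (‖a‖ + 1)) (by positivity)).mono fun n hn => ?_⟩
    rw [Set.mem_ofPred_eq, termNorm_smul] at hn
    rw [Set.mem_ofPred_eq, div_lt_iff₀ (by positivity)]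
    linarith [termNorm_nonneg (p := p) r x n]

variable {r s : ℝ} {x y z : ℚ → E}

lemma mem_gaussSpace_of_termNorm_le {K : ℝ} (hK : 0 < K) (hx : x ∈ gaussSpace p E r)
    (h : ∀ n, termNorm p s y n ≤ K * termNorm p r x n) : y ∈ gaussSpace p E s := by
  obtain ⟨⟨c, hc⟩, hx⟩ := hx
  refine ⟨⟨K * c, fun n => (h n).trans (mul_le_mul_of_nonneg_left (hc n) hK.le)⟩,
    fun ε hε => (hx (ε / K) (by positivity)).mono fun n hn => ?_⟩
  rw [Set.mem_ofPred_eq, div_lt_iff₀ hK, mul_comm]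
  exact lt_of_lt_of_le hn (h n)

lemma mem_gaussSpace_of_forall_exists_sub
    (h : ∀ ε : ℝ, 0 < ε → ∃ y ∈ gaussSpace p E r, NormLE p r (x - y) ε) :
    x ∈ gaussSpace p E r := by
  have hle (y : ℚ → E) (n : ℚ) :
      termNorm p r x n ≤ max (termNorm p r (x - y) n) (termNorm p r y n) := by
    simpa using termNorm_add_le r (x - y) y n
  refine ⟨?_, fun ε hε => ?_⟩
  · obtain ⟨y, ⟨⟨c, hc⟩, -⟩, hxy⟩ := h 1 one_pos
    exact ⟨_, fun n => (hle y n).trans (max_le_max (hxy n) (hc n))⟩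
  · obtain ⟨y, hy, hxy⟩ := h ε hε
    exact (hy.2 ε hε).mono fun n hn =>
      (lt_max_iff.1 (lt_of_lt_of_le hn (hle y n))).resolve_left (hxy n).not_gt

lemma single_mem_gaussSpace (r : ℝ) (q : ℚ) (a : E) :
    Pi.single q a ∈ gaussSpace p E r :=
  ⟨⟨_, normLE_single q a⟩, fun ε hε => (Set.finite_singleton q).isWF.mono fun n hn => by
    by_contra hnq
    exact hε.not_gt (hn.trans_eq (termNorm_of_eq_zero p r (Pi.single_eq_of_ne hnq _)))⟩

lemma tPow_mem_gaussSpace (r : ℝ) (q : ℚ) : (tPow q : ℚ → E) ∈ gaussSpace p E r :=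
  single_mem_gaussSpace r q 1

lemma one_mem_gaussSpace (r : ℝ) : (seriesOne : ℚ → E) ∈ gaussSpace p E r :=
  tPow_mem_gaussSpace r 0

end GaussSpace

section Product

variable {p : ℕ} [Fact p.Prime] {E : Type*} [NormedField E] [IsUltrametricDist E]
  {r c d : ℝ} {x y z : ℚ → E} {n : ℚ}

lemma exists_isWF_of_lt_termNorm_mul (hx : x ∈ gaussSpace p E r) (hy : y ∈ gaussSpace p E r)
    {ε : ℝ} (hε : 0 < ε) : ∃ X Y : Set ℚ, X.IsWF ∧ Y.IsWF ∧
      ∀ i j, ε < termNorm p r x i * termNorm p r y j → i ∈ X ∧ j ∈ Y := by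
  obtain ⟨⟨c, hc⟩, hx⟩ := hx
  obtain ⟨⟨d, hd⟩, hy⟩ := hy
  obtain ⟨δ, hδ, h⟩ := exists_pos_forall_lt_of_lt_mul (termNorm_nonneg r x) (termNorm_nonneg r y)
    hc hd hε
  exact ⟨_, _, hx δ hδ, hy δ hδ, h⟩

lemma exists_isWF_of_lt_termNorm_mul_mul (hx : x ∈ gaussSpace p E r) (hy : y ∈ gaussSpace p E r)
    (hz : z ∈ gaussSpace p E r) {ε : ℝ} (hε : 0 < ε) :
    ∃ X Y Z : Set ℚ, X.IsWF ∧ Y.IsWF ∧ Z.IsWF ∧ ∀ i j k,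
      ε < termNorm p r x i * (termNorm p r y j * termNorm p r z k) → i ∈ X ∧ j ∈ Y ∧ k ∈ Z := by
  obtain ⟨⟨c, hc⟩, hx⟩ := hx
  obtain ⟨b, hb⟩ := hy.1
  obtain ⟨d, hd⟩ := hz.1
  obtain ⟨δ, hδ, h⟩ := exists_pos_forall_lt_of_lt_mul
    (g := fun q : ℚ × ℚ => termNorm p r y q.1 * termNorm p r z q.2) (termNorm_nonneg r x)
    (fun q => mul_nonneg (termNorm_nonneg r y _) (termNorm_nonneg r z _)) hc
    (fun q => mul_le_mul (hb _) (hd _) (termNorm_nonneg r z _) hb.nonneg) hε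
  obtain ⟨Y, Z, hY, hZ, hYZ⟩ := exists_isWF_of_lt_termNorm_mul hy hz hδ
  exact ⟨_, Y, Z, hx δ hδ, hY, hZ, fun i j k hijk =>
    ⟨(h i (j, k) hijk).1, hYZ j k (h i (j, k) hijk).2⟩⟩

lemma tendsto_mul_coeff_cofinite (hx : x ∈ gaussSpace p E r) (hy : y ∈ gaussSpace p E r) (n : ℚ) :
    Filter.Tendsto (fun i => x i * y (n - i)) Filter.cofinite (𝓝 0) := by
  refine tendsto_cofinite_zero_of_finite_lt fun ε hε => ?_
  have hw : 0 < weight p r n := weight_pos r n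
  obtain ⟨X, Y, hX, hY, hXY⟩ := exists_isWF_of_lt_termNorm_mul hx hy (mul_pos hε hw)
  refine ((Set.AddAntidiagonal.finite_of_isPWO hX.isPWO hY.isPWO n).image Prod.fst).subset
    fun i hi => ?_
  have hlt : ε * weight p r n < termNorm p r x i * termNorm p r y (n - i) := by
    rw [← norm_mul_mul_weight]
    exact mul_lt_mul_of_pos_right hi hw
  exact ⟨(i, n - i), ⟨(hXY i _ hlt).1, (hXY i _ hlt).2, by simp⟩, rfl⟩

open scoped Pointwise in
lemma tendsto_mul_mul_coeff_cofinite (hx : x ∈ gaussSpace p E r) (hy : y ∈ gaussSpace p E r)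
    (hz : z ∈ gaussSpace p E r) (n : ℚ) :
    Filter.Tendsto (fun q : ℚ × ℚ => x q.1 * y (q.2 - q.1) * z (n - q.2)) Filter.cofinite
      (𝓝 0) := by
  refine tendsto_cofinite_zero_of_finite_lt fun ε hε => ?_
  have hw : 0 < weight p r n := weight_pos r n
  obtain ⟨X, Y, Z, hX, hY, hZ, hXYZ⟩ :=
    exists_isWF_of_lt_termNorm_mul_mul hx hy hz (mul_pos hε hw)
  refine ((Set.AddAntidiagonal.finite_of_isPWO (hX.isPWO.add hY.isPWO) hZ.isPWO n).biUnion
    fun m _ => (Set.AddAntidiagonal.finite_of_isPWO hX.isPWO hY.isPWO m.1).image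
      fun q => (q.1, m.1)).subset ?_
  rintro ⟨j, i⟩ hi
  have hterm : ‖x j * y (i - j) * z (n - i)‖ * weight p r n =
      termNorm p r x j * (termNorm p r y (i - j) * termNorm p r z (n - i)) := by
    have hwn : weight p r n = weight p r j * (weight p r (i - j) * weight p r (n - i)) := by
      rw [← weight_add, ← weight_add]; ring_nf
    rw [hwn, norm_mul, norm_mul, termNorm, termNorm, termNorm]
    ring
  obtain ⟨hjX, hijY, hniZ⟩ := hXYZ _ _ _ <|
    (mul_lt_mul_of_pos_right hi hw).trans_eq hterm
  have hiXY : i ∈ X + Y := Set.mem_add.2 ⟨j, hjX, i - j, hijY, by simp⟩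
  exact Set.mem_iUnion₂.2 ⟨(i, n - i), ⟨hiXY, hniZ, by simp⟩, (j, i - j), ⟨hjX, hijY, by simp⟩, rfl⟩

lemma termNorm_seriesMul_le (hc : 0 ≤ c)
    (h : ∀ i, termNorm p r x i * termNorm p r y (n - i) ≤ c) :
    termNorm p r (seriesMul x y) n ≤ c := by
  have hw : 0 < weight p r n := weight_pos r n
  rw [termNorm, ← le_div_iff₀ hw]
  refine IsUltrametricDist.norm_tsum_le_of_forall_le_of_nonneg (by positivity) fun i => ?_
  rw [le_div_iff₀ hw, norm_mul_mul_weight]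
  exact h i

lemma termNorm_seriesMul_lt (hx : x ∈ gaussSpace p E r) (hy : y ∈ gaussSpace p E r) (hc : 0 < c)
    (h : ∀ i, termNorm p r x i * termNorm p r y (n - i) < c) :
    termNorm p r (seriesMul x y) n < c := by
  have hw : 0 < weight p r n := weight_pos r n
  rw [termNorm, ← lt_div_iff₀ hw]
  refine norm_tsum_lt_of_forall_lt (tendsto_mul_coeff_cofinite hx hy n) (by positivity) fun i => ?_
  rw [lt_div_iff₀ hw, norm_mul_mul_weight]
  exact h i

lemma NormLE.mul (hx : NormLE p r x c) (hy : NormLE p r y d) :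
    NormLE p r (seriesMul x y) (c * d) := fun _ =>
  termNorm_seriesMul_le (mul_nonneg hx.nonneg hy.nonneg) fun _ =>
    mul_le_mul (hx _) (hy _) (termNorm_nonneg _ _ _) hx.nonneg

lemma mul_mem_gaussSpace (hx : x ∈ gaussSpace p E r) (hy : y ∈ gaussSpace p E r) :
    seriesMul x y ∈ gaussSpace p E r := by
  obtain ⟨c, hc⟩ := hx.1
  obtain ⟨d, hd⟩ := hy.1
  refine ⟨⟨_, hc.mul hd⟩, fun ε hε => ?_⟩
  obtain ⟨X, Y, hX, hY, hXY⟩ := exists_isWF_of_lt_termNorm_mul hx hy hε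
  refine (hX.isPWO.add hY.isPWO).isWF.mono fun n hn => ?_
  obtain ⟨i, hi⟩ : ∃ i, ε < termNorm p r x i * termNorm p r y (n - i) := by
    by_contra! hle
    exact (termNorm_seriesMul_le hε.le hle).not_gt hn
  exact Set.mem_add.2 ⟨i, (hXY _ _ hi).1, n - i, (hXY _ _ hi).2, by simp⟩

end Product

section Ring

variable {E : Type*} [NormedField E]

lemma seriesMul_comm (x y : ℚ → E) : seriesMul x y = seriesMul y x := by
  funext n
  rw [seriesMul, seriesMul, ← (Equiv.subLeft n).tsum_eq]
  exact tsum_congr fun i => by simp [mul_comm]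

lemma single_seriesMul (q : ℚ) (a : E) (x : ℚ → E) (n : ℚ) :
    seriesMul (Pi.single q a) x n = a * x (n - q) := by
  rw [seriesMul, tsum_eq_single q fun i hi => by simp [hi], Pi.single_eq_same]

lemma tPow_seriesMul (q : ℚ) (x : ℚ → E) (n : ℚ) : seriesMul (tPow q) x n = x (n - q) := by
  rw [tPow, single_seriesMul, one_mul]

lemma seriesOne_seriesMul (x : ℚ → E) : seriesMul seriesOne x = x := by
  funext n
  rw [seriesOne, tPow_seriesMul, sub_zero]

lemma seriesMul_seriesOne (x : ℚ → E) : seriesMul x seriesOne = x := by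
  rw [seriesMul_comm, seriesOne_seriesMul]

lemma smul_seriesMul (a : E) (x y : ℚ → E) : seriesMul (a • x) y = a • seriesMul x y := by
  funext n
  simp only [seriesMul, Pi.smul_apply, smul_eq_mul, mul_assoc]
  exact tsum_mul_left

lemma seriesMul_smul (a : E) (x y : ℚ → E) : seriesMul x (a • y) = a • seriesMul x y := by
  rw [seriesMul_comm, smul_seriesMul, seriesMul_comm]

variable {p : ℕ} [Fact p.Prime] [IsUltrametricDist E] [CompleteSpace E] {r : ℝ} {x y z : ℚ → E}

lemma seriesMul_add (hx : x ∈ gaussSpace p E r) (hy : y ∈ gaussSpace p E r)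
    (hz : z ∈ gaussSpace p E r) : seriesMul x (y + z) = seriesMul x y + seriesMul x z := by
  have hsum {u v : ℚ → E} (hu : u ∈ gaussSpace p E r) (hv : v ∈ gaussSpace p E r) (n : ℚ) :
      Summable fun i => u i * v (n - i) :=
    NonarchimedeanAddGroup.summable_of_tendsto_cofinite_zero (tendsto_mul_coeff_cofinite hu hv n)
  funext n
  simp only [seriesMul, Pi.add_apply, mul_add]
  exact (hsum hx hy n).tsum_add (hsum hx hz n)

lemma seriesMul_assoc (hx : x ∈ gaussSpace p E r) (hy : y ∈ gaussSpace p E r)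
    (hz : z ∈ gaussSpace p E r) : seriesMul (seriesMul x y) z = seriesMul x (seriesMul y z) := by
  funext n
  have hcomm := (NonarchimedeanAddGroup.summable_of_tendsto_cofinite_zero
    (tendsto_mul_mul_coeff_cofinite hx hy hz n)).tsum_comm
    (f := fun j i => x j * y (i - j) * z (n - i))
  simp only [seriesMul]
  calc ∑' i, (∑' j, x j * y (i - j)) * z (n - i)
      = ∑' i, ∑' j, x j * y (i - j) * z (n - i) := tsum_congr fun i => tsum_mul_right.symm
    _ = ∑' j, ∑' i, x j * y (i - j) * z (n - i) := hcomm
    _ = ∑' j, x j * ∑' k, y k * z (n - j - k) := by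
        refine tsum_congr fun j => ?_
        rw [← tsum_mul_left, ← (Equiv.addRight j).tsum_eq]
        refine tsum_congr fun k => ?_
        simp only [Equiv.coe_addRight]
        rw [add_sub_cancel_right, mul_assoc, sub_sub, add_comm k j]

instance gaussSpace.instCommRing (r : ℝ) : CommRing (gaussSpace p E r) where
  __ := (inferInstance : AddCommGroup (gaussSpace p E r))
  mul x y := ⟨seriesMul x.1 y.1, mul_mem_gaussSpace x.2 y.2⟩
  one := ⟨seriesOne, one_mem_gaussSpace r⟩
  mul_assoc x y z := Subtype.ext (seriesMul_assoc x.2 y.2 z.2)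
  mul_comm x y := Subtype.ext (seriesMul_comm x.1 y.1)
  one_mul x := Subtype.ext (seriesOne_seriesMul x.1)
  mul_one x := Subtype.ext (seriesMul_seriesOne x.1)
  left_distrib x y z := Subtype.ext (seriesMul_add x.2 y.2 z.2)
  right_distrib x y z := Subtype.ext <| (seriesMul_comm _ _).trans <|
    (seriesMul_add z.2 x.2 y.2).trans <| congrArg₂ _ (seriesMul_comm _ _) (seriesMul_comm _ _)
  zero_mul x := Subtype.ext <| funext fun n => by
    change ∑' i : ℚ, (0 : ℚ → E) i * x.1 (n - i) = 0
    simp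
  mul_zero x := Subtype.ext <| funext fun n => by
    change ∑' i : ℚ, x.1 i * (0 : ℚ → E) (n - i) = 0
    simp

lemma coe_mul_gaussSpace (x y : gaussSpace p E r) :
    ((x * y : gaussSpace p E r) : ℚ → E) = seriesMul x y := rfl

end Ring

/-! ### Newton polygons and dominant terms -/

section Dominant

variable {p : ℕ} {E : Type*} [NormedField E] {σ : ℚ} {r : ℝ} {x y : ℚ → E} {a b : ℚ}

/-- The term of exponent `a` of `x` is dominant for `w_r`: it is of maximal norm and, among the
terms of maximal norm, it is the one of lowest exponent if `σ > 0`, and the one of highest exponent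
if `σ < 0`. -/
def IsDominant (p : ℕ) (σ : ℚ) (r : ℝ) (x : ℚ → E) (a : ℚ) : Prop :=
  x a ≠ 0 ∧ ∀ n, termNorm p r x n ≤ termNorm p r x a ∧
    (σ * n < σ * a → termNorm p r x n < termNorm p r x a)

lemma IsDominant.unique (hσ : σ ≠ 0) (ha : IsDominant p σ r x a) (hb : IsDominant p σ r x b) :
    a = b := by
  rcases lt_trichotomy (σ * a) (σ * b) with h | h | h
  · exact absurd ((hb.2 a).2 h) (ha.2 b).1.not_gt
  · exact mul_left_cancel₀ hσ h
  · exact absurd ((ha.2 b).2 h) (hb.2 a).1.not_gt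

variable [Fact p.Prime]

lemma IsDominant.termNorm_mul_lt {i j : ℚ} (ha : IsDominant p σ r x a) (hb : IsDominant p σ r y b)
    (h : σ * i < σ * a ∨ σ * j < σ * b) :
    termNorm p r x i * termNorm p r y j < termNorm p r x a * termNorm p r y b := by
  rcases h with h | h
  · exact (mul_le_mul_of_nonneg_left (hb.2 j).1 (termNorm_nonneg _ _ _)).trans_lt
      (mul_lt_mul_of_pos_right ((ha.2 i).2 h) (termNorm_pos hb.1))
  · exact mul_lt_mul' (ha.2 i).1 ((hb.2 j).2 h) (termNorm_nonneg _ _ _) (termNorm_pos ha.1)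

variable [IsUltrametricDist E] [CompleteSpace E]

lemma IsDominant.termNorm_seriesMul (hσ : σ ≠ 0) (hx : x ∈ gaussSpace p E r)
    (hy : y ∈ gaussSpace p E r) (ha : IsDominant p σ r x a) (hb : IsDominant p σ r y b) :
    termNorm p r (seriesMul x y) (a + b) = termNorm p r x a * termNorm p r y b := by
  have hw : 0 < weight p r (a + b) := weight_pos r _
  have hmain : ‖∑' i, x i * y (a + b - i)‖ = ‖x a * y (a + b - a)‖ := by
    refine norm_tsum_eq_of_forall_ne_lt (f := fun i => x i * y (a + b - i))
      (tendsto_mul_coeff_cofinite hx hy (a + b)) ?_ fun i hi => ?_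
    · simpa using ⟨ha.1, hb.1⟩
    · refine lt_of_mul_lt_mul_right ?_ hw.le
      rw [norm_mul_mul_weight, norm_mul_mul_weight, add_sub_cancel_left]
      refine ha.termNorm_mul_lt hb
        (((mul_right_injective₀ hσ).ne hi).lt_or_gt.imp_right fun h => ?_)
      rw [mul_sub, mul_add]
      linarith
  rw [termNorm, seriesMul, hmain, norm_mul_mul_weight, add_sub_cancel_left]

protected lemma IsDominant.seriesMul (hσ : σ ≠ 0) (hx : x ∈ gaussSpace p E r)
    (hy : y ∈ gaussSpace p E r) (ha : IsDominant p σ r x a) (hb : IsDominant p σ r y b) :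
    IsDominant p σ r (seriesMul x y) (a + b) := by
  have hab : 0 < termNorm p r x a * termNorm p r y b :=
    mul_pos (termNorm_pos ha.1) (termNorm_pos hb.1)
  have hmain := ha.termNorm_seriesMul hσ hx hy hb
  refine ⟨termNorm_pos_iff.1 (hmain ▸ hab), fun n => hmain ▸ ⟨?_, fun hn => ?_⟩⟩
  · exact termNorm_seriesMul_le hab.le fun i =>
      mul_le_mul (ha.2 i).1 (hb.2 _).1 (termNorm_nonneg _ _ _) (termNorm_nonneg _ _ _)
  · refine termNorm_seriesMul_lt hx hy hab fun i => ha.termNorm_mul_lt hb ?_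
    by_contra! h
    rw [mul_add] at hn
    rw [mul_sub] at h
    linarith

end Dominant

section Slope

lemma mem_convexHull_face {V : Type*} [AddCommGroup V] [Module ℝ V] {A : Set V} (f : V →ₗ[ℝ] ℝ)
    {m : ℝ} (hA : ∀ Z ∈ A, m ≤ f Z) {P : V} (hP : P ∈ convexHull ℝ A) (hfP : f P = m) :
    P ∈ convexHull ℝ {Z ∈ A | f Z = m} := by
  let F : Set V := {Z | m ≤ f Z ∧ (f Z = m → Z ∈ convexHull ℝ {Z ∈ A | f Z = m})}
  have hAF : A ⊆ F := fun Z hZ => ⟨hA Z hZ, fun h => subset_convexHull ℝ _ ⟨hZ, h⟩⟩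
  suffices hF : Convex ℝ F from (convexHull_min hAF hF hP).2 hfP
  rintro Y ⟨hY, hYF⟩ Z ⟨hZ, hZF⟩ a b ha hb hab
  have hsub : f (a • Y + b • Z) - m = a * (f Y - m) + b * (f Z - m) := by
    simp only [map_add, map_smul, smul_eq_mul]
    linear_combination m * hab
  have haY : 0 ≤ a * (f Y - m) := mul_nonneg ha (sub_nonneg.2 hY)
  have hbZ : 0 ≤ b * (f Z - m) := mul_nonneg hb (sub_nonneg.2 hZ)
  refine ⟨by linarith, fun heq => ?_⟩
  rcases ha.eq_or_lt with rfl | ha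
  · obtain rfl : b = 1 := by linarith
    simpa using hZF (by linarith)
  rcases hb.eq_or_lt with rfl | hb
  · obtain rfl : a = 1 := by linarith
    simpa using hYF (by linarith)
  have hYm : f Y = m := by
    linarith [(mul_eq_zero.1 (by linarith : a * (f Y - m) = 0)).resolve_left ha.ne']
  have hZm : f Z = m := by
    linarith [(mul_eq_zero.1 (by linarith : b * (f Z - m) = 0)).resolve_left hb.ne']
  exact convex_convexHull ℝ _ (hYF hYm) (hZF hZm) ha.le hb.le hab

variable {p : ℕ} {E : Type*} [NormedField E] {s : ℝ} {x : ℚ → E}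

lemma mem_newtonRegion {i : ℚ} (hi : x i ≠ 0) : ((i : ℝ), vp p (x i)) ∈ newtonRegion p x :=
  subset_convexHull ℝ _ ⟨i, hi, rfl, le_rfl⟩

/-- The linear form `(n, v) ↦ s n + v`, whose level sets are the lines of slope `-s`. -/
def lineForm (s : ℝ) : ℝ × ℝ →ₗ[ℝ] ℝ := s • LinearMap.fst ℝ ℝ ℝ + LinearMap.snd ℝ ℝ ℝ

lemma lineForm_apply (s : ℝ) (Z : ℝ × ℝ) : lineForm s Z = s * Z.1 + Z.2 := by
  simp [lineForm]

lemma le_lineForm_of_mem_newtonRegion {m : ℝ} (h : ∀ i : ℚ, x i ≠ 0 → m ≤ s * i + vp p (x i))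
    {Z : ℝ × ℝ} (hZ : Z ∈ newtonRegion p x) : m ≤ lineForm s Z := by
  refine convexHull_min ?_ (convex_halfSpace_ge (lineForm s).isLinear m) hZ
  rintro Y ⟨i, hi, hY1, hY2⟩
  rw [Set.mem_ofPred_eq, lineForm_apply, hY1]
  linarith [h i hi]

lemma exists_exponent_bounds_of_mem_face {m : ℝ}
    (h : ∀ i : ℚ, x i ≠ 0 → m ≤ s * i + vp p (x i)) {P : ℝ × ℝ} (hP : P ∈ newtonRegion p x)
    (hPm : lineForm s P = m) : ∃ i j : ℚ, (i : ℝ) ≤ P.1 ∧ P.1 ≤ j ∧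
      (x i ≠ 0 ∧ s * i + vp p (x i) = m) ∧ (x j ≠ 0 ∧ s * j + vp p (x j) = m) := by
  have hface := mem_convexHull_face (lineForm s)
    (fun Z hZ => le_lineForm_of_mem_newtonRegion h (subset_convexHull ℝ _ hZ)) hP hPm
  have heq {Z : ℝ × ℝ} {i : ℚ} (hi : x i ≠ 0) (hZ1 : Z.1 = i) (hZ2 : vp p (x i) ≤ Z.2)
      (hZ : lineForm s Z = m) : x i ≠ 0 ∧ s * i + vp p (x i) = m := by
    rw [lineForm_apply, hZ1] at hZ
    exact ⟨hi, le_antisymm (by linarith) (h i hi)⟩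
  have hfst : IsLinearMap ℝ (Prod.fst : ℝ × ℝ → ℝ) := (LinearMap.fst ℝ ℝ ℝ).isLinear
  obtain ⟨Y, ⟨⟨i, hi, hY1, hY2⟩, hYm⟩, hiP⟩ :=
    (hfst.mk'.concaveOn convex_univ).exists_le_of_mem_convexHull (Set.subset_univ _) hface
  obtain ⟨Z, ⟨⟨j, hj, hZ1, hZ2⟩, hZm⟩, hPj⟩ :=
    (hfst.mk'.convexOn convex_univ).exists_ge_of_mem_convexHull (Set.subset_univ _) hface
  exact ⟨i, j, hY1 ▸ hiP, hZ1 ▸ hPj, heq hi hY1 hY2 hYm, heq hj hZ1 hZ2 hZm⟩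

variable [Fact p.Prime]

lemma logb_termNorm {r : ℝ} {n : ℚ} (h : x n ≠ 0) :
    Real.logb p (termNorm p r x n) = -(r * n + vp p (x n)) := by
  rw [termNorm, Real.logb_mul (norm_ne_zero_iff.2 h) (weight_pos r n).ne', weight, vp,
    Real.logb_rpow prime_cast_pos one_lt_prime_cast.ne']
  ring

lemma termNorm_le_termNorm_iff {r : ℝ} {i j : ℚ} (hi : x i ≠ 0) (hj : x j ≠ 0) :
    termNorm p r x i ≤ termNorm p r x j ↔ r * j + vp p (x j) ≤ r * i + vp p (x i) := by
  rw [← Real.logb_le_logb (one_lt_prime_cast (p := p)) (termNorm_pos hi) (termNorm_pos hj),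
    logb_termNorm hi, logb_termNorm hj, neg_le_neg_iff]

lemma exists_termNorm_eq_of_isSlope (h : IsSlope p x s) : ∃ i j : ℚ, i < j ∧ x i ≠ 0 ∧ x j ≠ 0 ∧
    termNorm p s x i = termNorm p s x j ∧ ∀ n, termNorm p s x n ≤ termNorm p s x i := by
  obtain ⟨-, P, hP, Q, hQ, hPQ, hslope, hmin⟩ := h
  have hm (i : ℚ) (hi : x i ≠ 0) : lineForm s P ≤ s * i + vp p (x i) := by
    have hle := hmin _ (mem_newtonRegion (p := p) hi)
    rw [lineForm_apply]
    simp only at hle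
    linarith
  have hQm : lineForm s Q = lineForm s P := by
    rw [lineForm_apply, lineForm_apply]
    linarith
  obtain ⟨i, -, hiP, -, ⟨hi, him⟩, -⟩ := exists_exponent_bounds_of_mem_face hm hP rfl
  obtain ⟨-, j, -, hQj, -, hj, hjm⟩ := exists_exponent_bounds_of_mem_face hm hQ hQm
  refine ⟨i, j, by exact_mod_cast hiP.trans_lt (hPQ.trans_le hQj), hi, hj,
    le_antisymm ?_ ?_, fun n => ?_⟩
  · rw [termNorm_le_termNorm_iff hi hj, him, hjm]
  · rw [termNorm_le_termNorm_iff hj hi, him, hjm]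
  · by_cases hn : x n = 0
    · exact (termNorm_of_eq_zero p s hn).trans_le (termNorm_nonneg s x i)
    · rw [termNorm_le_termNorm_iff hn hi, him]
      exact hm n hn

lemma isSlope_of_termNorm_eq (hs : 0 < s) {i j : ℚ} (hij : i < j) (hi : x i ≠ 0) (hj : x j ≠ 0)
    (heq : termNorm p s x i = termNorm p s x j)
    (hmax : ∀ n, termNorm p s x n ≤ termNorm p s x i) : IsSlope p x s := by
  have hij' : s * i + vp p (x i) = s * j + vp p (x j) :=
    le_antisymm ((termNorm_le_termNorm_iff hj hi).1 heq.ge)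
      ((termNorm_le_termNorm_iff hi hj).1 heq.le)
  refine ⟨hs, _, mem_newtonRegion hi, _, mem_newtonRegion hj, Rat.cast_lt.2 hij,
    by simp only; linarith, fun Z hZ => ?_⟩
  have hle := le_lineForm_of_mem_newtonRegion
    (fun n hn => (termNorm_le_termNorm_iff hn hi).1 (hmax n)) hZ
  rw [lineForm_apply] at hle
  simp only
  linarith

lemma isSlope_iff_of_isDominant {a b : ℚ} (ha : IsDominant p 1 s x a)
    (hb : IsDominant p (-1) s x b) : IsSlope p x s ↔ 0 < s ∧ a ≠ b := by
  refine ⟨fun h => ⟨h.1, ?_⟩, fun ⟨hs, hab⟩ => ?_⟩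
  · rintro rfl
    obtain ⟨i, j, hij, -, -, heq, hmax⟩ := exists_termNorm_eq_of_isSlope h
    have hai : a ≤ i := not_lt.1 fun _ => ((ha.2 i).2 (by linarith)).not_ge (hmax a)
    have hja : j ≤ a := not_lt.1 fun _ => ((hb.2 j).2 (by linarith)).not_ge (heq ▸ hmax a)
    linarith
  · refine isSlope_of_termNorm_eq hs (lt_of_le_of_ne ?_ hab) ha.1 hb.1
      (le_antisymm (hb.2 a).1 (ha.2 b).1) fun n => (ha.2 n).1
    exact not_lt.1 fun _ => ((ha.2 b).2 (by linarith)).not_ge (hb.2 a).1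

end Slope

section Discrete

/-- The norm of `E` is discrete: its nonzero values are discrete in `(0, ∞)`, as they are for a
finite extension of a field of Witt vectors. -/
def HasDiscreteNorm (E : Type*) [NormedField E] : Prop :=
  ∀ c C : ℝ, 0 < c → (Set.range (norm : E → ℝ) ∩ Set.Icc c C).Finite

lemma HasDiscreteNorm.exists_one_lt_forall_le_norm {E : Type*} [NormedField E]
    (hE : HasDiscreteNorm E) : ∃ q : ℝ, 1 < q ∧ ∀ a : E, 1 < ‖a‖ → q ≤ ‖a‖ := by
  have hfin : (Set.range (norm : E → ℝ) ∩ Set.Ioc 1 2).Finite :=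
    (hE 1 2 one_pos).subset (Set.inter_subset_inter_right _ Set.Ioc_subset_Icc_self)
  obtain ⟨q, hq, hmin⟩ := (hfin.insert (2 : ℝ)).exists_minimal (Set.insert_nonempty _ _)
  refine ⟨q, ?_, fun a ha => ?_⟩
  · rcases hq with rfl | ⟨-, hq, -⟩
    exacts [one_lt_two, hq]
  · rcases le_or_gt ‖a‖ 2 with h2 | h2
    · exact le_of_not_gt fun hlt => (hmin (Or.inr ⟨⟨a, rfl⟩, ha, h2⟩) hlt.le).not_gt hlt
    · exact (le_of_not_gt fun hlt => (hmin (Or.inl rfl) hlt.le).not_gt hlt).trans h2.le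

lemma exists_finite_forall_exists_le_of_finite_image {α β : Type*} [LinearOrder α] {X : Set α}
    (hX : X.IsWF) {f : α → β} (hf : (f '' X).Finite) :
    ∃ F : Set α, F.Finite ∧ F ⊆ X ∧ ∀ n ∈ X, ∃ m ∈ F, m ≤ n ∧ f m = f n := by
  let F : Set α := {m ∈ X | ∀ n ∈ X, f n = f m → m ≤ n}
  refine ⟨F, Set.Finite.of_finite_image (f := f) (hf.subset (Set.image_mono fun m hm => hm.1))
    fun m hm m' hm' h => le_antisymm (hm.2 m' hm'.1 h.symm) (hm'.2 m hm.1 h), fun m hm => hm.1,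
    fun n hn => ?_⟩
  have hfib : (X ∩ f ⁻¹' {f n}).IsWF := hX.mono Set.inter_subset_left
  have hne : (X ∩ f ⁻¹' {f n}).Nonempty := ⟨n, hn, rfl⟩
  obtain ⟨hmX, hmn⟩ := hfib.min_mem hne
  exact ⟨hfib.min hne, ⟨hmX, fun m hm hfm => hfib.min_le hne ⟨hm, hfm.trans hmn⟩⟩,
    hfib.min_le hne ⟨hn, rfl⟩, hmn⟩

variable {p : ℕ} [Fact p.Prime] {E : Type*} [NormedField E] {r r' c : ℝ} {x : ℚ → E} {m n : ℚ}

lemma termNorm_eq_mul_weight_sub (r r' : ℝ) (x : ℚ → E) (n : ℚ) :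
    termNorm p r x n = termNorm p r' x n * weight p (r - r') n := by
  rw [termNorm, termNorm, mul_assoc, weight, weight, weight, ← Real.rpow_add prime_cast_pos]
  ring_nf

lemma termNorm_le_of_exponent_le (hr : 0 ≤ r) (hmn : m ≤ n) (h : ‖x m‖ = ‖x n‖) :
    termNorm p r x n ≤ termNorm p r x m := by
  rw [termNorm, termNorm, h]
  exact mul_le_mul_of_nonneg_left (weight_le_weight
    (mul_le_mul_of_nonneg_left (Rat.cast_le.2 hmn) hr)) (norm_nonneg _)

lemma termNorm_lt_of_exponent_lt (hr : 0 < r) (hmn : m < n) (h : ‖x m‖ = ‖x n‖)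
    (hn : x n ≠ 0) : termNorm p r x n < termNorm p r x m := by
  rw [termNorm, termNorm, h]
  exact mul_lt_mul_of_pos_left (weight_lt_weight
    (mul_lt_mul_of_pos_left (Rat.cast_lt.2 hmn) hr)) (norm_pos_iff.2 hn)

lemma termNorm_anti (x : ℚ → E) (hn : 0 ≤ n) (h : r' ≤ r) :
    termNorm p r x n ≤ termNorm p r' x n :=
  mul_le_mul_of_nonneg_left (weight_le_weight
    (mul_le_mul_of_nonneg_right h (Rat.cast_nonneg.2 hn))) (norm_nonneg _)

lemma continuous_termNorm (x : ℚ → E) (n : ℚ) : Continuous fun r => termNorm p r x n :=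
  continuous_const.mul <| (Real.continuous_const_rpow prime_cast_pos.ne').comp <|
    (continuous_id.mul continuous_const).neg

lemma exists_forall_le_of_le_termNorm {C : ℝ} (hrr : r' < r) (hx : NormLE p r' x C) (hc : 0 < c) :
    ∃ M : ℚ, ∀ n, c ≤ termNorm p r x n → n ≤ M := by
  have hlim : Filter.Tendsto (fun n => C * weight p (r - r') n) Filter.atTop (𝓝 (C * 0)) :=
    (tendsto_weight_exponent_atTop (sub_pos.2 hrr)).const_mul C
  rw [mul_zero] at hlim
  obtain ⟨M, hM⟩ := (hlim.eventually (gt_mem_nhds hc)).exists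
  refine ⟨M, fun n hn => le_of_not_gt fun hlt => hM.not_ge (hn.trans ?_)⟩
  rw [termNorm_eq_mul_weight_sub r r']
  exact mul_le_mul (hx n) (weight_le_weight (mul_le_mul_of_nonneg_left (Rat.cast_le.2 hlt.le)
    (sub_pos.2 hrr).le)) (weight_pos _ _).le hx.nonneg

variable [IsUltrametricDist E]

lemma finite_image_norm_of_le_termNorm (hE : HasDiscreteNorm E) (hr : 0 ≤ r) (hrr : r' < r)
    (hx : x ∈ gaussSpace p E r) (hx' : x ∈ gaussSpace p E r') (hc : 0 < c) :
    ((fun n => ‖x n‖) '' {n | c ≤ termNorm p r x n}).Finite := by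
  obtain ⟨⟨C', hC'⟩, -⟩ := hx'
  obtain ⟨⟨C, hC⟩, hwf⟩ := hx
  obtain ⟨M, hM⟩ := exists_forall_le_of_le_termNorm hrr hC' hc
  obtain ⟨m, hm⟩ : ∃ m, ∀ n, c ≤ termNorm p r x n → m ≤ n := by
    have hX := (hwf (c / 2) (half_pos hc)).mono (fun n (hn : c ≤ termNorm p r x n) =>
      (half_lt_self hc).trans_le hn)
    rcases {n | c ≤ termNorm p r x n}.eq_empty_or_nonempty with h | h
    · exact ⟨0, fun n hn => absurd hn (Set.eq_empty_iff_forall_notMem.1 h n)⟩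
    · exact ⟨hX.min h, fun n hn => hX.min_le h hn⟩
  refine (hE (c / weight p r m) (C / weight p r M)
    (div_pos hc (weight_pos r m))).subset ?_
  rintro _ ⟨n, hn, rfl⟩
  refine ⟨⟨x n, rfl⟩, ?_, ?_⟩
  · rw [div_le_iff₀ (weight_pos r m)]
    exact hn.trans (mul_le_mul_of_nonneg_left (weight_le_weight
      (mul_le_mul_of_nonneg_left (Rat.cast_le.2 (hm n hn)) hr)) (norm_nonneg _))
  · rw [le_div_iff₀ (weight_pos r M)]
    exact (mul_le_mul_of_nonneg_left (weight_le_weight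
      (mul_le_mul_of_nonneg_left (Rat.cast_le.2 (hM n hn)) hr)) (norm_nonneg _)).trans (hC n)

lemma exists_finite_forall_exists_le_norm_eq (hE : HasDiscreteNorm E) (hr : 0 ≤ r) (hrr : r' < r)
    (hx : x ∈ gaussSpace p E r) (hx' : x ∈ gaussSpace p E r') (hc : 0 < c) (A : Set ℚ) :
    ∃ F : Set ℚ, F.Finite ∧ F ⊆ A ∧
      ∀ n ∈ A, c ≤ termNorm p r x n → ∃ m ∈ F, m ≤ n ∧ ‖x m‖ = ‖x n‖ := by
  have hwf : (A ∩ {n | c ≤ termNorm p r x n}).IsWF :=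
    (hx.2 (c / 2) (half_pos hc)).mono fun n hn => (half_lt_self hc).trans_le hn.2
  obtain ⟨F, hF, hFA, h⟩ := exists_finite_forall_exists_le_of_finite_image hwf
    (f := fun n => ‖x n‖) ((finite_image_norm_of_le_termNorm hE hr hrr hx hx' hc).subset
      (Set.image_mono Set.inter_subset_right))
  exact ⟨F, hF, fun n hn => (hFA hn).1, fun n hn hcn => h n ⟨hn, hcn⟩⟩

lemma exists_forall_termNorm_le (hE : HasDiscreteNorm E) (hr : 0 ≤ r) (hrr : r' < r)
    (hx : x ∈ gaussSpace p E r) (hx' : x ∈ gaussSpace p E r') :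
    ∃ m, ∀ n, termNorm p r x n ≤ termNorm p r x m := by
  by_contra! hcon
  obtain ⟨n₀, hn₀⟩ := hcon 0
  have hpos : 0 < termNorm p r x n₀ := (termNorm_nonneg r x 0).trans_lt hn₀
  obtain ⟨F, hF, -, hFn⟩ := exists_finite_forall_exists_le_norm_eq hE hr hrr hx hx' hpos Set.univ
  obtain ⟨m₀, hm₀, -⟩ := hFn n₀ trivial le_rfl
  obtain ⟨m, -, hm⟩ := Set.exists_max_image F (termNorm p r x) hF ⟨m₀, hm₀⟩
  have hle : ∀ n, termNorm p r x n₀ ≤ termNorm p r x n → termNorm p r x n ≤ termNorm p r x m := by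
    intro n hn
    obtain ⟨m', hm', hmn, heq⟩ := hFn n trivial hn
    exact (termNorm_le_of_exponent_le hr hmn heq).trans (hm m' hm')
  obtain ⟨n, hn⟩ := hcon m
  exact (hle n ((hle n₀ le_rfl).trans hn.le)).not_gt hn

lemma finite_setOf_termNorm_eq (hE : HasDiscreteNorm E) (hr : 0 < r) (hrr : r' < r)
    (hx : x ∈ gaussSpace p E r) (hx' : x ∈ gaussSpace p E r') (hm : x m ≠ 0)
    (hmax : ∀ n, termNorm p r x n ≤ termNorm p r x m) :
    {n | termNorm p r x n = termNorm p r x m}.Finite := by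
  have hpos : 0 < termNorm p r x m := termNorm_pos hm
  obtain ⟨F, hF, -, hFn⟩ :=
    exists_finite_forall_exists_le_norm_eq hE hr.le hrr hx hx' hpos Set.univ
  refine hF.subset fun n (hn : termNorm p r x n = termNorm p r x m) => ?_
  obtain ⟨m', hm', hmn, heq⟩ := hFn n trivial hn.ge
  rcases hmn.eq_or_lt with rfl | hlt
  · exact hm'
  · have hn0 : x n ≠ 0 := termNorm_pos_iff.1 (hn ▸ hpos)
    exact absurd (hmax m') (hn ▸ termNorm_lt_of_exponent_lt hr hlt heq hn0).not_ge

lemma exists_isDominant (hE : HasDiscreteNorm E) (hr : 0 < r) (hrr : r' < r)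
    (hx : x ∈ gaussSpace p E r) (hx' : x ∈ gaussSpace p E r') (hx0 : x ≠ 0) (σ : ℚ) :
    ∃ a, IsDominant p σ r x a := by
  obtain ⟨m, hmax⟩ := exists_forall_termNorm_le hE hr.le hrr hx hx'
  obtain ⟨n₀, hn₀⟩ := Function.ne_iff.1 hx0
  have hm : 0 < termNorm p r x m := (termNorm_pos hn₀).trans_le (hmax n₀)
  obtain ⟨a, ha : termNorm p r x a = _, hmin⟩ := Set.exists_min_image _ (fun n => σ * n)
    (finite_setOf_termNorm_eq hE hr hrr hx hx' (termNorm_pos_iff.1 hm) hmax) ⟨m, rfl⟩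
  refine ⟨a, termNorm_pos_iff.1 (ha ▸ hm), fun n => ?_⟩
  rw [ha]
  exact ⟨hmax n, fun hn => (hmax n).lt_of_ne fun h => (hmin n h).not_gt hn⟩

lemma exists_normLE_lt (hE : HasDiscreteNorm E) (hr : 0 ≤ r) (hrr : r' < r)
    (hx : x ∈ gaussSpace p E r) (hx' : x ∈ gaussSpace p E r')
    (h : ∀ n, termNorm p r x n < c) : ∃ d, 0 ≤ d ∧ d < c ∧ NormLE p r x d := by
  obtain ⟨m, hm⟩ := exists_forall_termNorm_le hE hr hrr hx hx'
  exact ⟨_, termNorm_nonneg r x m, h m, hm⟩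

/- Only finitely many terms of positive exponent can exceed `c`: the norm is discrete, and on each
of its level sets the term of lowest exponent is the largest one. -/
lemma eventually_forall_termNorm_lt (hE : HasDiscreteNorm E) {t t' : ℝ} (ht : 0 ≤ t)
    (htt : t' < t) (hx : x ∈ gaussSpace p E t) (hx' : x ∈ gaussSpace p E t') (hc : 0 < c)
    {l : Filter ℝ} (hl : ∀ᶠ r in l, t ≤ r)
    (h : ∀ n, 0 < n → ∀ᶠ r in l, termNorm p r x n < c) :
    ∀ᶠ r in l, ∀ n, 0 < n → termNorm p r x n < c := by
  obtain ⟨F, hF, hFpos, hFn⟩ :=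
    exists_finite_forall_exists_le_norm_eq hE ht htt hx hx' hc (Set.Ioi 0)
  filter_upwards [hl, (Filter.eventually_all_finite hF).2 fun m hm => h m (hFpos hm)]
    with r hr hrF n hn
  rcases lt_or_ge (termNorm p t x n) c with hlt | hge
  · exact (termNorm_anti x hn.le hr).trans_lt hlt
  · obtain ⟨m, hm, hmn, heq⟩ := hFn n hn hge
    exact (termNorm_le_of_exponent_le (ht.trans hr) hmn heq).trans_lt (hrF m hm)

lemma exists_lt_forall_termNorm_lt (hE : HasDiscreteNorm E) {s s' : ℝ} (hs' : 0 ≤ s')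
    (hs : s' < s) (hx : ∀ r, s' ≤ r → x ∈ gaussSpace p E r) (hc : 0 < c)
    (h : ∀ n, 0 < n → termNorm p s x n < c) :
    ∃ r, s' < r ∧ r < s ∧ ∀ n, 0 < n → termNorm p r x n < c := by
  obtain ⟨t, hs't, hts⟩ := exists_between hs
  have htr : ∀ᶠ r in 𝓝[<] s, t < r := (lt_mem_nhds hts).filter_mono nhdsWithin_le_nhds
  have hlt := eventually_forall_termNorm_lt hE (hs'.trans hs't.le) hs't (hx t hs't.le)
    (hx s' le_rfl) hc (htr.mono fun _ => le_of_lt) fun n hn =>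
      (((continuous_termNorm x n).tendsto s).eventually (gt_mem_nhds (h n hn))).filter_mono
        nhdsWithin_le_nhds
  obtain ⟨r, hr, htr, hrs⟩ := (hlt.and (htr.and eventually_mem_nhdsWithin)).exists
  exact ⟨r, hs't.trans htr, hrs, hr⟩

end Discrete

/-! ### Stable spaces of series -/

section Contraction

variable {E : Type*} [NormedField E] {p : ℕ} {r K θ : ℝ}

/-- The space of series `D` is closed under limits for the norm `w_r`. -/
def IsClosedAt (p : ℕ) (r : ℝ) (D : Submodule E (ℚ → E)) : Prop :=
  ∀ x, (∀ ε : ℝ, 0 < ε → ∃ y ∈ D, NormLE p r (x - y) ε) → x ∈ D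

lemma IsClosedAt.inf {C D : Submodule E (ℚ → E)} (hC : IsClosedAt p r C)
    (hD : IsClosedAt p r D) : IsClosedAt p r (C ⊓ D) := fun x h =>
  ⟨hC x fun ε hε => (h ε hε).imp fun _ hy => ⟨hy.1.1, hy.2⟩,
    hD x fun ε hε => (h ε hε).imp fun _ hy => ⟨hy.1.2, hy.2⟩⟩

variable [IsUltrametricDist E] [Fact p.Prime]

lemma isClosedAt_gaussSpace (r : ℝ) : IsClosedAt p r (gaussSpace p E r) :=
  fun _ => mem_gaussSpace_of_forall_exists_sub

lemma normLE_add_sub_of_geometric (hθ₀ : 0 ≤ θ) (hθ : θ < 1) {S : ℕ → ℚ → E}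
    (hS : ∀ k, NormLE p r (S (k + 1) - S k) (K * θ ^ k)) (k l : ℕ) :
    NormLE p r (S (k + l) - S k) (K * θ ^ k) := by
  have hK : 0 ≤ K := by simpa using (hS 0).nonneg
  induction l with
  | zero => simpa using (normLE_zero p r).mono (by positivity : 0 ≤ K * θ ^ k)
  | succ l ih =>
    have hl : NormLE p r (S (k + l + 1) - S (k + l)) (K * θ ^ k) :=
      (hS (k + l)).mono (mul_le_mul_of_nonneg_left
        (pow_le_pow_of_le_one hθ₀ hθ.le (Nat.le_add_right k l)) hK)
    rw [← add_assoc]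
    simpa only [sub_add_sub_cancel] using hl.add ih

variable [CompleteSpace E]

lemma exists_normLE_sub_of_geometric (hθ₀ : 0 ≤ θ) (hθ : θ < 1) {S : ℕ → ℚ → E}
    (hS : ∀ k, NormLE p r (S (k + 1) - S k) (K * θ ^ k)) :
    ∃ x : ℚ → E, ∀ k, NormLE p r (x - S k) (K * θ ^ k) := by
  have hlim : Filter.Tendsto (fun k => K * θ ^ k) Filter.atTop (𝓝 0) := by
    simpa using (tendsto_pow_atTop_nhds_zero_of_lt_one hθ₀ hθ).const_mul K
  have hcauchy (n : ℚ) : CauchySeq fun k => S k n := by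
    refine cauchySeq_of_le_tendsto_0' (fun k => K * θ ^ k * (weight p r n)⁻¹) ?_
      (by simpa using hlim.mul_const (weight p r n)⁻¹)
    intro k m hkm
    obtain ⟨l, rfl⟩ := Nat.exists_eq_add_of_le hkm
    rw [dist_comm, dist_eq_norm, ← div_eq_mul_inv, le_div_iff₀ (weight_pos r n)]
    exact normLE_add_sub_of_geometric hθ₀ hθ hS k l n
  choose x hx using fun n => cauchySeq_tendsto_of_complete (hcauchy n)
  refine ⟨x, fun k n => ?_⟩
  have hxk : Filter.Tendsto (fun l => S (k + l) n) Filter.atTop (𝓝 (x n)) := by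
    simpa [add_comm] using (Filter.tendsto_add_atTop_iff_nat k).2 (hx n)
  exact le_of_tendsto' ((hxk.sub_const (S k n)).norm.mul_const (weight p r n))
    fun l => normLE_add_sub_of_geometric hθ₀ hθ hS k l n

lemma exists_fixedPoint {D : Submodule E (ℚ → E)} (hD : IsClosedAt p r D) (hθ₀ : 0 ≤ θ)
    (hθ : θ < 1) {F : (ℚ → E) → ℚ → E} (hFD : ∀ x ∈ D, F x ∈ D)
    (hF : ∀ x ∈ D, ∀ y ∈ D, ∀ c, NormLE p r (x - y) c → NormLE p r (F x - F y) (θ * c))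
    (hK : NormLE p r (F 0) K) : ∃ x ∈ D, F x = x ∧ NormLE p r x K := by
  have hSD (k : ℕ) : F^[k] 0 ∈ D := by
    induction k with
    | zero => exact D.zero_mem
    | succ k ih => rw [Function.iterate_succ_apply']; exact hFD _ ih
  have hS (k : ℕ) : NormLE p r (F^[k + 1] 0 - F^[k] 0) (K * θ ^ k) := by
    induction k with
    | zero => simpa using hK
    | succ k ih =>
      rw [Function.iterate_succ_apply', Function.iterate_succ_apply' F k, pow_succ', mul_left_comm]
      exact hF _ (hFD _ (hSD k)) _ (hSD k) _ (by simpa only [Function.iterate_succ_apply'] using ih)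
  obtain ⟨x, hx⟩ := exists_normLE_sub_of_geometric (S := fun k => F^[k] 0) hθ₀ hθ hS
  have hsmall (ε : ℝ) (hε : 0 < ε) : ∃ k, K * θ ^ k ≤ ε := by
    have hlim : Filter.Tendsto (fun k => K * θ ^ k) Filter.atTop (𝓝 0) := by
      simpa using (tendsto_pow_atTop_nhds_zero_of_lt_one hθ₀ hθ).const_mul K
    exact (hlim.eventually_le_const hε).exists
  have hxD : x ∈ D := hD x fun ε hε =>
    (hsmall ε hε).elim fun k hk => ⟨_, hSD k, (hx k).mono hk⟩
  refine ⟨x, hxD, sub_eq_zero.1 ?_, by simpa using hx 0⟩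
  refine eq_zero_of_forall_normLE (p := p) (r := r) fun ε hε => ?_
  obtain ⟨k, hk⟩ := hsmall ε hε
  have hKk := (hx k).nonneg
  have hnext : NormLE p r (F^[k + 1] 0 - x) ε := by
    rw [← neg_sub]
    refine ((hx (k + 1)).mono ?_).neg
    rw [pow_succ, ← mul_assoc]
    exact (mul_le_of_le_one_right hKk hθ.le).trans hk
  have hFx : NormLE p r (F x - F^[k + 1] 0) ε := by
    rw [Function.iterate_succ_apply']
    exact (hF x hxD _ (hSD k) _ (hx k)).mono ((mul_le_of_le_one_left hKk hθ.le).trans hk)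
  simpa only [sub_add_sub_cancel] using hFx.add hnext

lemma exists_mem_seriesMul_eq_one {D : Submodule E (ℚ → E)} (hD : IsClosedAt p r D)
    (hDg : D ≤ gaussSpace p E r) (h1 : seriesOne ∈ D)
    (hmul : ∀ x ∈ D, ∀ y ∈ D, seriesMul x y ∈ D) {u : ℚ → E} (hu : u ∈ D) (hθ : θ < 1)
    (hb : NormLE p r (u - seriesOne) θ) : ∃ x ∈ D, seriesMul u x = seriesOne := by
  have hu1 : u - seriesOne ∈ D := D.sub_mem hu h1
  have hdist {a b c : ℚ → E} (ha : a ∈ D) (hb : b ∈ D) (hc : c ∈ D) :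
      seriesMul a (b - c) = seriesMul a b - seriesMul a c :=
    congrArg Subtype.val (mul_sub (⟨a, hDg ha⟩ : gaussSpace p E r) ⟨b, hDg hb⟩ ⟨c, hDg hc⟩)
  obtain ⟨x, hxD, hx, -⟩ := exists_fixedPoint hD hb.nonneg hθ
    (F := fun x => seriesOne - seriesMul (u - seriesOne) x)
    (fun x hx => D.sub_mem h1 (hmul _ hu1 x hx))
    (fun x hx y hy c hxy => by
      rw [sub_sub_sub_cancel_left, ← hdist hu1 hy hx]
      exact hb.mul (by simpa only [neg_sub] using hxy.neg))
    (K := 1) (by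
      have h0 : seriesMul (u - seriesOne) 0 = 0 := by funext n; simp [seriesMul]
      simpa only [h0, sub_zero] using normLE_one r)
  refine ⟨x, hxD, ?_⟩
  have hux : seriesMul (u - seriesOne) x = seriesMul u x - x := by
    rw [seriesMul_comm, hdist hxD hu h1, seriesMul_comm x u, seriesMul_seriesOne]
  linear_combination -((congrArg (seriesOne - ·) hux).symm.trans hx)

end Contraction

section Support

/-- The space of the series all of whose exponents lie in `A`. -/
def supportedIn (E : Type*) [NormedField E] (A : Set ℚ) : Submodule E (ℚ → E) where
  carrier := {x | ∀ n ∉ A, x n = 0}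
  zero_mem' _ _ := rfl
  add_mem' hx hy n hn := by rw [Pi.add_apply, hx n hn, hy n hn, add_zero]
  smul_mem' a x hx n hn := by rw [Pi.smul_apply, hx n hn, smul_zero]

variable {E : Type*} [NormedField E] {A B D : Set ℚ} {x y : ℚ → E}

lemma indicator_mem_supportedIn (A : Set ℚ) (x : ℚ → E) : A.indicator x ∈ supportedIn E A :=
  fun _ hn => Set.indicator_of_notMem hn x

lemma tPow_mem_supportedIn {j : ℚ} (hj : j ∈ A) : (tPow j : ℚ → E) ∈ supportedIn E A :=
  fun _ hn => by
    classical
    exact Pi.single_eq_of_ne (ne_of_mem_of_not_mem hj hn).symm 1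

lemma one_mem_supportedIn (hA : 0 ∈ A) : (seriesOne : ℚ → E) ∈ supportedIn E A :=
  tPow_mem_supportedIn hA

lemma seriesMul_mem_supportedIn (hx : x ∈ supportedIn E A) (hy : y ∈ supportedIn E B)
    (hD : ∀ a ∈ A, ∀ b ∈ B, a + b ∈ D) : seriesMul x y ∈ supportedIn E D := fun n hn => by
  rw [seriesMul, ← tsum_zero]
  refine tsum_congr fun i => ?_
  by_cases hi : i ∈ A
  · have hni : n - i ∉ B := fun h => hn (by simpa using hD i hi (n - i) h)
    rw [hy _ hni, mul_zero]
  · rw [hx i hi, zero_mul]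

lemma seriesMul_mem_supportedIn_Ici (hx : x ∈ supportedIn E (Set.Ici 0))
    (hy : y ∈ supportedIn E (Set.Ici 0)) : seriesMul x y ∈ supportedIn E (Set.Ici 0) :=
  seriesMul_mem_supportedIn hx hy fun _ ha _ hb => Set.mem_Ici.2 (add_nonneg ha hb)

lemma seriesMul_apply_zero (hx : x ∈ supportedIn E (Set.Ici 0))
    (hy : y ∈ supportedIn E (Set.Ici 0)) : seriesMul x y 0 = x 0 * y 0 := by
  rw [seriesMul, tsum_eq_single 0, sub_zero]
  intro i hi
  rcases hi.lt_or_gt with hi | hi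
  · rw [hx i hi.not_ge, zero_mul]
  · rw [hy _ (by simpa using hi), mul_zero]

variable {p : ℕ} {r s c : ℝ}

lemma termNorm_indicator_le [Fact p.Prime] (r : ℝ) (A : Set ℚ) (x : ℚ → E) (n : ℚ) :
    termNorm p r (A.indicator x) n ≤ termNorm p r x n := by
  by_cases hn : n ∈ A
  · rw [termNorm, Set.indicator_of_mem hn, termNorm]
  · rw [termNorm_of_eq_zero p r (Set.indicator_of_notMem hn x)]
    exact termNorm_nonneg r x n

lemma NormLE.indicator [Fact p.Prime] (h : NormLE p r x c) (A : Set ℚ) :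
    NormLE p r (A.indicator x) c :=
  fun n => (termNorm_indicator_le r A x n).trans (h n)

lemma isClosedAt_supportedIn [Fact p.Prime] (r : ℝ) (A : Set ℚ) :
    IsClosedAt p r (supportedIn E A) := fun x h n hn => by
  by_contra hxn
  have hpos : 0 < termNorm p r x n := termNorm_pos hxn
  obtain ⟨y, hy, hxy⟩ := h _ (half_pos hpos)
  have hle := hxy n
  rw [termNorm, Pi.sub_apply, hy n hn, sub_zero] at hle
  exact hle.not_gt (half_lt_self hpos)

variable [IsUltrametricDist E] [Fact p.Prime]

lemma indicator_mem_gaussSpace (hx : x ∈ gaussSpace p E r) (A : Set ℚ) :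
    A.indicator x ∈ gaussSpace p E r :=
  mem_gaussSpace_of_termNorm_le one_pos hx fun n => by
    rw [one_mul]; exact termNorm_indicator_le r A x n

lemma mem_gaussSpace_of_mul_le (hx : x ∈ gaussSpace p E r)
    (h : ∀ n, x n ≠ 0 → r * n ≤ s * n) : x ∈ gaussSpace p E s := by
  refine mem_gaussSpace_of_termNorm_le one_pos hx fun n => ?_
  by_cases hn : x n = 0
  · rw [termNorm_of_eq_zero p s hn, termNorm_of_eq_zero p r hn, mul_zero]
  · rw [one_mul]
    exact mul_le_mul_of_nonneg_left (weight_le_weight (h n hn)) (norm_nonneg _)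

lemma mem_gaussSpace_of_le (hrs : r ≤ s) (hx₀ : x ∈ supportedIn E (Set.Ici 0))
    (hx : x ∈ gaussSpace p E r) : x ∈ gaussSpace p E s :=
  mem_gaussSpace_of_mul_le hx fun n hn => by
    have hn₀ : 0 ≤ n := not_lt.1 fun h => hn (hx₀ n h.not_ge)
    gcongr

end Support

section Omega

variable {E : Type*} [NormedField E] [IsUltrametricDist E] {p : ℕ} [Fact p.Prime]

/-- The closure properties of a space of series `C` which ensure that slope factorizations of
elements of `C` can be found in `C`. -/
structure IsStable (p : ℕ) [Fact p.Prime] (C : Submodule E (ℚ → E)) : Prop where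
  one_mem : seriesOne ∈ C
  tPow_mem : ∀ x ∈ C, ∀ j : ℚ, x j ≠ 0 → tPow j ∈ C ∧ tPow (-j) ∈ C
  indicator_mem : ∀ x ∈ C, ∀ j : ℚ, (Set.Iio j).indicator x ∈ C
  mul_mem : ∀ r : ℝ, 0 < r → ∀ x ∈ C ⊓ gaussSpace p E r, ∀ y ∈ C ⊓ gaussSpace p E r,
    seriesMul x y ∈ C
  isClosedAt : ∀ r : ℝ, 0 < r → IsClosedAt p r (C ⊓ gaussSpace p E r)

/-- The series in `C` with nonnegative exponents and with finite norms `w_r` for all `r > 0`. This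
is the common form of the three rings `Ω_an`, `Ω^imm_an` and `Ω^alg_an`. -/
def omega (p : ℕ) [Fact p.Prime] (C : Submodule E (ℚ → E)) : Submodule E (ℚ → E) :=
  C ⊓ supportedIn E (Set.Ici 0) ⊓ ⨅ r : Set.Ioi (0 : ℝ), gaussSpace p E r

variable {C : Submodule E (ℚ → E)} {x y z : ℚ → E} {r : ℝ}

lemma mem_omega : x ∈ omega p C ↔
    x ∈ C ∧ x ∈ supportedIn E (Set.Ici 0) ∧ ∀ r : ℝ, 0 < r → x ∈ gaussSpace p E r := by
  simp [omega, and_assoc]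

lemma mem_of_mem_omega (hx : x ∈ omega p C) : x ∈ C := (mem_omega.1 hx).1

lemma mem_supportedIn_of_mem_omega (hx : x ∈ omega p C) : x ∈ supportedIn E (Set.Ici 0) :=
  (mem_omega.1 hx).2.1

lemma apply_eq_zero_of_mem_omega (hx : x ∈ omega p C) {n : ℚ} (hn : n < 0) : x n = 0 :=
  mem_supportedIn_of_mem_omega hx n hn.not_ge

lemma mem_gaussSpace_of_mem_omega (hx : x ∈ omega p C) (hr : 0 < r) : x ∈ gaussSpace p E r :=
  (mem_omega.1 hx).2.2 r hr

lemma IsStable.one_mem_omega (hC : IsStable p C) : seriesOne ∈ omega p C :=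
  mem_omega.2 ⟨hC.one_mem, one_mem_supportedIn Set.self_mem_Ici, fun r _ => one_mem_gaussSpace r⟩

lemma IsStable.indicator_mem_omega (hC : IsStable p C) (hx : x ∈ omega p C) (j : ℚ) :
    (Set.Iio j).indicator x ∈ omega p C := by
  refine mem_omega.2 ⟨hC.indicator_mem x (mem_of_mem_omega hx) j, fun n hn => ?_, fun r hr =>
    indicator_mem_gaussSpace (mem_gaussSpace_of_mem_omega hx hr) _⟩
  rw [Set.indicator_apply_eq_zero]
  exact fun _ => mem_supportedIn_of_mem_omega hx n hn

lemma exists_isDominant_of_mem_omega (hE : HasDiscreteNorm E) (hx : x ∈ omega p C) (hx₀ : x ≠ 0)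
    (hr : 0 < r) (σ : ℚ) : ∃ a, IsDominant p σ r x a :=
  exists_isDominant hE hr (half_lt_self hr) (mem_gaussSpace_of_mem_omega hx hr)
    (mem_gaussSpace_of_mem_omega hx (half_pos hr)) hx₀ σ

lemma IsStable.mul_mem_inf (hC : IsStable p C) (hr : 0 < r) (hx : x ∈ C ⊓ gaussSpace p E r)
    (hy : y ∈ C ⊓ gaussSpace p E r) : seriesMul x y ∈ C ⊓ gaussSpace p E r :=
  ⟨hC.mul_mem r hr x hx y hy, mul_mem_gaussSpace hx.2 hy.2⟩

lemma IsStable.mul_mem_omega (hC : IsStable p C) (hx : x ∈ omega p C) (hy : y ∈ omega p C) :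
    seriesMul x y ∈ omega p C := by
  obtain ⟨hxC, hx₀, hxg⟩ := mem_omega.1 hx
  obtain ⟨hyC, hy₀, hyg⟩ := mem_omega.1 hy
  exact mem_omega.2 ⟨hC.mul_mem 1 one_pos x ⟨hxC, hxg 1 one_pos⟩ y ⟨hyC, hyg 1 one_pos⟩,
    seriesMul_mem_supportedIn_Ici hx₀ hy₀, fun r hr => mul_mem_gaussSpace (hxg r hr) (hyg r hr)⟩

variable [CompleteSpace E]

lemma omega_mul_assoc (hx : x ∈ omega p C) (hy : y ∈ omega p C) (hz : z ∈ omega p C) :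
    seriesMul (seriesMul x y) z = seriesMul x (seriesMul y z) :=
  seriesMul_assoc (mem_gaussSpace_of_mem_omega hx one_pos)
    (mem_gaussSpace_of_mem_omega hy one_pos) (mem_gaussSpace_of_mem_omega hz one_pos)

lemma IsDominant.right_of_seriesMul (hE : HasDiscreteNorm E) (hx : x ∈ omega p C)
    (hy : y ∈ omega p C) (hy₀ : y ≠ 0) (hr : 0 < r) {σ a c : ℚ} (hσ : σ ≠ 0)
    (ha : IsDominant p σ r x a) (hc : IsDominant p σ r (seriesMul x y) c) :
    IsDominant p σ r y (c - a) := by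
  obtain ⟨b, hb⟩ := exists_isDominant_of_mem_omega hE hy hy₀ hr σ
  have hab := ha.seriesMul hσ (mem_gaussSpace_of_mem_omega hx hr)
    (mem_gaussSpace_of_mem_omega hy hr) hb
  rwa [← hab.unique hσ hc, add_sub_cancel_left]

lemma IsStable.exists_inverse_nonneg (hC : IsStable p C) (hr : 0 < r) {u : ℚ → E}
    (hu : u ∈ C ⊓ gaussSpace p E r ⊓ supportedIn E (Set.Ici 0)) {θ : ℝ} (hθ : θ < 1)
    (hb : NormLE p r (u - seriesOne) θ) :
    ∃ x ∈ C ⊓ gaussSpace p E r ⊓ supportedIn E (Set.Ici 0), seriesMul u x = seriesOne :=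
  exists_mem_seriesMul_eq_one ((hC.isClosedAt r hr).inf (isClosedAt_supportedIn r _))
    (fun _ hx => hx.1.2) ⟨⟨hC.one_mem, one_mem_gaussSpace r⟩, one_mem_supportedIn Set.self_mem_Ici⟩
    (fun _ hx _ hy =>
      ⟨hC.mul_mem_inf hr hx.1 hy.1, seriesMul_mem_supportedIn_Ici hx.2 hy.2⟩) hu hθ hb

lemma eq_of_seriesMul_eq_one {u : ℚ → E} (hu : u ∈ gaussSpace p E r) (hx : x ∈ gaussSpace p E r)
    (hy : y ∈ gaussSpace p E r) (hux : seriesMul u x = seriesOne)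
    (huy : seriesMul u y = seriesOne) : x = y :=
  congrArg Subtype.val (left_inv_eq_right_inv (M := gaussSpace p E r)
    (b := ⟨x, hx⟩) (a := ⟨u, hu⟩) (c := ⟨y, hy⟩)
    (Subtype.ext ((seriesMul_comm x u).trans hux)) (Subtype.ext huy))

end Omega

section Flat

variable {E : Type*} [NormedField E] {p : ℕ} {x y : ℚ → E} {r s : ℝ}

/-- For every norm `w_s` with `s > 0`, the constant term of `x` is strictly dominant. For elements
of the rings considered here, this means that `x` is a unit. -/
def IsFlat (p : ℕ) (x : ℚ → E) : Prop :=
  ∀ s : ℝ, 0 < s → ∀ n, n ≠ 0 → termNorm p s x n < ‖x 0‖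

lemma IsDominant.termNorm_lt {a n : ℚ} (ha : IsDominant p 1 s x a) (ha' : IsDominant p (-1) s x a)
    (hn : n ≠ a) : termNorm p s x n < termNorm p s x a := by
  rcases hn.lt_or_gt with h | h
  · exact (ha.2 n).2 (by linarith)
  · exact (ha'.2 n).2 (by linarith)

variable [Fact p.Prime]

lemma isDominant_of_forall_termNorm_lt {a : ℚ} (σ : ℚ)
    (h : ∀ n, n ≠ a → termNorm p s x n < termNorm p s x a) : IsDominant p σ s x a := by
  refine ⟨termNorm_pos_iff.1 ((termNorm_nonneg s x (a + 1)).trans_lt (h _ (by simp))),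
    fun n => ⟨?_, fun hn => h n fun he => hn.ne (he ▸ rfl)⟩⟩
  by_cases hn : n = a
  · rw [hn]
  · exact (h n hn).le

lemma IsFlat.isDominant (hx : IsFlat p x) (hs : 0 < s) (σ : ℚ) : IsDominant p σ s x 0 :=
  isDominant_of_forall_termNorm_lt σ fun n hn => by
    rw [termNorm_zero_exponent]; exact hx s hs n hn

lemma IsFlat.apply_zero_ne_zero (hx : IsFlat p x) : x 0 ≠ 0 := (hx.isDominant one_pos 0).1

lemma isFlat_of_norm_le (hx : x ∈ supportedIn E (Set.Ici 0)) (hx₀ : x 0 ≠ 0)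
    (h : ∀ n, ‖x n‖ ≤ ‖x 0‖) : IsFlat p x := fun s hs n hn => by
  rcases hn.lt_or_gt with hn | hn
  · rw [termNorm_of_eq_zero p s (hx n hn.not_ge)]
    exact norm_pos_iff.2 hx₀
  · calc termNorm p s x n ≤ ‖x 0‖ * weight p s n :=
          mul_le_mul_of_nonneg_right (h n) (weight_pos s n).le
      _ < ‖x 0‖ := mul_lt_of_lt_one_right (norm_pos_iff.2 hx₀)
          (weight_lt_one (mul_pos hs (by exact_mod_cast hn)))

lemma isFlat_one : IsFlat p (seriesOne : ℚ → E) :=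
  isFlat_of_norm_le (one_mem_supportedIn Set.self_mem_Ici) (by simp [seriesOne, tPow]) fun n => by
    simpa [termNorm_zero_left, seriesOne, tPow] using normLE_one (E := E) (p := p) 0 n

variable [IsUltrametricDist E] [CompleteSpace E] {C : Submodule E (ℚ → E)}

lemma IsStable.exists_inverse_gaussSpace (hE : HasDiscreteNorm E) (hC : IsStable p C) {u : ℚ → E}
    (hu : u ∈ omega p C) (hflat : IsFlat p u) (hr : 0 < r) :
    ∃ x ∈ C ⊓ gaussSpace p E r ⊓ supportedIn E (Set.Ici 0), seriesMul u x = seriesOne := by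
  have hu₀ := hflat.apply_zero_ne_zero
  set v : ℚ → E := (u 0)⁻¹ • u with hv
  have hvΩ : v ∈ omega p C := (omega p C).smul_mem _ hu
  have hv1 : v - seriesOne ∈ omega p C := (omega p C).sub_mem hvΩ hC.one_mem_omega
  have hlt : ∀ n, termNorm p r (v - seriesOne) n < 1 := fun n => by
    by_cases hn : n = 0
    · subst hn
      rw [termNorm_of_eq_zero p r (by simp [hv, hu₀, seriesOne, tPow])]
      exact one_pos
    · have hvn : termNorm p r (v - seriesOne) n = ‖u 0‖⁻¹ * termNorm p r u n := by
        rw [← norm_inv, ← termNorm_smul]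
        simp [termNorm, hv, seriesOne, tPow, hn]
      rw [hvn, inv_mul_lt_one₀ (norm_pos_iff.2 hu₀)]
      exact hflat r hr n hn
  obtain ⟨θ, -, hθ, hb⟩ := exists_normLE_lt hE hr.le (half_lt_self hr)
    (mem_gaussSpace_of_mem_omega hv1 hr) (mem_gaussSpace_of_mem_omega hv1 (half_pos hr)) hlt
  obtain ⟨x, hx, hvx⟩ := hC.exists_inverse_nonneg hr ⟨⟨mem_of_mem_omega hvΩ,
    mem_gaussSpace_of_mem_omega hvΩ hr⟩, mem_supportedIn_of_mem_omega hvΩ⟩ hθ hb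
  exact ⟨(u 0)⁻¹ • x, Submodule.smul_mem _ _ hx, by
    rw [seriesMul_smul, ← smul_seriesMul, ← hv, hvx]⟩

lemma IsFlat.of_seriesMul_eq_one (hE : HasDiscreteNorm E) (hx : x ∈ omega p C)
    (hy : y ∈ omega p C) (hflat : IsFlat p x) (hxy : seriesMul x y = seriesOne) :
    IsFlat p y := fun s hs n hn => by
  have hy₀ : y ≠ 0 := by
    rintro rfl
    simpa [seriesMul, seriesOne, tPow] using congrFun hxy 0
  have hdom (σ : ℚ) (hσ : σ ≠ 0) : IsDominant p σ s y 0 := by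
    simpa only [sub_zero] using (hflat.isDominant hs σ).right_of_seriesMul hE hx hy hy₀ hs hσ
      (hxy ▸ isFlat_one.isDominant hs σ)
  rw [← termNorm_zero_exponent p s y]
  exact (hdom 1 one_ne_zero).termNorm_lt (hdom (-1) (by norm_num)) hn

lemma IsStable.exists_inverse_of_isFlat (hE : HasDiscreteNorm E) (hC : IsStable p C) {u : ℚ → E}
    (hu : u ∈ omega p C) (hflat : IsFlat p u) :
    ∃ d ∈ omega p C, IsFlat p d ∧ seriesMul u d = seriesOne := by
  obtain ⟨x, ⟨⟨hxC, hx⟩, hx₀⟩, hux⟩ := hC.exists_inverse_gaussSpace hE hu hflat one_pos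
  have hxΩ : x ∈ omega p C := mem_omega.2 ⟨hxC, hx₀, fun r hr => by
    obtain ⟨y, ⟨⟨-, hy⟩, hy₀⟩, huy⟩ := hC.exists_inverse_gaussSpace hE hu hflat hr
    have hxy : x = y := eq_of_seriesMul_eq_one
      (mem_gaussSpace_of_mem_omega hu (lt_max_of_lt_left one_pos))
      (mem_gaussSpace_of_le (le_max_left 1 r) hx₀ hx)
      (mem_gaussSpace_of_le (le_max_right 1 r) hy₀ hy) hux huy
    exact hxy ▸ hy⟩
  exact ⟨x, hxΩ, hflat.of_seriesMul_eq_one hE hu hxΩ hux, hux⟩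

lemma IsPureOfSlope.mul_isFlat (hE : HasDiscreteNorm E) (hx : x ∈ omega p C) (hy : y ∈ omega p C)
    (hflat : IsFlat p y) (hs : IsPureOfSlope p x s) : IsPureOfSlope p (seriesMul x y) s := by
  have hx₀ : x ≠ 0 := fun h => hs.1 (congrFun h 0)
  refine ⟨?_, fun s' => ?_⟩
  · rw [seriesMul_apply_zero (mem_supportedIn_of_mem_omega hx) (mem_supportedIn_of_mem_omega hy)]
    exact mul_ne_zero hs.1 hflat.apply_zero_ne_zero
  rw [← hs.2 s']
  by_cases hs' : 0 < s'
  · have hmul {σ a : ℚ} (hσ : σ ≠ 0) (ha : IsDominant p σ s' x a) :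
        IsDominant p σ s' (seriesMul x y) a := by
      simpa only [add_zero] using ha.seriesMul hσ (mem_gaussSpace_of_mem_omega hx hs')
        (mem_gaussSpace_of_mem_omega hy hs') (hflat.isDominant hs' σ)
    obtain ⟨a, ha⟩ := exists_isDominant_of_mem_omega hE hx hx₀ hs' 1
    obtain ⟨b, hb⟩ := exists_isDominant_of_mem_omega hE hx hx₀ hs' (-1)
    rw [isSlope_iff_of_isDominant ha hb,
      isSlope_iff_of_isDominant (hmul one_ne_zero ha) (hmul (by norm_num) hb)]
  · exact iff_of_false (fun h => hs' h.1) fun h => hs' h.1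

end Flat

section TopSlope

variable {E : Type*} [NormedField E] {p : ℕ} {s t : ℝ} {b : ℚ} {y z : ℚ → E}

/-- `s` is the largest slope of `z`. -/
def IsTopSlope (p : ℕ) (z : ℚ → E) (s : ℝ) : Prop :=
  0 < s ∧ NormLE p s z ‖z 0‖ ∧ ∃ n, 0 < n ∧ termNorm p s z n = ‖z 0‖

/-- The Newton polygon of `y` consists of a segment of slope `-s` from the exponent `0` to the
exponent `b`, and `y` is a polynomial of degree `b`. -/
structure IsSegment (p : ℕ) (y : ℚ → E) (s : ℝ) (b : ℚ) : Prop where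
  slope_pos : 0 < s
  degree_pos : 0 < b
  mem_supportedIn : y ∈ supportedIn E (Set.Icc 0 b)
  isDominant_zero : IsDominant p 1 s y 0
  isDominant_degree : IsDominant p (-1) s y b

lemma IsSegment.termNorm_degree (h : IsSegment p y s b) : termNorm p s y b = ‖y 0‖ := by
  rw [← termNorm_zero_exponent p s y]
  exact le_antisymm (h.isDominant_zero.2 b).1 (h.isDominant_degree.2 0).1

lemma IsSegment.smul (h : IsSegment p y s b) {c : E} (hc : c ≠ 0) : IsSegment p (c • y) s b := by
  have hdom {σ a : ℚ} (ha : IsDominant p σ s y a) : IsDominant p σ s (c • y) a := by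
    have hc' : 0 < ‖c‖ := norm_pos_iff.2 hc
    refine ⟨mul_ne_zero hc ha.1, fun n => ?_⟩
    rw [termNorm_smul, termNorm_smul, mul_le_mul_iff_right₀ hc', mul_lt_mul_iff_right₀ hc']
    exact ha.2 n
  exact ⟨h.slope_pos, h.degree_pos, Submodule.smul_mem _ c h.mem_supportedIn,
    hdom h.isDominant_zero, hdom h.isDominant_degree⟩

lemma normLE_apply_zero_of_forall_pos (hz : z ∈ supportedIn E (Set.Ici 0))
    (h : ∀ n, 0 < n → termNorm p s z n ≤ ‖z 0‖) : NormLE p s z ‖z 0‖ := fun n => by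
  rcases lt_trichotomy n 0 with hn | rfl | hn
  · rw [termNorm_of_eq_zero p s (hz n hn.not_ge)]
    exact norm_nonneg _
  · rw [termNorm_zero_exponent]
  · exact h n hn

variable [Fact p.Prime]

lemma termNorm_lt_of_termNorm_le {m n : ℚ} (hle : termNorm p s y n ≤ termNorm p s y m)
    (hm : y m ≠ 0) (h : (t - s) * m < (t - s) * n) : termNorm p t y n < termNorm p t y m := by
  rw [termNorm_eq_mul_weight_sub t s, termNorm_eq_mul_weight_sub t s y m]
  exact (mul_le_mul_of_nonneg_right hle (weight_pos _ _).le).trans_lt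
    (mul_lt_mul_of_pos_left (weight_lt_weight h) (termNorm_pos hm))

lemma IsSegment.isDominant_zero_of_lt (h : IsSegment p y s b) (hst : s < t) (σ : ℚ) :
    IsDominant p σ t y 0 := by
  refine isDominant_of_forall_termNorm_lt σ fun n hn => ?_
  by_cases hnb : n ∈ Set.Icc 0 b
  · exact termNorm_lt_of_termNorm_le (h.isDominant_zero.2 n).1 h.isDominant_zero.1
      (mul_lt_mul_of_pos_left (Rat.cast_lt.2 (hnb.1.lt_of_ne hn.symm)) (sub_pos.2 hst))
  · rw [termNorm_of_eq_zero p t (h.mem_supportedIn n hnb)]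
    exact termNorm_pos h.isDominant_zero.1

lemma IsSegment.isDominant_degree_of_lt (h : IsSegment p y s b) (hts : t < s) (σ : ℚ) :
    IsDominant p σ t y b := by
  refine isDominant_of_forall_termNorm_lt σ fun n hn => ?_
  by_cases hnb : n ∈ Set.Icc 0 b
  · exact termNorm_lt_of_termNorm_le (h.isDominant_degree.2 n).1 h.isDominant_degree.1
      (mul_lt_mul_of_neg_left (Rat.cast_lt.2 (hnb.2.lt_of_ne hn)) (sub_neg.2 hts))
  · rw [termNorm_of_eq_zero p t (h.mem_supportedIn n hnb)]
    exact termNorm_pos h.isDominant_degree.1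

lemma IsSegment.isPureOfSlope (h : IsSegment p y s b) : IsPureOfSlope p y s := by
  refine ⟨h.isDominant_zero.1, fun t => ?_⟩
  rcases lt_trichotomy t s with ht | rfl | ht
  · rw [isSlope_iff_of_isDominant (h.isDominant_degree_of_lt ht 1)
      (h.isDominant_degree_of_lt ht (-1))]
    simp [ht.ne]
  · rw [isSlope_iff_of_isDominant h.isDominant_zero h.isDominant_degree]
    simp [h.slope_pos, h.degree_pos.ne]
  · rw [isSlope_iff_of_isDominant (h.isDominant_zero_of_lt ht 1) (h.isDominant_zero_of_lt ht (-1))]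
    simp [ht.ne']

variable [IsUltrametricDist E] {C : Submodule E (ℚ → E)}

lemma exists_normLE_apply_zero (hE : HasDiscreteNorm E) (hz : z ∈ omega p C) (hz₀ : z 0 ≠ 0) :
    ∃ r : ℝ, 0 < r ∧ NormLE p r z ‖z 0‖ := by
  have hc : 0 < ‖z 0‖ := norm_pos_iff.2 hz₀
  have hlim (n : ℚ) (hn : 0 < n) : ∀ᶠ r in Filter.atTop, termNorm p r z n < ‖z 0‖ := by
    have h : Filter.Tendsto (fun r => termNorm p r z n) Filter.atTop (𝓝 (‖z n‖ * 0)) :=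
      (tendsto_weight_atTop hn).const_mul _
    rw [mul_zero] at h
    exact h.eventually_lt_const hc
  have hlt := eventually_forall_termNorm_lt hE one_pos.le one_half_lt_one
    (mem_gaussSpace_of_mem_omega hz one_pos) (mem_gaussSpace_of_mem_omega hz one_half_pos) hc
    (Filter.eventually_ge_atTop 1) hlim
  obtain ⟨r, hr, hr₁⟩ := (hlt.and (Filter.eventually_gt_atTop 0)).exists
  exact ⟨r, hr₁, normLE_apply_zero_of_forall_pos (mem_supportedIn_of_mem_omega hz)
    fun n hn => (hr n hn).le⟩

lemma isFlat_or_exists_isTopSlope (hE : HasDiscreteNorm E) (hz : z ∈ omega p C) (hz₀ : z 0 ≠ 0) :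
    IsFlat p z ∨ ∃ s, IsTopSlope p z s := by
  set S : Set ℝ := {r | 0 < r ∧ NormLE p r z ‖z 0‖}
  have hbdd : BddBelow S := ⟨0, fun r hr => hr.1.le⟩
  have hne : S.Nonempty := exists_normLE_apply_zero hE hz hz₀
  have hle : NormLE p (sInf S) z ‖z 0‖ := fun n =>
    closure_minimal (fun r hr => hr.2 n) (isClosed_le (continuous_termNorm z n) continuous_const)
      (csInf_mem_closure hne hbdd)
  rcases (le_csInf hne fun r hr => hr.1.le).eq_or_lt with h0 | hpos
  · refine .inl (isFlat_of_norm_le (mem_supportedIn_of_mem_omega hz) hz₀ fun n => ?_)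
    simpa only [← h0, termNorm_zero_left] using hle n
  · refine .inr ⟨sInf S, hpos, hle, ?_⟩
    by_contra! hcon
    obtain ⟨r, hr, hrs, hlt⟩ := exists_lt_forall_termNorm_lt hE (half_pos hpos).le
      (half_lt_self hpos) (fun r hr => mem_gaussSpace_of_mem_omega hz ((half_pos hpos).trans_le hr))
      (norm_pos_iff.2 hz₀) fun n hn => (hle n).lt_of_ne (hcon n hn)
    exact (csInf_le hbdd ⟨(half_pos hpos).trans hr, normLE_apply_zero_of_forall_pos
      (mem_supportedIn_of_mem_omega hz) fun n hn => (hlt n hn).le⟩).not_gt hrs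

end TopSlope

/-! ### Weierstrass preparation -/

section Weierstrass

variable {E : Type*} [NormedField E] {p : ℕ} {r s θ : ℝ} {b : ℚ} {x y z u : ℚ → E}

lemma termNorm_lt_one_of_normLE_sub_one (hθ : θ < 1) (h : NormLE p r (x - seriesOne) θ) {n : ℚ}
    (hn : n ≠ 0) : termNorm p r x n < 1 := by
  simpa [termNorm, seriesOne, tPow, hn] using (h n).trans_lt hθ

variable [IsUltrametricDist E]

lemma norm_apply_zero_eq_one_of_normLE_sub_one (hθ : θ < 1) (h : NormLE p r (x - seriesOne) θ) :
    ‖x 0‖ = 1 := by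
  have h0 : ‖x 0 - 1‖ < ‖(1 : E)‖ := by
    rw [norm_one]
    simpa [seriesOne, tPow, termNorm_zero_exponent] using (h 0).trans_lt hθ
  rw [← sub_add_cancel (x 0) 1, IsUltrametricDist.norm_add_eq_max_of_norm_ne_norm h0.ne,
    max_eq_right h0.le, norm_one]

variable [Fact p.Prime] {C : Submodule E (ℚ → E)}

lemma mem_gaussSpace_of_mem_supportedIn_Icc (hx : x ∈ gaussSpace p E r)
    (hb : x ∈ supportedIn E (Set.Icc 0 b)) (s : ℝ) : x ∈ gaussSpace p E s := by
  refine mem_gaussSpace_of_termNorm_le (weight_pos (p := p) (-|s - r|) b) hx fun n => ?_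
  by_cases hn : n ∈ Set.Icc 0 b
  · rw [termNorm_eq_mul_weight_sub s r, mul_comm]
    refine mul_le_mul_of_nonneg_right (weight_le_weight ?_) (termNorm_nonneg _ _ _)
    have hn₀ : (0 : ℝ) ≤ n := by exact_mod_cast hn.1
    have hnb : (n : ℝ) ≤ b := by exact_mod_cast hn.2
    nlinarith [neg_abs_le (s - r), abs_nonneg (s - r)]
  · rw [termNorm_of_eq_zero p s (hb n hn), termNorm_of_eq_zero p r (hb n hn), mul_zero]

lemma NormLE.le_one_of_sub_one (hθ : θ ≤ 1) (h : NormLE p r (x - seriesOne) θ) :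
    NormLE p r x 1 := by
  simpa only [sub_add_cancel] using (h.mono hθ).add (normLE_one r)

lemma IsStable.exists_normalization (hE : HasDiscreteNorm E) (hC : IsStable p C) (hr : 0 < r)
    (hz : z ∈ omega p C) (hzb : z b ≠ 0)
    (hlt : ∀ n, n ≠ b → termNorm p r z n < termNorm p r z b) :
    ∃ u ∈ C, ∃ θ, (∀ ρ, 0 < ρ → u ∈ gaussSpace p E ρ) ∧ θ < 1 ∧
      NormLE p r (u - seriesOne) θ ∧ z = seriesMul (z b • tPow b) u := by
  obtain ⟨-, htb⟩ := hC.tPow_mem z (mem_of_mem_omega hz) b hzb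
  set u : ℚ → E := (z b)⁻¹ • seriesMul (tPow (-b)) z with hu
  have hun (n : ℚ) : u n = (z b)⁻¹ * z (n + b) := by
    rw [hu, Pi.smul_apply, tPow_seriesMul, sub_neg_eq_add, smul_eq_mul]
  have hum (ρ : ℝ) (hρ : 0 < ρ) : u ∈ gaussSpace p E ρ := Submodule.smul_mem _ _
    (mul_mem_gaussSpace (tPow_mem_gaussSpace ρ _) (mem_gaussSpace_of_mem_omega hz hρ))
  have hu1 (ρ : ℝ) (hρ : 0 < ρ) : u - seriesOne ∈ gaussSpace p E ρ :=
    Submodule.sub_mem _ (hum ρ hρ) (one_mem_gaussSpace ρ)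
  have hlt1 (n : ℚ) : termNorm p r (u - seriesOne) n < 1 := by
    by_cases hn : n = 0
    · rw [termNorm_of_eq_zero p r (by simp [hn, hun, hzb, seriesOne, tPow])]
      exact one_pos
    · have h : termNorm p r (u - seriesOne) n * termNorm p r z b = termNorm p r z (n + b) := by
        have hzb' : ‖z b‖ ≠ 0 := norm_ne_zero_iff.2 hzb
        simp only [termNorm, Pi.sub_apply, hun, seriesOne, tPow, Pi.single_eq_of_ne hn, sub_zero,
          norm_mul, norm_inv, weight_add]
        field_simp
      exact (mul_lt_iff_lt_one_left (termNorm_pos hzb)).1 (h ▸ hlt (n + b) (by simpa using hn))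
  obtain ⟨θ, -, hθ, hb⟩ := exists_normLE_lt hE hr.le (half_lt_self hr) (hu1 r hr)
    (hu1 _ (half_pos hr)) hlt1
  refine ⟨u, C.smul_mem _ (hC.mul_mem 1 one_pos _ ⟨htb, tPow_mem_gaussSpace 1 _⟩ _
    ⟨mem_of_mem_omega hz, mem_gaussSpace_of_mem_omega hz one_pos⟩), θ, hum, hθ, hb, ?_⟩
  funext n
  rw [smul_seriesMul, Pi.smul_apply, tPow_seriesMul, hun, smul_eq_mul, sub_add_cancel,
    mul_inv_cancel_left₀ hzb]

variable [CompleteSpace E]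

lemma NormLE.seriesMul_sub_one (hx : x ∈ gaussSpace p E r) (hy : y ∈ gaussSpace p E r)
    (hθ : θ ≤ 1) (hx₁ : NormLE p r (x - seriesOne) θ) (hy₁ : NormLE p r (y - seriesOne) θ) :
    NormLE p r (seriesMul x y - seriesOne) θ := by
  let X : gaussSpace p E r := ⟨x, hx⟩
  let Y : gaussSpace p E r := ⟨y, hy⟩
  have h : seriesMul x y - seriesOne = seriesMul (x - seriesOne) y + (y - seriesOne) :=
    congrArg Subtype.val (by ring : X * Y - 1 = (X - 1) * Y + (Y - 1))
  rw [h]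
  exact (by simpa only [mul_one] using hx₁.mul (hy₁.le_one_of_sub_one hθ) :
    NormLE p r (seriesMul (x - seriesOne) y) θ).add hy₁

lemma IsStable.exists_eq_neg_indicator (hC : IsStable p C) (hr : 0 < r) (hθ : θ < 1)
    {δ : ℚ → E} (hδ : δ ∈ C ⊓ gaussSpace p E r) (hb : NormLE p r δ θ) :
    ∃ g ∈ C ⊓ gaussSpace p E r ⊓ supportedIn E (Set.Iio 0),
      g = -(Set.Iio 0).indicator (δ + seriesMul δ g) ∧ NormLE p r g θ := by
  let F (x : ℚ → E) : ℚ → E := -(Set.Iio 0).indicator (δ + seriesMul δ x)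
  have hFsub {x y : ℚ → E} (hx : x ∈ gaussSpace p E r) (hy : y ∈ gaussSpace p E r) :
      F x - F y = -(Set.Iio 0).indicator (seriesMul δ (x - y)) := by
    have h : seriesMul δ (x - y) = (δ + seriesMul δ x) - (δ + seriesMul δ y) :=
      (congrArg Subtype.val (mul_sub (⟨δ, hδ.2⟩ : gaussSpace p E r) ⟨x, hx⟩ ⟨y, hy⟩)).trans
        (add_sub_add_left_eq_sub _ _ _).symm
    rw [h, Set.indicator_sub', neg_sub_neg, neg_sub]
  have hF0 : F 0 = -(Set.Iio 0).indicator δ := by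
    have h0 : seriesMul δ 0 = 0 := by funext n; simp [seriesMul]
    simp only [F, h0, add_zero]
  obtain ⟨g, hg, hFg, hgb⟩ := exists_fixedPoint
    (D := C ⊓ gaussSpace p E r ⊓ supportedIn E (Set.Iio 0)) (F := F) (K := θ)
    ((hC.isClosedAt r hr).inf (isClosedAt_supportedIn r _)) hb.nonneg hθ
    (fun x hx => by
      have hm := Submodule.add_mem _ hδ (hC.mul_mem_inf hr hδ hx.1)
      exact Submodule.neg_mem _ ⟨⟨hC.indicator_mem _ hm.1 0, indicator_mem_gaussSpace hm.2 _⟩,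
        indicator_mem_supportedIn _ _⟩)
    (fun x hx y hy c hxy => by
      rw [hFsub hx.1.2 hy.1.2]
      exact ((hb.mul hxy).indicator _).neg)
    (hF0 ▸ (hb.indicator _).neg)
  exact ⟨g, hg, hFg.symm, hgb⟩

lemma IsStable.exists_wienerHopf (hC : IsStable p C) (hr : 0 < r) (hθ : θ < 1)
    (hu : u ∈ C ⊓ gaussSpace p E r) (hb : NormLE p r (u - seriesOne) θ) :
    ∃ f ∈ C ⊓ gaussSpace p E r ⊓ supportedIn E (Set.Iic 0),
      NormLE p r (f - seriesOne) θ ∧ seriesMul u f ∈ supportedIn E (Set.Ici 0) := by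
  have h1 : seriesOne ∈ C ⊓ gaussSpace p E r := ⟨hC.one_mem, one_mem_gaussSpace r⟩
  have hδ : u - seriesOne ∈ C ⊓ gaussSpace p E r := Submodule.sub_mem _ hu h1
  obtain ⟨g, ⟨hgm, hg₀⟩, hg, hgb⟩ := hC.exists_eq_neg_indicator hr hθ hδ hb
  refine ⟨seriesOne + g, ⟨Submodule.add_mem _ h1 hgm, Submodule.add_mem _
    (one_mem_supportedIn Set.self_mem_Iic) fun n hn => hg₀ n fun h => hn (Set.mem_Iio.1 h).le⟩,
    by rwa [add_sub_cancel_left], fun n hn => ?_⟩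
  replace hn : n < 0 := not_le.1 hn
  set δ := u - seriesOne
  have hmul : seriesMul u (seriesOne + g) = seriesOne + (δ + seriesMul δ g) + g := by
    let U : gaussSpace p E r := ⟨u, hu.2⟩
    let G : gaussSpace p E r := ⟨g, hgm.2⟩
    exact congrArg Subtype.val (by ring : U * (1 + G) = 1 + ((U - 1) + (U - 1) * G) + G)
  have hgn : g n = -(δ + seriesMul δ g) n := by
    rw [← Set.indicator_of_mem (s := Set.Iio 0) hn (δ + seriesMul δ g)]
    exact congrFun hg n
  rw [hmul, Pi.add_apply, Pi.add_apply, hgn, one_mem_supportedIn Set.self_mem_Ici n hn.not_ge]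
  ring

/- As `f` has nonpositive exponents and `v = u f` nonnegative ones, `v` belongs to all the spaces in
which `u` lies. -/
lemma IsStable.exists_wienerHopf_omega (hC : IsStable p C) (hr : 0 < r) (hθ : θ < 1)
    (huC : u ∈ C) (hu : ∀ ρ, 0 < ρ → u ∈ gaussSpace p E ρ)
    (hb : NormLE p r (u - seriesOne) θ) :
    ∃ f ∈ gaussSpace p E r ⊓ supportedIn E (Set.Iic 0), ∃ v ∈ omega p C,
      NormLE p r (f - seriesOne) θ ∧ NormLE p r (v - seriesOne) θ ∧ seriesMul u f = v := by
  have hur : u ∈ C ⊓ gaussSpace p E r := ⟨huC, hu r hr⟩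
  obtain ⟨f, ⟨hf, hf₀⟩, hfb, hv₀⟩ := hC.exists_wienerHopf hr hθ hur hb
  have hfρ (ρ : ℝ) (hρ : ρ ≤ r) : f ∈ gaussSpace p E ρ := mem_gaussSpace_of_mul_le hf.2
    fun n hn => mul_le_mul_of_nonpos_right hρ
      (Rat.cast_nonpos.2 (not_lt.1 fun h => hn (hf₀ n h.not_ge)))
  refine ⟨f, ⟨hf.2, hf₀⟩, seriesMul u f, mem_omega.2 ⟨hC.mul_mem r hr u hur f hf, hv₀,
    fun ρ hρ => ?_⟩, hfb, hb.seriesMul_sub_one hur.2 hf.2 hθ.le hfb, rfl⟩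
  rcases le_total ρ r with h | h
  · exact mul_mem_gaussSpace (hu ρ hρ) (hfρ ρ h)
  · exact mem_gaussSpace_of_le h hv₀ (mul_mem_gaussSpace hur.2 hf.2)

lemma IsStable.exists_inverse_of_dominant (hE : HasDiscreteNorm E) (hC : IsStable p C)
    (hr : 0 < r) (hz : z ∈ omega p C) (hzb : z b ≠ 0)
    (hlt : ∀ n, n ≠ b → termNorm p r z n < termNorm p r z b) :
    ∃ v ∈ omega p C, ∃ h ∈ C ⊓ gaussSpace p E r ⊓ supportedIn E (Set.Ici 0), ∃ θ, θ < 1 ∧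
      NormLE p r (v - seriesOne) θ ∧ seriesMul v h = seriesOne ∧
      seriesMul z h ∈ supportedIn E (Set.Iic b) := by
  obtain ⟨u, huC, θ, hu, hθ, hub, hzu⟩ := hC.exists_normalization hE hr hz hzb hlt
  obtain ⟨f, ⟨hf, hf₀⟩, v, hv, hfb, hvb, huf⟩ := hC.exists_wienerHopf_omega hr hθ huC hu hub
  obtain ⟨hvC, hv₀, hvg⟩ := mem_omega.1 hv
  obtain ⟨h, hh, hvh⟩ := hC.exists_inverse_nonneg hr ⟨⟨hvC, hvg r hr⟩, hv₀⟩ hθ hvb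
  obtain ⟨g, ⟨hg, hg₀⟩, hfg⟩ := exists_mem_seriesMul_eq_one
    ((isClosedAt_gaussSpace r).inf (isClosedAt_supportedIn r (Set.Iic 0))) inf_le_left
    ⟨one_mem_gaussSpace r, one_mem_supportedIn Set.self_mem_Iic⟩
    (fun x hx y hy => ⟨mul_mem_gaussSpace hx.1 hy.1,
      seriesMul_mem_supportedIn hx.2 hy.2 fun _ ha _ hb => Set.mem_Iic.2 (add_nonpos ha hb)⟩)
    ⟨hf, hf₀⟩ hθ hfb
  let T : gaussSpace p E r := ⟨z b • tPow b, Submodule.smul_mem _ _ (tPow_mem_gaussSpace r b)⟩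
  let U : gaussSpace p E r := ⟨u, hu r hr⟩
  let F : gaussSpace p E r := ⟨f, hf⟩
  let V : gaussSpace p E r := ⟨v, hvg r hr⟩
  let H : gaussSpace p E r := ⟨h, hh.1.2⟩
  let G : gaussSpace p E r := ⟨g, hg⟩
  have hUF : U * F = V := Subtype.ext huf
  have hVH : V * H = 1 := Subtype.ext hvh
  have hFG : F * G = 1 := Subtype.ext hfg
  have hTUH : T * U * H = T * G := by
    linear_combination T * H * G * hUF + T * G * hVH - T * U * H * hFG
  have hzh : seriesMul z h = z b • seriesMul (tPow b) g :=
    calc seriesMul z h = seriesMul (seriesMul (z b • tPow b) u) h := by rw [← hzu]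
      _ = seriesMul (z b • tPow b) g := congrArg Subtype.val hTUH
      _ = z b • seriesMul (tPow b) g := smul_seriesMul ..
  refine ⟨v, hv, h, hh, θ, hθ, hvb, hvh, fun n hn => ?_⟩
  rw [hzh, Pi.smul_apply, tPow_seriesMul, hg₀ _ (by simpa using hn), smul_zero]

lemma IsStable.exists_weierstrass (hE : HasDiscreteNorm E) (hC : IsStable p C) (hr : 0 < r)
    (hz : z ∈ omega p C) (hzb : z b ≠ 0)
    (hlt : ∀ n, n ≠ b → termNorm p r z n < termNorm p r z b) :
    ∃ y ∈ omega p C, ∃ v ∈ omega p C, ∃ θ, y ∈ supportedIn E (Set.Icc 0 b) ∧ θ < 1 ∧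
      NormLE p r (v - seriesOne) θ ∧ z = seriesMul y v := by
  obtain ⟨v, hv, h, ⟨⟨hhC, hh⟩, hh₀⟩, θ, hθ, hvb, hvh, hzh⟩ :=
    hC.exists_inverse_of_dominant hE hr hz hzb hlt
  have hzr := mem_gaussSpace_of_mem_omega hz hr
  have hzh₀ := seriesMul_mem_supportedIn_Ici (mem_supportedIn_of_mem_omega hz) hh₀
  have hsupp : seriesMul z h ∈ supportedIn E (Set.Icc 0 b) := fun n hn =>
    (not_and_or.1 hn).elim (hzh₀ n) (hzh n)
  refine ⟨seriesMul z h, mem_omega.2 ⟨hC.mul_mem r hr z ⟨mem_of_mem_omega hz, hzr⟩ h ⟨hhC, hh⟩,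
    hzh₀, fun ρ _ => mem_gaussSpace_of_mem_supportedIn_Icc (mul_mem_gaussSpace hzr hh) hsupp ρ⟩,
    v, hv, θ, hsupp, hθ, hvb, ?_⟩
  rw [seriesMul_assoc hzr hh (mem_gaussSpace_of_mem_omega hv hr), seriesMul_comm h, hvh,
    seriesMul_seriesOne]

end Weierstrass

section Division

variable {E : Type*} [NormedField E] {p : ℕ} [Fact p.Prime] {C : Submodule E (ℚ → E)}
  {x y z z' : ℚ → E} {r s : ℝ} {b : ℚ}

lemma IsSegment.logb_le (h : IsSegment p y s b) {q : ℝ} (hq : 1 < q)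
    (hqE : ∀ a : E, 1 < ‖a‖ → q ≤ ‖a‖) : Real.logb p q ≤ s * b := by
  have hy₀ : ‖y 0‖ ≠ 0 := norm_ne_zero_iff.2 h.isDominant_zero.1
  have hyb : ‖y b / y 0‖ = (p : ℝ) ^ (s * b) := by
    have hp : (p : ℝ) ^ (s * b) ≠ 0 := (Real.rpow_pos_of_pos prime_cast_pos _).ne'
    have hb := h.termNorm_degree
    rw [termNorm, weight, Real.rpow_neg prime_cast_pos.le, mul_inv_eq_iff_eq_mul₀ hp] at hb
    rw [norm_div, hb, mul_div_cancel_left₀ _ hy₀]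
  rw [Real.logb_le_iff_le_rpow one_lt_prime_cast (one_pos.trans hq), ← hyb]
  exact hqE _ (hyb ▸ Real.one_lt_rpow one_lt_prime_cast
    (mul_pos h.slope_pos (Rat.cast_pos.2 h.degree_pos)))

variable [IsUltrametricDist E]

/-- The factor `y` of `z = y z'` carries the part of slope `s` of the Newton polygon of `z`: it
consists of a single segment of slope `-s`, while all slopes of `z'` are smaller than `s`. -/
structure IsSlopeDivision (p : ℕ) [Fact p.Prime] (C : Submodule E (ℚ → E)) (z y z' : ℚ → E)
    (s : ℝ) : Prop where
  left_mem : y ∈ omega p C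
  right_mem : z' ∈ omega p C
  eq_mul : z = seriesMul y z'
  right_zero : z' 0 = 1
  isSegment : ∃ b, IsSegment p y s b
  right_lt : ∃ r, 0 < r ∧ r < s ∧ ∀ n, 0 < n → termNorm p r z' n < 1

lemma IsTopSlope.exists_isDominant (hE : HasDiscreteNorm E) (hz : z ∈ omega p C) (hz₀ : z 0 ≠ 0)
    (hs : IsTopSlope p z s) : IsDominant p 1 s z 0 ∧ ∃ b > 0, IsDominant p (-1) s z b := by
  obtain ⟨hs₀, hle, n, hn, hne⟩ := hs
  simp only [NormLE, ← termNorm_zero_exponent p s z] at hle hne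
  refine ⟨⟨hz₀, fun m => ⟨hle m, fun hm => ?_⟩⟩, ?_⟩
  · rw [termNorm_of_eq_zero p s (apply_eq_zero_of_mem_omega hz (by linarith))]
    exact termNorm_pos hz₀
  · obtain ⟨b, hb⟩ := exists_isDominant_of_mem_omega hE hz (fun h => hz₀ (congrFun h 0)) hs₀ (-1)
    refine ⟨b, lt_of_not_ge fun hb₀ => ((hb.2 n).2 (by linarith)).not_ge ?_, hb⟩
    exact hne ▸ hle b

lemma IsDominant.exists_lt_forall_termNorm_lt (hE : HasDiscreteNorm E) (hz : z ∈ omega p C)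
    (hs : 0 < s) (hb : IsDominant p (-1) s z b) :
    ∃ r, 0 < r ∧ r < s ∧ ∀ n, n ≠ b → termNorm p r z n < termNorm p r z b := by
  set u : ℚ → E := seriesMul (tPow (-b)) z with hu_def
  have hu (ρ : ℝ) (n : ℚ) : termNorm p ρ u n * weight p ρ b = termNorm p ρ z (n + b) := by
    rw [termNorm, hu_def, tPow_seriesMul, sub_neg_eq_add, mul_assoc, ← weight_add, termNorm]
  have hug (ρ : ℝ) (hρ : 0 < ρ) : u ∈ gaussSpace p E ρ :=
    mul_mem_gaussSpace (tPow_mem_gaussSpace ρ _) (mem_gaussSpace_of_mem_omega hz hρ)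
  obtain ⟨r, hr, hrs, hlt⟩ := SlopeFact.exists_lt_forall_termNorm_lt hE (half_pos hs).le
    (half_lt_self hs) (fun ρ hρ => hug ρ ((half_pos hs).trans_le hρ)) (norm_pos_iff.2 hb.1)
    fun n hn => lt_of_mul_lt_mul_right (a := weight p s b)
      (by rw [hu]; exact (hb.2 _).2 (by linarith)) (weight_pos s b).le
  refine ⟨r, (half_pos hs).trans hr, hrs, fun n hn => ?_⟩
  rcases hn.lt_or_gt with hn | hn
  · exact termNorm_lt_of_termNorm_le (hb.2 n).1 hb.1
      (mul_lt_mul_of_neg_left (Rat.cast_lt.2 hn) (sub_neg.2 hrs))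
  · have h := mul_lt_mul_of_pos_right (hlt (n - b) (sub_pos.2 hn)) (weight_pos (p := p) r b)
    rwa [hu, sub_add_cancel] at h

lemma IsSlopeDivision.slope_lt (h : IsSlopeDivision p C z y z' s) {s' : ℝ}
    (hs' : IsTopSlope p z' s') : s' < s := by
  obtain ⟨r, -, hrs, hr⟩ := h.right_lt
  obtain ⟨-, -, n, hn, hne⟩ := hs'
  refine lt_of_not_ge fun hss' => ((termNorm_anti z' hn.le (hrs.le.trans hss')).trans_lt
    (hr n hn)).ne ?_
  rw [hne, h.right_zero, norm_one]

variable [CompleteSpace E]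

lemma IsStable.exists_isSlopeDivision (hE : HasDiscreteNorm E) (hC : IsStable p C)
    (hz : z ∈ omega p C) (hz₀ : z 0 ≠ 0) (hs : IsTopSlope p z s) :
    ∃ y z', IsSlopeDivision p C z y z' s := by
  obtain ⟨hdom₀, b, hb, hdomb⟩ := hs.exists_isDominant hE hz hz₀
  obtain ⟨r, hr, hrs, hlt⟩ := hdomb.exists_lt_forall_termNorm_lt hE hz hs.1
  obtain ⟨y, hy, v, hv, θ, hyb, hθ, hvb, hzyv⟩ := hC.exists_weierstrass hE hr hz hdomb.1 hlt
  have hv₀ : ‖v 0‖ = 1 := norm_apply_zero_eq_one_of_normLE_sub_one hθ hvb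
  have hv₀' : v 0 ≠ 0 := norm_pos_iff.1 (hv₀ ▸ one_pos)
  have hvlt (n : ℚ) (hn : n ≠ 0) : termNorm p r v n < 1 :=
    termNorm_lt_one_of_normLE_sub_one hθ hvb hn
  have hvdom (σ : ℚ) : IsDominant p σ s v 0 := isDominant_of_forall_termNorm_lt σ fun n hn => by
    rw [termNorm_zero_exponent, hv₀]
    rcases hn.lt_or_gt with hn' | hn'
    · rw [termNorm_of_eq_zero p s (apply_eq_zero_of_mem_omega hv hn')]
      exact one_pos
    · exact (termNorm_anti v hn'.le hrs.le).trans_lt (hvlt n hn)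
  have hy₀ : y ≠ 0 := by
    rintro rfl
    exact hz₀ (by simp [hzyv, seriesMul])
  have hydom {σ c : ℚ} (hσ : σ ≠ 0) (hc : IsDominant p σ s z c) : IsDominant p σ s y c := by
    rw [hzyv, seriesMul_comm] at hc
    simpa only [sub_zero] using (hvdom σ).right_of_seriesMul hE hv hy hy₀ hs.1 hσ hc
  have hseg : IsSegment p y s b :=
    ⟨hs.1, hb, hyb, hydom one_ne_zero hdom₀, hydom (by norm_num) hdomb⟩
  refine ⟨v 0 • y, (v 0)⁻¹ • v, Submodule.smul_mem _ _ hy, Submodule.smul_mem _ _ hv, ?_,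
    by simp [hv₀'], ⟨b, hseg.smul hv₀'⟩, r, hr, hrs, fun n hn => ?_⟩
  · rw [smul_seriesMul, seriesMul_smul, smul_smul, mul_inv_cancel₀ hv₀', one_smul, hzyv]
  · rw [termNorm_smul, norm_inv, hv₀, inv_one, one_mul]
    exact hvlt n hn.ne'

lemma IsSlopeDivision.exists_degree (hE : HasDiscreteNorm E) (h : IsSlopeDivision p C z y z' s)
    (hr : 0 < r) (hrs : r ≤ s) {q : ℝ} (hq : 1 < q) (hqE : ∀ a : E, 1 < ‖a‖ → q ≤ ‖a‖) {B : ℚ}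
    (hB : IsDominant p (-1) r z B) :
    ∃ b, IsDominant p (-1) r z' (B - b) ∧ Real.logb p q ≤ s * b := by
  obtain ⟨b, hseg⟩ := h.isSegment
  have hyb : IsDominant p (-1) r y b := by
    rcases hrs.eq_or_lt with rfl | hrs
    · exact hseg.isDominant_degree
    · exact hseg.isDominant_degree_of_lt hrs (-1)
  have hz' : z' ≠ 0 := by
    rintro rfl
    exact zero_ne_one h.right_zero
  exact ⟨b, hyb.right_of_seriesMul hE h.left_mem h.right_mem hz' hr (by norm_num) (h.eq_mul ▸ hB),
    hseg.logb_le hq hqE⟩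

end Division

/-! ### Slope factorizations -/

section Factorization

variable {E : Type*} [NormedField E] {p : ℕ} {C : Submodule E (ℚ → E)}

lemma partialProd_congr {y y' : ℕ → ℚ → E} {n : ℕ} (h : ∀ i < n, y i = y' i) :
    partialProd y n = partialProd y' n := by
  induction n with
  | zero => rfl
  | succ n ih =>
    rw [partialProd, partialProd, ih fun i hi => h i (hi.trans n.lt_succ_self), h n n.lt_succ_self]

lemma NormLE.w_le {r c : ℝ} {x : ℚ → E} (h : NormLE p r x c) : w p r x ≤ ENNReal.ofReal c :=
  iSup_le fun i => ENNReal.ofReal_le_ofReal (h i)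

lemma exists_enat_forall_lt_not (P : ℕ → Prop) :
    ∃ N : ℕ∞, (∀ n : ℕ, (n : ℕ∞) < N → ¬ P n) ∧ ∀ n : ℕ, N = n → P n := by
  classical
  by_cases h : ∃ n, P n
  · refine ⟨(Nat.find h : ℕ), fun n hn => Nat.find_min h (Nat.cast_lt.1 hn), fun n hn => ?_⟩
    exact Nat.cast_inj.1 hn ▸ Nat.find_spec h
  · exact ⟨⊤, fun n _ hn => h ⟨n, hn⟩, fun n hn => absurd hn (ENat.top_ne_natCast n)⟩

variable [Fact p.Prime]

lemma NormLE.indicator_Iio_sub {z : ℚ → E} {r s : ℝ} (hle : NormLE p s z 1) (hsr : s ≤ r) (j : ℚ) :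
    NormLE p r ((Set.Iio j).indicator z - z) (weight p (r - s) j) := fun n => by
  by_cases hn : n ∈ Set.Iio j
  · rw [termNorm_of_eq_zero p r (by rw [Pi.sub_apply, Set.indicator_of_mem hn, sub_self])]
    exact (weight_pos _ _).le
  · have hneg : ((Set.Iio j).indicator z - z) n = (-z) n := by
      rw [Pi.sub_apply, Set.indicator_of_notMem hn, zero_sub, Pi.neg_apply]
    have hjn : weight p (r - s) n ≤ weight p (r - s) j := weight_le_weight
      (mul_le_mul_of_nonneg_left (Rat.cast_le.2 (not_lt.1 hn)) (sub_nonneg.2 hsr))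
    calc termNorm p r ((Set.Iio j).indicator z - z) n = termNorm p r z n := by
          rw [termNorm, hneg, ← termNorm, termNorm_neg]
      _ = termNorm p s z n * weight p (r - s) n := termNorm_eq_mul_weight_sub r s z n
      _ ≤ 1 * weight p (r - s) j := mul_le_mul (hle n) hjn (weight_pos _ _).le zero_le_one
      _ = weight p (r - s) j := one_mul _

variable [IsUltrametricDist E]

lemma IsStable.partialProd_mem_omega (hC : IsStable p C) {y : ℕ → ℚ → E} {n : ℕ}
    (hy : ∀ i < n, y i ∈ omega p C) : partialProd y n ∈ omega p C := by
  induction n with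
  | zero => exact hC.one_mem_omega
  | succ n ih =>
    exact hC.mul_mem_omega (ih fun i hi => hy i (hi.trans n.lt_succ_self)) (hy n n.lt_succ_self)

lemma IsStable.isUnitOf_one (hC : IsStable p C) : IsUnitOf (omega p C) (seriesOne : ℚ → E) :=
  ⟨hC.one_mem_omega, seriesOne, hC.one_mem_omega, seriesOne_seriesMul _⟩

/-- A sequence of `N` successive slope divisions, the `n`-th one splitting off the factor `Y n` of
`Z n = Y n * Z (n + 1)`. The slope `s n` is the largest slope of `Z n`. -/
structure IsDivisionChain (p : ℕ) [Fact p.Prime] (C : Submodule E (ℚ → E)) (Z Y : ℕ → ℚ → E)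
    (s : ℕ → ℝ) (N : ℕ∞) : Prop where
  start_mem : Z 0 ∈ omega p C
  isTopSlope : ∀ n : ℕ, (n : ℕ∞) < N → IsTopSlope p (Z n) (s n)
  step : ∀ n : ℕ, (n : ℕ∞) < N → IsSlopeDivision p C (Z n) (Y n) (Z (n + 1)) (s n)

lemma natCast_lt_of_succ_le {n : ℕ} {N : ℕ∞} (h : ((n + 1 : ℕ) : ℕ∞) ≤ N) : (n : ℕ∞) < N :=
  (Nat.cast_lt.2 n.lt_succ_self).trans_le h

namespace IsDivisionChain

variable {x : ℚ → E} {Z Y : ℕ → ℚ → E} {s : ℕ → ℝ} {N : ℕ∞}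

lemma mem (h : IsDivisionChain p C Z Y s N) {n : ℕ} (hn : (n : ℕ∞) ≤ N) : Z n ∈ omega p C := by
  cases n with
  | zero => exact h.start_mem
  | succ n => exact (h.step n (natCast_lt_of_succ_le hn)).right_mem

lemma factor_mem (h : IsDivisionChain p C Z Y s N) {n : ℕ} (hn : (n : ℕ∞) < N) :
    Y n ∈ omega p C := (h.step n hn).left_mem

lemma partialProd_mem (hC : IsStable p C) (h : IsDivisionChain p C Z Y s N) {n : ℕ}
    (hn : (n : ℕ∞) ≤ N) : partialProd Y n ∈ omega p C :=
  hC.partialProd_mem_omega fun _ hi => h.factor_mem ((Nat.cast_lt.2 hi).trans_le hn)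

lemma isPureOfSlope (h : IsDivisionChain p C Z Y s N) {n : ℕ} (hn : (n : ℕ∞) < N) :
    IsPureOfSlope p (Y n) (s n) :=
  (h.step n hn).isSegment.choose_spec.isPureOfSlope

lemma slope_lt (h : IsDivisionChain p C Z Y s N) {i i' : ℕ} (hi : i < i')
    (hi' : (i' : ℕ∞) < N) : s i' < s i := by
  induction i', hi using Nat.le_induction with
  | base => exact (h.step i (natCast_lt_of_succ_le hi'.le)).slope_lt (h.isTopSlope _ hi')
  | succ n _ ih =>
    have hlt := natCast_lt_of_succ_le hi'.le
    exact ((h.step n hlt).slope_lt (h.isTopSlope _ hi')).trans (ih hlt)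

lemma antitone_slope (h : IsDivisionChain p C Z Y s ⊤) : Antitone s :=
  antitone_nat_of_succ_le fun n => (h.slope_lt n.lt_succ_self (ENat.natCast_lt_top _)).le

lemma slope_pos (h : IsDivisionChain p C Z Y s ⊤) (n : ℕ) : 0 < s n :=
  (h.isTopSlope n (ENat.natCast_lt_top n)).1

lemma apply_zero (h : IsDivisionChain p C Z Y s ⊤) {n : ℕ} (hn : n ≠ 0) : Z n 0 = 1 := by
  obtain ⟨m, rfl⟩ := Nat.exists_eq_succ_of_ne_zero hn
  exact (h.step m (ENat.natCast_lt_top m)).right_zero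

lemma start_ne_zero (h : IsDivisionChain p C Z Y s ⊤) : Z 0 ≠ 0 := fun h₀ => by
  have hst := h.step 0 (ENat.natCast_lt_top 0)
  have hZ := congrFun (h₀.symm.trans hst.eq_mul) 0
  rw [seriesMul_apply_zero (mem_supportedIn_of_mem_omega hst.left_mem)
    (mem_supportedIn_of_mem_omega hst.right_mem), hst.right_zero, mul_one] at hZ
  exact (h.isPureOfSlope (ENat.natCast_lt_top 0)).1 hZ.symm

end IsDivisionChain

lemma IsStable.exists_eq_tPow_seriesMul (hC : IsStable p C) {x : ℚ → E} (hx : x ∈ omega p C) {j : ℚ}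
    (hj : IsLeast (Function.support x) j) :
    tPow j ∈ omega p C ∧ ∃ z ∈ omega p C, z 0 ≠ 0 ∧ x = seriesMul (tPow j) z := by
  obtain ⟨hxC, -, hxg⟩ := mem_omega.1 hx
  obtain ⟨htj, htj'⟩ := hC.tPow_mem x hxC j hj.1
  have hz (n : ℚ) : seriesMul (tPow (-j)) x n = x (n + j) := by
    rw [tPow_seriesMul, sub_neg_eq_add]
  have hj₀ : 0 ≤ j := le_of_not_gt fun h => hj.1 (apply_eq_zero_of_mem_omega hx h)
  refine ⟨mem_omega.2 ⟨htj, fun n hn => ?_, fun r _ => tPow_mem_gaussSpace r j⟩,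
    seriesMul (tPow (-j)) x, mem_omega.2 ⟨?_, fun n hn => ?_, fun r hr => ?_⟩, ?_, ?_⟩
  · exact Pi.single_eq_of_ne ((not_le.1 hn).trans_le hj₀).ne _
  · exact hC.mul_mem 1 one_pos _ ⟨htj', tPow_mem_gaussSpace 1 _⟩ _ ⟨hxC, hxg 1 one_pos⟩
  · rw [hz]
    exact not_not.1 fun h => hn (by simpa using hj.2 h)
  · exact mul_mem_gaussSpace (tPow_mem_gaussSpace r _) (hxg r hr)
  · rw [hz, zero_add]
    exact hj.1
  · funext n
    rw [tPow_seriesMul, hz, sub_add_cancel]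

/- By the choice of `q`, a coefficient of norm greater than `1` is at least `q` in norm, which the
bound by `p ^ (s n)` excludes for the exponents `n < log_p q / s`. -/
lemma isFlat_indicator_Iio {z : ℚ → E} (hz : z ∈ omega p C) (hz₀ : z 0 = 1) {s : ℝ} (hs : 0 < s)
    (hle : NormLE p s z 1) {q : ℝ} (hq : 1 < q) (hqE : ∀ a : E, 1 < ‖a‖ → q ≤ ‖a‖) {j : ℚ}
    (hj₀ : 0 < j) (hj : s * j < Real.logb p q) : IsFlat p ((Set.Iio j).indicator z) := by
  have hu₀ : (Set.Iio j).indicator z 0 = 1 := by rw [Set.indicator_of_mem (Set.mem_Iio.2 hj₀), hz₀]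
  refine isFlat_of_norm_le (fun n hn => ?_) (hu₀ ▸ one_ne_zero) fun n => ?_
  · rw [Set.indicator_apply_eq_zero]
    exact fun _ => apply_eq_zero_of_mem_omega hz (not_le.1 hn)
  rw [hu₀, norm_one]
  by_cases hn : n ∈ Set.Iio j
  · rw [Set.indicator_of_mem hn]
    refine le_of_not_gt fun hlt => (hqE _ hlt).not_gt ?_
    have hzn : ‖z n‖ ≤ (p : ℝ) ^ (s * n) := by
      have h := hle n
      rwa [termNorm, weight, Real.rpow_neg prime_cast_pos.le, mul_inv_le_iff₀
        (Real.rpow_pos_of_pos prime_cast_pos _), one_mul] at h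
    refine hzn.trans_lt ((Real.lt_logb_iff_rpow_lt one_lt_prime_cast (one_pos.trans hq)).1 ?_)
    exact (mul_lt_mul_of_pos_left (Rat.cast_lt.2 hn) hs).trans hj
  · rw [Set.indicator_of_notMem hn, norm_zero]
    exact zero_le_one

variable [CompleteSpace E]

protected lemma IsFlat.seriesMul {x y : ℚ → E} (hx : x ∈ omega p C) (hy : y ∈ omega p C)
    (hfx : IsFlat p x) (hfy : IsFlat p y) : IsFlat p (seriesMul x y) := fun s hs n hn => by
  have hdom {σ : ℚ} (hσ : σ ≠ 0) : IsDominant p σ s (seriesMul x y) 0 := by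
    simpa only [add_zero] using (hfx.isDominant hs σ).seriesMul hσ
      (mem_gaussSpace_of_mem_omega hx hs) (mem_gaussSpace_of_mem_omega hy hs) (hfy.isDominant hs σ)
  rw [← termNorm_zero_exponent p s]
  exact (hdom one_ne_zero).termNorm_lt (hdom (by norm_num)) hn

lemma NormLE.of_seriesMul_left (hE : HasDiscreteNorm E) {x y : ℚ → E} {r c : ℝ} (hr : 0 < r)
    (hx : x ∈ omega p C) (hx₀ : x ≠ 0) (hy : y ∈ omega p C) (hy₀ : y 0 = 1)
    (h : NormLE p r (seriesMul x y) c) : NormLE p r x c := fun n => by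
  have hy' : y ≠ 0 := fun hy' => one_ne_zero (hy₀.symm.trans (congrFun hy' 0))
  obtain ⟨a, ha⟩ := exists_isDominant_of_mem_omega hE hx hx₀ hr 1
  obtain ⟨b, hb⟩ := exists_isDominant_of_mem_omega hE hy hy' hr 1
  calc termNorm p r x n ≤ termNorm p r x a * 1 := by rw [mul_one]; exact (ha.2 n).1
    _ ≤ termNorm p r x a * termNorm p r y b := mul_le_mul_of_nonneg_left
        (by simpa only [termNorm_zero_exponent, hy₀, norm_one] using (hb.2 0).1)
        (termNorm_nonneg r x a)
    _ = termNorm p r (seriesMul x y) (a + b) := (ha.termNorm_seriesMul one_ne_zero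
        (mem_gaussSpace_of_mem_omega hx hr) (mem_gaussSpace_of_mem_omega hy hr) hb).symm
    _ ≤ c := h _

namespace IsDivisionChain

variable {Z Y : ℕ → ℚ → E} {s : ℕ → ℝ}

lemma partialProd_seriesMul (hC : IsStable p C) {N : ℕ∞}
    (h : IsDivisionChain p C Z Y s N) {n : ℕ}
    (hn : (n : ℕ∞) ≤ N) : seriesMul (partialProd Y n) (Z n) = Z 0 := by
  induction n with
  | zero => exact seriesOne_seriesMul _
  | succ n ih =>
    have hlt := natCast_lt_of_succ_le hn
    rw [partialProd, omega_mul_assoc (h.partialProd_mem hC hlt.le) (h.factor_mem hlt) (h.mem hn),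
      ← (h.step n hlt).eq_mul, ih hlt.le]

/- Each step lowers the degree in the sense of the norm of exponent `ρ` by at least the fixed
amount `log_p q / s_0`, because `q` is the smallest norm exceeding `1`. -/
lemma exists_isDominant (hE : HasDiscreteNorm E) (h : IsDivisionChain p C Z Y s ⊤) {ρ : ℝ}
    (hρ : 0 < ρ) (hs : ∀ n, ρ ≤ s n) {q : ℝ} (hq : 1 < q) (hqE : ∀ a : E, 1 < ‖a‖ → q ≤ ‖a‖) {B : ℚ}
    (hB : IsDominant p (-1) ρ (Z 0) B) (n : ℕ) :
    ∃ B' : ℚ, IsDominant p (-1) ρ (Z n) B' ∧ n * (Real.logb p q / s 0) + B' ≤ B := by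
  induction n with
  | zero => exact ⟨B, hB, by simp⟩
  | succ n ih =>
    obtain ⟨B', hB', hle⟩ := ih
    obtain ⟨b, hb, hqb⟩ := (h.step n (ENat.natCast_lt_top n)).exists_degree hE hρ (hs n) hq hqE hB'
    refine ⟨B' - b, hb, ?_⟩
    have hb₀ : (0 : ℝ) < b :=
      pos_of_mul_pos_right ((Real.logb_pos one_lt_prime_cast hq).trans_le hqb) (h.slope_pos n).le
    have hsb : Real.logb p q / s 0 ≤ b := (div_le_iff₀' (h.slope_pos 0)).2
      (hqb.trans (mul_le_mul_of_nonneg_right (h.antitone_slope n.zero_le) hb₀.le))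
    push_cast
    linarith

lemma exists_slope_lt (hE : HasDiscreteNorm E) (h : IsDivisionChain p C Z Y s ⊤) {ρ : ℝ}
    (hρ : 0 < ρ) : ∃ n, s n < ρ := by
  by_contra! hs
  obtain ⟨q, hq, hqE⟩ := hE.exists_one_lt_forall_le_norm
  obtain ⟨B, hB⟩ := exists_isDominant_of_mem_omega hE h.start_mem h.start_ne_zero hρ (-1)
  have hδ : 0 < Real.logb p q / s 0 :=
    div_pos (Real.logb_pos one_lt_prime_cast hq) (h.slope_pos 0)
  obtain ⟨n, hn⟩ := exists_nat_gt (B / (Real.logb p q / s 0))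
  obtain ⟨B', hB', hle⟩ := h.exists_isDominant hE hρ hs hq hqE hB n
  have hB'₀ : 0 ≤ B' := le_of_not_gt fun hlt =>
    hB'.1 (apply_eq_zero_of_mem_omega (h.mem le_top) hlt)
  rw [div_lt_iff₀ hδ] at hn
  have : (0 : ℝ) ≤ B' := Rat.cast_nonneg.2 hB'₀
  linarith

lemma tendsto_slope (hE : HasDiscreteNorm E) (h : IsDivisionChain p C Z Y s ⊤) :
    Filter.Tendsto s Filter.atTop (𝓝 0) := by
  refine tendsto_order.2 ⟨fun a ha => .of_forall fun n => ha.trans (h.slope_pos n), fun ρ hρ => ?_⟩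
  obtain ⟨n, hn⟩ := h.exists_slope_lt hE hρ
  filter_upwards [Filter.eventually_ge_atTop n] with m hm
  exact (h.antitone_slope hm).trans_lt hn

lemma exists_flat_approximation (hE : HasDiscreteNorm E) (hC : IsStable p C)
    (h : IsDivisionChain p C Z Y s ⊤) :
    ∃ U : ℕ → ℚ → E, U 0 = seriesOne ∧ (∀ n, U n ∈ omega p C ∧ IsFlat p (U n)) ∧
      ∀ r : ℝ, 0 < r → ∃ c : ℕ → ℝ, Filter.Tendsto c Filter.atTop (𝓝 0) ∧
        ∀ᶠ n in Filter.atTop, NormLE p r (U n - Z n) (c n) := by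
  obtain ⟨q, hq, hqE⟩ := hE.exists_one_lt_forall_le_norm
  have hlog : 0 < Real.logb p q := Real.logb_pos one_lt_prime_cast hq
  have hj (n : ℕ) : ∃ j : ℚ, Real.logb p q / 2 / s n < j ∧ (j : ℝ) < Real.logb p q / s n :=
    exists_rat_btwn (div_lt_div_of_pos_right (half_lt_self hlog) (h.slope_pos n))
  choose j hltj hjlt using hj
  have hj₀ (n : ℕ) : 0 < j n :=
    Rat.cast_pos.1 ((div_pos (half_pos hlog) (h.slope_pos n)).trans (hltj n))
  have hjtop : Filter.Tendsto (fun n => (j n : ℝ)) Filter.atTop Filter.atTop := by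
    have hs : Filter.Tendsto s Filter.atTop (𝓝[>] 0) :=
      tendsto_nhdsWithin_iff.2 ⟨h.tendsto_slope hE, .of_forall h.slope_pos⟩
    exact Filter.tendsto_atTop_mono (fun n => (hltj n).le)
      ((tendsto_inv_nhdsGT_zero.comp hs).const_mul_atTop (half_pos hlog))
  have hle {n : ℕ} (hn : n ≠ 0) : NormLE p (s n) (Z n) 1 := by
    simpa only [h.apply_zero hn, norm_one] using (h.isTopSlope n (ENat.natCast_lt_top n)).2.1
  refine ⟨fun n => if n = 0 then seriesOne else (Set.Iio (j n)).indicator (Z n), if_pos rfl,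
    fun n => ?_, fun r hr => ⟨fun n => weight p (r - s n) (j n), tendsto_weight ?_, ?_⟩⟩
  · rcases eq_or_ne n 0 with rfl | hn
    · exact ⟨hC.one_mem_omega, isFlat_one⟩
    · simp only [if_neg hn]
      exact ⟨hC.indicator_mem_omega (h.mem le_top) _, isFlat_indicator_Iio (h.mem le_top)
        (h.apply_zero hn) (h.slope_pos n) (hle hn) hq hqE (hj₀ n)
        ((lt_div_iff₀' (h.slope_pos n)).1 (hjlt n))⟩
  · refine Filter.Tendsto.pos_mul_atTop hr ?_ hjtop
    simpa only [sub_zero] using (h.tendsto_slope hE).const_sub r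
  · filter_upwards [(h.tendsto_slope hE).eventually (ge_mem_nhds hr),
      Filter.eventually_ne_atTop 0] with n hn hn₀
    rw [if_neg hn₀]
    exact (hle hn₀).indicator_Iio_sub hn _

lemma partialProd_mul_units (hC : IsStable p C) (h : IsDivisionChain p C Z Y s ⊤)
    {U V : ℕ → ℚ → E} (hU₀ : U 0 = seriesOne) (hU : ∀ n, U n ∈ omega p C)
    (hV : ∀ n, V n ∈ omega p C) (hUV : ∀ n, seriesMul (U n) (V n) = seriesOne) (n : ℕ) :
    partialProd (fun i => seriesMul (Y i) (seriesMul (U (i + 1)) (V i))) n =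
      seriesMul (partialProd Y n) (U n) := by
  induction n with
  | zero => rw [hU₀, seriesMul_seriesOne]; rfl
  | succ n ih =>
    let ι (a : ℚ → E) (ha : a ∈ omega p C) : gaussSpace p E 1 :=
      ⟨a, mem_gaussSpace_of_mem_omega ha one_pos⟩
    let P := ι _ (h.partialProd_mem hC (n := n) le_top)
    let y := ι _ (h.factor_mem (ENat.natCast_lt_top n))
    have huv : ι _ (hU n) * ι _ (hV n) = 1 := Subtype.ext (hUV n)
    have hring : (P * ι _ (hU n)) * (y * (ι _ (hU (n + 1)) * ι _ (hV n))) =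
        (P * y) * ι _ (hU (n + 1)) := by
      linear_combination P * y * ι _ (hU (n + 1)) * huv
    rw [partialProd, ih]
    exact congrArg Subtype.val hring

lemma tendsto_w_sub (hE : HasDiscreteNorm E) (hC : IsStable p C)
    (h : IsDivisionChain p C Z Y s ⊤) {U : ℕ → ℚ → E} (hU : ∀ n, U n ∈ omega p C) {r : ℝ}
    (hr : 0 < r) {c : ℕ → ℝ} (hc : Filter.Tendsto c Filter.atTop (𝓝 0))
    (hle : ∀ᶠ n in Filter.atTop, NormLE p r (U n - Z n) (c n)) :
    Filter.Tendsto (fun n => w p r (seriesMul (partialProd Y n) (U n) - Z 0)) Filter.atTop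
      (𝓝 0) := by
  obtain ⟨d, hd⟩ := (mem_gaussSpace_of_mem_omega h.start_mem hr).1
  have hbound : ∀ᶠ n in Filter.atTop,
      w p r (seriesMul (partialProd Y n) (U n) - Z 0) ≤ ENNReal.ofReal (d * c n) := by
    filter_upwards [hle, Filter.eventually_ne_atTop 0] with n hn hn₀
    have hP := h.partialProd_mem hC (n := n) le_top
    have hPZ := h.partialProd_seriesMul hC (n := n) le_top
    have hP₀ : partialProd Y n ≠ 0 := fun hP₀ => h.start_ne_zero <| by
      rw [← hPZ, hP₀]; funext i; simp [seriesMul]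
    have hPd : NormLE p r (partialProd Y n) d :=
      NormLE.of_seriesMul_left hE hr hP hP₀ (h.mem le_top) (h.apply_zero hn₀) (hPZ ▸ hd)
    let P : gaussSpace p E r := ⟨_, mem_gaussSpace_of_mem_omega hP hr⟩
    let u : gaussSpace p E r := ⟨_, mem_gaussSpace_of_mem_omega (hU n) hr⟩
    let z : gaussSpace p E r := ⟨_, mem_gaussSpace_of_mem_omega (h.mem (n := n) le_top) hr⟩
    have hsub : seriesMul (partialProd Y n) (U n) - Z 0 =
        seriesMul (partialProd Y n) (U n - Z n) := by
      rw [← hPZ]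
      exact congrArg Subtype.val (mul_sub P u z).symm
    rw [hsub]
    exact (hPd.mul hn).w_le
  refine tendsto_of_tendsto_of_tendsto_of_le_of_le' tendsto_const_nhds ?_
    (.of_forall fun _ => zero_le) hbound
  simpa only [mul_zero, ENNReal.ofReal_zero] using ENNReal.tendsto_ofReal (hc.const_mul d)

/- The product of the `Y n` need not converge. Let `U n` be a unit close to the remaining factor
`Z n`; replacing `Y n` by `Y n * U (n + 1) / U n`, the `n`-th partial product becomes
`Z 0 * U n / Z n`. -/
lemma exists_tendsto_partialProd (hE : HasDiscreteNorm E) (hC : IsStable p C)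
    (h : IsDivisionChain p C Z Y s ⊤) :
    ∃ y : ℕ → ℚ → E, (∀ i, y i ∈ omega p C ∧ IsPureOfSlope p (y i) (s i)) ∧
      ∀ r : ℝ, 0 < r →
        Filter.Tendsto (fun n => w p r (partialProd y n - Z 0)) Filter.atTop (𝓝 0) := by
  obtain ⟨U, hU₀, hU, hUZ⟩ := h.exists_flat_approximation hE hC
  choose V hV hVflat hUV using fun n => hC.exists_inverse_of_isFlat hE (hU n).1 (hU n).2
  have hUV_mem (n : ℕ) := hC.mul_mem_omega (hU (n + 1)).1 (hV n)
  have hUV_flat (n : ℕ) : IsFlat p (seriesMul (U (n + 1)) (V n)) :=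
    IsFlat.seriesMul (hU (n + 1)).1 (hV n) (hU (n + 1)).2 (hVflat n)
  refine ⟨fun n => seriesMul (Y n) (seriesMul (U (n + 1)) (V n)), fun n => ⟨?_, ?_⟩, fun r hr => ?_⟩
  · exact hC.mul_mem_omega (h.factor_mem (ENat.natCast_lt_top n)) (hUV_mem n)
  · exact (h.isPureOfSlope (ENat.natCast_lt_top n)).mul_isFlat hE
      (h.factor_mem (ENat.natCast_lt_top n)) (hUV_mem n) (hUV_flat n)
  · obtain ⟨c, hc, hle⟩ := hUZ r hr
    simpa only [h.partialProd_mul_units hC hU₀ (fun n => (hU n).1) hV hUV] using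
      h.tendsto_w_sub hE hC (fun n => (hU n).1) hr hc hle

lemma hasSlopeFactorization_top (hE : HasDiscreteNorm E) (hC : IsStable p C)
    (h : IsDivisionChain p C Z Y s ⊤) {j : ℚ} (hj : tPow j ∈ omega p C) :
    HasSlopeFactorization p (omega p C) (seriesMul (tPow j) (Z 0)) := by
  obtain ⟨y, hy, hconv⟩ := h.exists_tendsto_partialProd hE hC
  exact ⟨⊤, seriesOne, j, y, s, Z 0, hC.isUnitOf_one, fun _ => rfl, hj, fun i _ => hy i,
    fun i i' hi hi' => h.slope_lt hi hi', fun _ => h.tendsto_slope hE, h.start_mem,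
    fun n hn => absurd hn (ENat.top_ne_natCast n), fun _ => hconv, (seriesOne_seriesMul _).symm⟩

lemma hasSlopeFactorization_succ (hE : HasDiscreteNorm E) (hC : IsStable p C) {m : ℕ}
    (h : IsDivisionChain p C Z Y s (m + 1 : ℕ)) (hflat : IsFlat p (Z (m + 1))) {j : ℚ}
    (hj : tPow j ∈ omega p C) :
    HasSlopeFactorization p (omega p C) (seriesMul (tPow j) (Z 0)) := by
  have hm : (m : ℕ∞) < (m + 1 : ℕ) := natCast_lt_of_succ_le le_rfl
  have hZ : Z (m + 1) ∈ omega p C := h.mem le_rfl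
  have hlast : partialProd (Function.update Y m (seriesMul (Y m) (Z (m + 1)))) (m + 1) = Z 0 := by
    rw [partialProd, Function.update_self, ← h.partialProd_seriesMul hC le_rfl, partialProd,
      omega_mul_assoc (h.partialProd_mem hC hm.le) (h.factor_mem hm) hZ,
      partialProd_congr fun i hi => Function.update_of_ne hi.ne _ _]
  refine ⟨(m + 1 : ℕ), seriesOne, j, Function.update Y m (seriesMul (Y m) (Z (m + 1))), s, Z 0,
    hC.isUnitOf_one, fun _ => rfl, hj, fun i hi => ?_, fun i i' hi hi' => h.slope_lt hi hi',
    fun h => absurd h (ENat.natCast_ne_top _), h.start_mem, fun n hn => ?_,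
    fun h => absurd h (ENat.natCast_ne_top _), (seriesOne_seriesMul _).symm⟩
  · rcases eq_or_ne i m with rfl | him
    · rw [Function.update_self]
      exact ⟨hC.mul_mem_omega (h.factor_mem hi) hZ,
        (h.isPureOfSlope hi).mul_isFlat hE (h.factor_mem hi) hZ hflat⟩
    · rw [Function.update_of_ne him]
      exact ⟨h.factor_mem hi, h.isPureOfSlope hi⟩
  · rw [← Nat.cast_inj.1 hn, hlast]

end IsDivisionChain

lemma IsFlat.hasSlopeFactorization (hE : HasDiscreteNorm E) (hC : IsStable p C)
    {x : ℚ → E} (hx : x ∈ omega p C) (hflat : IsFlat p x) {j : ℚ} (hj : tPow j ∈ omega p C) :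
    HasSlopeFactorization p (omega p C) (seriesMul (tPow j) x) := by
  obtain ⟨d, hd, -, hxd⟩ := hC.exists_inverse_of_isFlat hE hx hflat
  refine ⟨0, x, j, fun _ => seriesOne, fun _ => 0, seriesOne, ⟨hx, d, hd, hxd⟩,
    fun h => absurd rfl h, hj, fun i hi => absurd hi not_lt_zero, fun i i' _ hi => absurd hi
    not_lt_zero, fun h => absurd h ENat.zero_ne_top, hC.one_mem_omega, fun n hn => ?_,
    fun h => absurd h ENat.zero_ne_top, by rw [seriesMul_seriesOne, seriesMul_comm]⟩
  rw [Nat.cast_eq_zero.1 hn.symm, partialProd]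

lemma IsStable.exists_isDivisionChain (hE : HasDiscreteNorm E)
    (hC : IsStable p C) {x : ℚ → E} (hx : x ∈ omega p C) (hx₀ : x 0 ≠ 0) :
    ∃ Z Y s N, Z 0 = x ∧ IsDivisionChain p C Z Y s N ∧ ∀ n : ℕ, N = n → IsFlat p (Z n) := by
  have hstep (z : ℚ → E) (hz : z ∈ omega p C) (hz₀ : z 0 ≠ 0) (hflat : ¬ IsFlat p z) :
      ∃ y z' s, IsTopSlope p z s ∧ IsSlopeDivision p C z y z' s := by
    obtain ⟨s, hs⟩ := (isFlat_or_exists_isTopSlope hE hz hz₀).resolve_left hflat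
    obtain ⟨y, z', h⟩ := hC.exists_isSlopeDivision hE hz hz₀ hs
    exact ⟨y, z', s, hs, h⟩
  choose! F G σ hσ hdiv using hstep
  obtain ⟨N, hlt, hN⟩ := exists_enat_forall_lt_not fun n => IsFlat p (G^[n] x)
  have hZ (n : ℕ) (hn : (n : ℕ∞) ≤ N) : G^[n] x ∈ omega p C ∧ (G^[n] x) 0 ≠ 0 := by
    induction n with
    | zero => exact ⟨hx, hx₀⟩
    | succ n ih =>
      have hn' := natCast_lt_of_succ_le hn
      have h := hdiv _ (ih hn'.le).1 (ih hn'.le).2 (hlt n hn')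
      rw [Function.iterate_succ_apply']
      exact ⟨h.right_mem, h.right_zero ▸ one_ne_zero⟩
  refine ⟨fun n => G^[n] x, fun n => F (G^[n] x), fun n => σ (G^[n] x), N, rfl, ⟨hx, ?_, ?_⟩, hN⟩
  · exact fun n hn => hσ _ (hZ n hn.le).1 (hZ n hn.le).2 (hlt n hn)
  · intro n hn
    simp only [Function.iterate_succ_apply']
    exact hdiv _ (hZ n hn.le).1 (hZ n hn.le).2 (hlt n hn)

theorem IsStable.hasSlopeFactorization (hE : HasDiscreteNorm E)
    (hC : IsStable p C) {x : ℚ → E} (hx : x ∈ omega p C) {j : ℚ}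
    (hj : IsLeast (Function.support x) j) : HasSlopeFactorization p (omega p C) x := by
  obtain ⟨htj, z, hz, hz₀, rfl⟩ := hC.exists_eq_tPow_seriesMul hx hj
  obtain ⟨Z, Y, s, N, rfl, h, hflat⟩ := hC.exists_isDivisionChain hE hz hz₀
  rcases eq_or_ne N ⊤ with rfl | hN
  · exact h.hasSlopeFactorization_top hE hC htj
  · lift N to ℕ using hN
    cases N with
    | zero => exact (hflat 0 rfl).hasSlopeFactorization hE hC hz htj
    | succ m => exact h.hasSlopeFactorization_succ hE hC (hflat _ rfl) htj

end Factorization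

/-! ### The rings `Ω_an` and `Ω^imm_an` -/

section ImmediateSeries

variable {E : Type*} [NormedField E] {p : ℕ} {r : ℝ} {x : ℚ → E}

lemma w_lt_top_iff : w p r x < ⊤ ↔ ∃ c, NormLE p r x c := by
  refine ⟨fun h => ⟨(w p r x).toReal, fun n => ?_⟩,
    fun ⟨_, hc⟩ => hc.w_le.trans_lt ENNReal.ofReal_lt_top⟩
  rw [← ENNReal.ofReal_le_iff_le_toReal h.ne]
  exact le_iSup (fun i : ℚ => ENNReal.ofReal (‖x i‖ * (p : ℝ) ^ (-(r * (i : ℝ))))) n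

variable [IsUltrametricDist E] [Fact p.Prime]

lemma mem_gaussSpace_of_wellOrderedSupports (hr : 0 < r) (hx : x ∈ supportedIn E (Set.Ici 0))
    (hwf : WellOrderedSupports p x) (hw : w p r x < ⊤) : x ∈ gaussSpace p E r := by
  refine ⟨w_lt_top_iff.1 hw, fun ε hε => (hwf (Real.logb p ε)).mono fun n hn => ?_⟩
  have hn₀ : 0 ≤ n := by
    by_contra h
    exact ((termNorm_of_eq_zero p r (hx n h)).trans_lt hε).asymm hn
  rw [Set.mem_ofPred_eq, Real.rpow_logb prime_cast_pos one_lt_prime_cast.ne' hε]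
  exact lt_of_lt_of_le hn <|
    mul_le_of_le_one_right (norm_nonneg _) (weight_le_one (mul_nonneg hr.le (mod_cast hn₀)))

lemma wellOrderedSupports_of_mem_gaussSpace (hr : 0 < r) (hx : x ∈ gaussSpace p E r) :
    WellOrderedSupports p x := by
  intro ρ
  rw [Set.isWF_iff_no_descending_seq]
  intro f hf hρ
  have hpos : 0 < (p : ℝ) ^ ρ := Real.rpow_pos_of_pos prime_cast_pos ρ
  have hwf := hx.2 ((p : ℝ) ^ ρ * weight p r (f 0)) (mul_pos hpos (weight_pos r (f 0)))
  refine Set.isWF_iff_no_descending_seq.1 hwf f hf fun n => ?_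
  have hle : (f n : ℝ) ≤ f 0 := mod_cast hf.antitone n.zero_le
  exact mul_lt_mul (hρ n) (weight_le_weight (by gcongr)) (weight_pos r (f 0)) (norm_nonneg _)

theorem omegaImmAn_eq_omega : OmegaImmAn p E = omega p (⊤ : Submodule E (ℚ → E)) := by
  ext x
  rw [SetLike.mem_coe, mem_omega]
  constructor
  · rintro ⟨hx₀, hwf, hw⟩
    have hx : x ∈ supportedIn E (Set.Ici 0) := fun n hn => hx₀ n (not_le.1 hn)
    exact ⟨trivial, hx, fun r hr => mem_gaussSpace_of_wellOrderedSupports hr hx hwf (hw r hr)⟩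
  · rintro ⟨-, hx₀, hx⟩
    have hwf := wellOrderedSupports_of_mem_gaussSpace one_pos (hx 1 one_pos)
    exact ⟨fun n hn => hx₀ n hn.not_ge, hwf, fun r hr => w_lt_top_iff.2 (hx r hr).1⟩

lemma isStable_top : IsStable p (⊤ : Submodule E (ℚ → E)) where
  one_mem := trivial
  tPow_mem _ _ _ _ := ⟨trivial, trivial⟩
  indicator_mem _ _ _ := trivial
  mul_mem _ _ _ _ _ _ := trivial
  isClosedAt r _ := by
    rw [top_inf_eq]
    exact isClosedAt_gaussSpace r

end ImmediateSeries

section IntegralExponents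

variable {E : Type*} [NormedField E] {p : ℕ} {x : ℚ → E}

lemma exists_isLeast_support_of_mem_omegaAn (hx : x ∈ OmegaAn p E) (hx₀ : x ≠ 0) :
    ∃ j : ℚ, IsLeast (Function.support x) j := by
  classical
  have hnat : ∀ n : ℚ, x n ≠ 0 → ∃ m : ℕ, n = m := fun n => not_imp_comm.1 (hx.1 n)
  have hex : ∃ m : ℕ, x m ≠ 0 := by
    obtain ⟨n, hn⟩ := Function.ne_iff.1 hx₀
    obtain ⟨m, rfl⟩ := hnat n hn
    exact ⟨m, hn⟩
  refine ⟨Nat.find hex, Nat.find_spec hex, fun n hn => ?_⟩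
  obtain ⟨m, rfl⟩ := hnat n hn
  exact_mod_cast Nat.find_min' hex hn

variable [IsUltrametricDist E] [Fact p.Prime]

lemma isStable_supportedIn (A : AddSubgroup ℚ) :
    IsStable p (supportedIn E (A : Set ℚ)) where
  one_mem := one_mem_supportedIn A.zero_mem
  tPow_mem x hx j hj := by
    have hjA : j ∈ A := by
      by_contra h
      exact hj (hx j h)
    exact ⟨tPow_mem_supportedIn hjA, tPow_mem_supportedIn (A.neg_mem hjA)⟩
  indicator_mem x hx j n hn := Set.indicator_apply_eq_zero.2 fun _ => hx n hn
  mul_mem r _ x hx y hy := seriesMul_mem_supportedIn hx.1 hy.1 fun _ ha _ hb => A.add_mem ha hb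
  isClosedAt r _ := (isClosedAt_supportedIn r _).inf (isClosedAt_gaussSpace r)

lemma isWF_range_natCast : (Set.range (Nat.cast : ℕ → ℚ)).IsWF := by
  rw [← Set.image_univ]
  exact ((Set.isWF_univ_iff.2 inferInstance).isPWO.image_of_monotone Nat.mono_cast).isWF

theorem omegaAn_eq_omega :
    OmegaAn p E = omega p (supportedIn E ((Int.castAddHom ℚ).range : Set ℚ)) := by
  ext x
  rw [SetLike.mem_coe, mem_omega]
  constructor
  · rintro ⟨hx₀, hw⟩
    have hx : x ∈ supportedIn E (Set.range (Nat.cast : ℕ → ℚ)) :=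
      fun n hn => hx₀ n fun ⟨m, hm⟩ => hn ⟨m, hm.symm⟩
    refine ⟨fun n hn => hx n ?_, fun n hn => hx n ?_, fun r hr =>
      ⟨w_lt_top_iff.1 (hw r hr), fun ε hε => isWF_range_natCast.mono fun n hn => ?_⟩⟩
    · rintro ⟨m, rfl⟩
      exact hn ⟨m, by simp⟩
    · rintro ⟨m, rfl⟩
      exact hn (Set.mem_Ici.2 m.cast_nonneg)
    · by_contra h
      exact ((termNorm_of_eq_zero p r (hx n h)).trans_lt hε).asymm hn
  · rintro ⟨hC, hx₀, hg⟩
    refine ⟨fun n hn => ?_, fun r hr => w_lt_top_iff.2 (hg r hr).1⟩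
    by_contra hxn
    have hn₀ : 0 ≤ n := not_lt.1 fun h => hxn (hx₀ n h.not_ge)
    obtain ⟨m, rfl⟩ : n ∈ (Int.castAddHom ℚ).range := by
      by_contra h
      exact hxn (hC n h)
    lift m to ℕ using by simpa using hn₀
    exact hn ⟨m, by simp⟩

end IntegralExponents

/-! ### The ring `Γ^alg` -/

section PowerRoots

variable {p : ℕ} [Fact p.Prime] {R : Type*} [CommRing R]

section Teichmuller

variable {I : Ideal R} [CharP (R ⧸ I) p] [IsAdicComplete I R] {u : R}

lemma exists_pow_eq_of_mem_mrange_teichmuller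
    (hu : u ∈ MonoidHom.mrange (Perfection.teichmuller p I)) (m : ℕ) :
    ∃ v ∈ MonoidHom.mrange (Perfection.teichmuller p I), v ^ p ^ m = u := by
  obtain ⟨f, rfl⟩ := hu
  refine ⟨_, ⟨(frobeniusEquiv _ p).symm^[m] f, rfl⟩, ?_⟩
  rw [← map_pow, iterate_frobeniusEquiv_symm_pow_p_pow]

lemma mem_mrange_teichmuller_iff [IsReduced (R ⧸ I)] :
    u ∈ MonoidHom.mrange (Perfection.teichmuller p I) ↔ ∀ m : ℕ, ∃ v : R, v ^ p ^ m = u := by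
  refine ⟨fun hu m => ?_, fun hu => ?_⟩
  · obtain ⟨v, -, hv⟩ := exists_pow_eq_of_mem_mrange_teichmuller hu m
    exact ⟨v, hv⟩
  · choose v hv using hu
    have hroot (m : ℕ) : Ideal.Quotient.mk I (v (m + 1)) ^ p = Ideal.Quotient.mk I (v m) := by
      refine iterateFrobenius_inj (R ⧸ I) p m ?_
      simp only [iterateFrobenius_def, ← map_pow, ← pow_mul, ← pow_succ', hv]
    exact ⟨⟨fun m => Ideal.Quotient.mk I (v m), hroot⟩, Perfection.teichmuller_spec fun m =>
      ⟨v m, rfl, by rw [hv]⟩⟩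

lemma exists_mem_mrange_teichmuller_sub_mem [PerfectRing (R ⧸ I) p] (a : R) :
    ∃ t ∈ MonoidHom.mrange (Perfection.teichmuller p I), a - t ∈ I := by
  obtain ⟨f, hf⟩ := Perfection.coeff_surjective (surjective_frobenius (R ⧸ I) p) 0
    (Ideal.Quotient.mk I a)
  refine ⟨_, ⟨f, rfl⟩, Ideal.Quotient.eq.1 ?_⟩
  rw [Perfection.mk_teichmuller, hf]

end Teichmuller

lemma exists_eq_pow_add_mul_of_mem_closure {S : Subring R} {T : Set R} (hT : T ⊆ S) {N : ℕ}
    (hroot : ∀ t ∈ T, ∃ v ∈ T, v ^ p ^ N = t) {x : R} (hx : x ∈ AddSubmonoid.closure T) :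
    ∃ v ∈ S, ∃ s ∈ S, x = v ^ p ^ N + p * s := by
  induction hx using AddSubmonoid.closure_induction with
  | mem t ht =>
    obtain ⟨v, hv, rfl⟩ := hroot t ht
    exact ⟨v, hT hv, 0, S.zero_mem, by rw [mul_zero, add_zero]⟩
  | zero =>
    exact ⟨0, S.zero_mem, 0, S.zero_mem, by
      rw [zero_pow (pow_ne_zero N (NeZero.ne p)), mul_zero, add_zero]⟩
  | add x y _ _ hx hy =>
    obtain ⟨v, hv, s, hs, rfl⟩ := hx
    obtain ⟨v', hv', s', hs', rfl⟩ := hy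
    obtain ⟨c, hc⟩ := exists_add_pow_prime_pow_eq (Fact.out : p.Prime) (⟨v, hv⟩ : S) ⟨v', hv'⟩ N
    have hc' := congrArg Subtype.val hc
    push_cast at hc'
    refine ⟨v + v', S.add_mem hv hv', s + s' - v * v' * c, ?_, by rw [hc']; ring⟩
    exact S.sub_mem (S.add_mem hs hs') (S.mul_mem (S.mul_mem hv hv') c.2)

end PowerRoots

section AdicClosure

variable {O R : Type*} [CommRing O] [CommRing R] [Algebra O R]

/-- The closure of the subalgebra `S` of `R` in the `I`-adic topology. -/
def adicClosure (I : Ideal R) (S : Subalgebra O R) : Subalgebra O R where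
  carrier := {x | ∀ N : ℕ, ∃ z ∈ S, x - z ∈ I ^ N}
  algebraMap_mem' a _ := ⟨_, S.algebraMap_mem a, by rw [sub_self]; exact Ideal.zero_mem _⟩
  add_mem' hx hy N := by
    obtain ⟨z, hz, hxz⟩ := hx N
    obtain ⟨w, hw, hyw⟩ := hy N
    exact ⟨z + w, S.add_mem hz hw, by rw [add_sub_add_comm]; exact Ideal.add_mem _ hxz hyw⟩
  mul_mem' {x y} hx hy N := by
    obtain ⟨z, hz, hxz⟩ := hx N
    obtain ⟨w, hw, hyw⟩ := hy N
    refine ⟨z * w, S.mul_mem hz hw, ?_⟩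
    rw [show x * y - z * w = x * (y - w) + w * (x - z) by ring]
    exact Ideal.add_mem _ (Ideal.mul_mem_left _ _ hyw) (Ideal.mul_mem_left _ _ hxz)

variable {I : Ideal R} {S : Subalgebra O R} {x : R}

lemma mem_adicClosure : x ∈ adicClosure I S ↔ ∀ N : ℕ, ∃ z ∈ S, x - z ∈ I ^ N := Iff.rfl

lemma le_adicClosure : S ≤ adicClosure I S := fun x hx _ =>
  ⟨x, hx, by rw [sub_self]; exact Ideal.zero_mem _⟩

variable {ϖ : O}

lemma mem_adicClosure_of_smul_mem (hϖ : IsLeftRegular (algebraMap O R ϖ))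
    (hS : ∀ z ∈ S, z ∈ Ideal.span {algebraMap O R ϖ} → ∀ N : ℕ, ∃ s ∈ S,
      z - ϖ • s ∈ Ideal.span {algebraMap O R ϖ} ^ N)
    (hx : ϖ • x ∈ adicClosure (Ideal.span {algebraMap O R ϖ}) S) :
    x ∈ adicClosure (Ideal.span {algebraMap O R ϖ}) S := fun N => by
  have hϖx (y : R) : ϖ • y ∈ Ideal.span {algebraMap O R ϖ} := by
    rw [Algebra.smul_def]
    exact Ideal.mul_mem_right _ _ (Ideal.mem_span_singleton_self _)
  obtain ⟨z, hz, hxz⟩ := hx (N + 1)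
  have hzI : z ∈ Ideal.span {algebraMap O R ϖ} := by
    rw [← sub_sub_cancel (ϖ • x) z]
    exact Ideal.sub_mem _ (hϖx x) (Ideal.pow_le_self N.succ_ne_zero hxz)
  obtain ⟨s, hs, hzs⟩ := hS z hz hzI (N + 1)
  refine ⟨s, hs, ?_⟩
  have h : ϖ • (x - s) ∈ Ideal.span {algebraMap O R ϖ} ^ (N + 1) := by
    rw [smul_sub, ← sub_add_sub_cancel]
    exact Ideal.add_mem _ hxz hzs
  rw [Ideal.span_singleton_pow, Ideal.mem_span_singleton] at h ⊢
  rw [Algebra.smul_def, pow_succ'] at h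
  exact hϖ.dvd_cancel_left.1 h

variable {T : Submonoid R}

lemma exists_eq_add_smul_of_mem_adjoin
    (hT : ∀ a : O, ∃ b : O, algebraMap O R b ∈ T ∧ ϖ ∣ a - b)
    (hx : x ∈ Algebra.adjoin O (T : Set R)) :
    ∃ m ∈ AddSubmonoid.closure (T : Set R), ∃ s ∈ Algebra.adjoin O (T : Set R), x = m + ϖ • s := by
  rw [← Subalgebra.mem_toSubmodule, Algebra.adjoin_eq_span, Submonoid.closure_eq] at hx
  induction hx using Submodule.closure_induction with
  | zero => exact ⟨0, zero_mem _, 0, zero_mem _, by rw [smul_zero, add_zero]⟩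
  | add x y _ _ hx hy =>
    obtain ⟨m, hm, s, hs, rfl⟩ := hx
    obtain ⟨m', hm', s', hs', rfl⟩ := hy
    exact ⟨m + m', add_mem hm hm', s + s', add_mem hs hs', by rw [smul_add, add_add_add_comm]⟩
  | smul_mem a t ht =>
    obtain ⟨b, hb, c, hc⟩ := hT a
    refine ⟨algebraMap O R b * t, AddSubmonoid.subset_closure (T.mul_mem hb ht), c • t,
      Subalgebra.smul_mem _ (Algebra.subset_adjoin ht) c, ?_⟩
    rw [← Algebra.smul_def, smul_smul, ← hc, ← add_smul, add_sub_cancel]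

variable {p : ℕ} [Fact p.Prime]

lemma exists_sub_smul_mem_pow (hϖ : (Ideal.span {algebraMap O R ϖ}).IsPrime) (hp : ϖ ∣ p)
    (hT : ∀ a : O, ∃ b : O, algebraMap O R b ∈ T ∧ ϖ ∣ a - b)
    (hroot : ∀ t ∈ T, ∀ N : ℕ, ∃ v ∈ T, v ^ p ^ N = t) (hx : x ∈ Algebra.adjoin O (T : Set R))
    (hxϖ : x ∈ Ideal.span {algebraMap O R ϖ}) (N : ℕ) :
    ∃ s ∈ Algebra.adjoin O (T : Set R), x - ϖ • s ∈ Ideal.span {algebraMap O R ϖ} ^ N := by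
  obtain ⟨m, hm, s, hs, rfl⟩ := exists_eq_add_smul_of_mem_adjoin hT hx
  obtain ⟨v, -, s', hs', rfl⟩ := exists_eq_pow_add_mul_of_mem_closure
    (S := (Algebra.adjoin O (T : Set R)).toSubring) Algebra.subset_adjoin
    (fun t ht => hroot t ht N) hm
  obtain ⟨c, hc⟩ := hp
  have hpc : (p : R) * s' = ϖ • c • s' := by
    rw [smul_smul, ← hc, Algebra.smul_def, map_natCast]
  have hsub : v ^ p ^ N + p * s' + ϖ • s - ϖ • (c • s' + s) = v ^ p ^ N := by
    rw [hpc, smul_add]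
    ring
  have hv : v ^ p ^ N ∈ Ideal.span {algebraMap O R ϖ} := by
    rw [← hsub, Algebra.smul_def _ (c • s' + s)]
    exact Ideal.sub_mem _ hxϖ (Ideal.mul_mem_right _ _ (Ideal.mem_span_singleton_self _))
  refine ⟨c • s' + s, add_mem (Subalgebra.smul_mem _ hs' c) hs, ?_⟩
  rw [hsub]
  exact Ideal.pow_le_pow_right (Nat.lt_pow_self (Fact.out : p.Prime).one_lt).le
    (Ideal.pow_mem_pow (hϖ.mem_of_pow_mem _ hv) _)

end AdicClosure

section UnitBall

/-- The image of `O` in `E` is the unit ball of `E`. -/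
def IsUnitBall (O E : Type*) [CommRing O] [NormedField E] [Algebra O E] : Prop :=
  ∀ a : E, ‖a‖ ≤ 1 ↔ a ∈ Set.range (algebraMap O E)

namespace IsUnitBall

variable {O : Type*} [CommRing O] {E : Type*} [NormedField E] [Algebra O E]

lemma norm_algebraMap_le_one (hB : IsUnitBall O E) (a : O) : ‖algebraMap O E a‖ ≤ 1 :=
  (hB _).2 ⟨a, rfl⟩

variable [IsFractionRing O E]

lemma norm_algebraMap_eq_one_iff (hB : IsUnitBall O E) {a : O} :
    ‖algebraMap O E a‖ = 1 ↔ IsUnit a := by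
  refine ⟨fun ha => ?_, fun ha => ?_⟩
  · have ha₀ : algebraMap O E a ≠ 0 := norm_pos_iff.1 (ha ▸ one_pos)
    obtain ⟨b, hb⟩ := (hB (algebraMap O E a)⁻¹).1 (by rw [norm_inv, ha, inv_one])
    refine .of_mul_eq_one b (IsFractionRing.injective O E ?_)
    rw [map_mul, hb, map_one, mul_inv_cancel₀ ha₀]
  · obtain ⟨b, hb⟩ := ha.exists_right_inv
    refine (hB.norm_algebraMap_le_one a).antisymm ?_
    calc (1 : ℝ) = ‖algebraMap O E a‖ * ‖algebraMap O E b‖ := by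
          rw [← norm_mul, ← map_mul, hb, map_one, norm_one]
      _ ≤ ‖algebraMap O E a‖ :=
          mul_le_of_le_one_right (norm_nonneg _) (hB.norm_algebraMap_le_one b)

lemma norm_algebraMap_lt_one_iff [IsLocalRing O] (hB : IsUnitBall O E) {a : O} :
    ‖algebraMap O E a‖ < 1 ↔ IsLocalRing.residue O a = 0 := by
  rw [(hB.norm_algebraMap_le_one a).lt_iff_ne, Ne, hB.norm_algebraMap_eq_one_iff,
    IsLocalRing.residue_eq_zero_iff, IsLocalRing.mem_maximalIdeal, mem_nonunits_iff]

section Uniformizer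

variable {ϖ : O}

lemma norm_algebraMap_irreducible_lt_one (hB : IsUnitBall O E) (hϖ : Irreducible ϖ) :
    ‖algebraMap O E ϖ‖ < 1 :=
  (hB.norm_algebraMap_le_one ϖ).lt_of_ne (hB.norm_algebraMap_eq_one_iff.not.2 hϖ.not_isUnit)

variable [IsDomain O] [IsDiscreteValuationRing O]

lemma norm_le_of_norm_lt_one (hB : IsUnitBall O E) (hϖ : Irreducible ϖ) {a : E} (ha : ‖a‖ < 1) :
    ‖a‖ ≤ ‖algebraMap O E ϖ‖ := by
  obtain ⟨b, rfl⟩ := (hB a).1 ha.le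
  rw [hB.norm_algebraMap_lt_one_iff, IsLocalRing.residue_eq_zero_iff, hϖ.maximalIdeal_eq,
    Ideal.mem_span_singleton] at ha
  obtain ⟨c, rfl⟩ := ha
  rw [map_mul, norm_mul]
  exact mul_le_of_le_one_right (norm_nonneg _) (hB.norm_algebraMap_le_one c)

lemma exists_norm_eq_pow (hB : IsUnitBall O E) (hϖ : Irreducible ϖ) {a : E} (ha₀ : a ≠ 0)
    (ha : ‖a‖ ≤ 1) : ∃ n : ℕ, ‖a‖ = ‖algebraMap O E ϖ‖ ^ n := by
  obtain ⟨b, rfl⟩ := (hB a).1 ha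
  obtain ⟨n, u, rfl⟩ := IsDiscreteValuationRing.eq_unit_mul_pow_irreducible
    (ne_zero_of_map ha₀) hϖ
  refine ⟨n, ?_⟩
  rw [map_mul, norm_mul, hB.norm_algebraMap_eq_one_iff.2 u.isUnit, one_mul, map_pow, norm_pow]

lemma hasDiscreteNorm (hB : IsUnitBall O E) : HasDiscreteNorm E := fun c C hc => by
  obtain ⟨ϖ, hϖ⟩ := IsDiscreteValuationRing.exists_irreducible O
  have hϖ₀ : 0 < ‖algebraMap O E ϖ‖ := norm_pos_iff.2 (by simpa using hϖ.ne_zero)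
  have hϖ₁ := hB.norm_algebraMap_irreducible_lt_one hϖ
  have hC : 0 < max C 1 := lt_max_of_lt_right one_pos
  obtain ⟨N, hN⟩ := exists_pow_lt_of_lt_one (inv_pos.2 hC) hϖ₁
  obtain ⟨M, hM⟩ := exists_pow_lt_of_lt_one (mul_pos (pow_pos hϖ₀ N) hc) hϖ₁
  refine ((Set.finite_Iio M).image fun m => ‖algebraMap O E ϖ‖ ^ m / ‖algebraMap O E ϖ‖ ^ N).subset
    ?_
  rintro - ⟨⟨a, rfl⟩, hac, haC⟩
  have ha₀ : algebraMap O E ϖ ^ N * a ≠ 0 :=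
    mul_ne_zero (pow_ne_zero N (norm_pos_iff.1 hϖ₀)) (norm_pos_iff.1 (hc.trans_le hac))
  have hnorm : ‖algebraMap O E ϖ ^ N * a‖ = ‖algebraMap O E ϖ‖ ^ N * ‖a‖ := by
    rw [norm_mul, norm_pow]
  obtain ⟨m, hm⟩ := hB.exists_norm_eq_pow hϖ ha₀ <| by
    rw [hnorm]
    exact (mul_le_mul hN.le (haC.trans (le_max_left C 1)) (norm_nonneg a)
      (inv_pos.2 hC).le).trans_eq (inv_mul_cancel₀ hC.ne')
  rw [hnorm] at hm
  refine ⟨m, ?_, by simp only [← hm, mul_div_cancel_left₀ _ (pow_pos hϖ₀ N).ne']⟩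
  rw [Set.mem_Iio, ← pow_lt_pow_iff_right_of_lt_one₀ hϖ₀ hϖ₁, ← hm]
  exact hM.trans_le (mul_le_mul_of_nonneg_left hac (pow_pos hϖ₀ N).le)

end Uniformizer

end IsUnitBall

end UnitBall

section Reduction

variable {O : Type*} [CommRing O] [IsLocalRing O] {E : Type*} [NormedField E] [Algebra O E]
  {x y : ℚ → E} {a b : HahnSeries ℚ (IsLocalRing.ResidueField O)}

lemma IsReduction.add (hx : IsReduction x a) (hy : IsReduction y b) :
    IsReduction (x + y) (a + b) := fun n => by
  obtain ⟨c, hcx, hca⟩ := hx n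
  obtain ⟨d, hdy, hdb⟩ := hy n
  exact ⟨c + d, by rw [map_add, hcx, hdy, Pi.add_apply],
    by rw [map_add, hca, hdb, HahnSeries.coeff_add]⟩

lemma isReduction_single (q : ℚ) (c : O) : IsReduction (Pi.single q (algebraMap O E c))
    (HahnSeries.single q (IsLocalRing.residue O c)) := fun n => by
  rcases eq_or_ne n q with rfl | h
  · exact ⟨c, (Pi.single_eq_same (M := fun _ => E) n _).symm,
      (HahnSeries.coeff_single_same n _).symm⟩
  · exact ⟨0, by rw [map_zero, Pi.single_eq_of_ne h],
      by rw [map_zero, HahnSeries.coeff_single_of_ne h]⟩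

lemma isReduction_zero : IsReduction (O := O) (0 : ℚ → E) 0 := fun _ =>
  ⟨0, map_zero _, map_zero _⟩

variable [IsFractionRing O E]

lemma IsReduction.unique (ha : IsReduction x a) (hb : IsReduction x b) : a = b := by
  ext n
  obtain ⟨c, hcx, hca⟩ := ha n
  obtain ⟨d, hdx, hdb⟩ := hb n
  rw [← hca, ← hdb, IsFractionRing.injective O E (hcx.trans hdx.symm)]

lemma IsReduction.coeff_eq_zero_iff (hB : IsUnitBall O E) (ha : IsReduction x a) (n : ℚ) :
    a.coeff n = 0 ↔ ‖x n‖ < 1 := by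
  obtain ⟨c, hcx, hca⟩ := ha n
  rw [← hca, ← hcx, hB.norm_algebraMap_lt_one_iff]

end Reduction

section Gamma

lemma exists_finset_coeff_mul_eq_sum {Γ R : Type*} [AddCommGroup Γ] [PartialOrder Γ]
    [IsOrderedCancelAddMonoid Γ] [NonUnitalNonAssocSemiring R] (a b : HahnSeries Γ R) (n : Γ) :
    ∃ F : Finset Γ, (a * b).coeff n = ∑ i ∈ F, a.coeff i * b.coeff (n - i) ∧
      ∀ i ∉ F, a.coeff i * b.coeff (n - i) = 0 := by
  classical
  have hsnd {i : Γ × Γ} (hi : i ∈ Finset.antidiagonal a.isPWO_support b.isPWO_support n) :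
      i.2 = n - i.1 := eq_sub_of_add_eq' (Finset.mem_antidiagonal.1 hi).2.2
  refine ⟨(Finset.antidiagonal a.isPWO_support b.isPWO_support n).image Prod.fst, ?_,
    fun i hi => ?_⟩
  · rw [HahnSeries.coeff_mul, Finset.sum_image fun i hi j hj hij => Prod.ext hij <| by
      rw [hsnd hi, hsnd hj, hij]]
    exact Finset.sum_congr rfl fun i hi => by rw [hsnd hi]
  · contrapose! hi
    exact Finset.mem_image.2 ⟨(i, n - i), Finset.mem_antidiagonal.2
      ⟨left_ne_zero_of_mul hi, right_ne_zero_of_mul hi, add_sub_cancel i n⟩, rfl⟩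

variable {p : ℕ} [Fact p.Prime] {O : Type*} [CommRing O] {E : Type*} [NormedField E]
  [IsUltrametricDist E] [CompleteSpace E] [Algebra O E]

instance gaussSpace.instAlgebra (r : ℝ) : Algebra O (gaussSpace p E r) :=
  Algebra.ofModule
    (fun a x y => Subtype.ext <| by
      rw [← algebraMap_smul E a x, ← algebraMap_smul E a (x * y)]
      exact smul_seriesMul _ _ _)
    (fun a x y => Subtype.ext <| by
      rw [← algebraMap_smul E a y, ← algebraMap_smul E a (x * y)]
      exact seriesMul_smul _ _ _)

lemma coe_pow_gaussSpace {r : ℝ} (x : gaussSpace p E r) (n : ℕ) :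
    ((x ^ n : gaussSpace p E r) : ℚ → E) = seriesPow x n := by
  induction n with
  | zero => rfl
  | succ n ih => rw [pow_succ, coe_mul_gaussSpace, ih]; rfl

namespace IsUnitBall

/-- The ring `Γ^imm`, as an `O`-algebra. -/
def gammaImm (hB : IsUnitBall O E) (p : ℕ) [Fact p.Prime] :
    Subalgebra O (gaussSpace p E 0) where
  carrier := {x | NormLE p 0 x.1 1}
  mul_mem' hx hy := (NormLE.mul hx hy).mono (one_mul _).le
  add_mem' hx hy := NormLE.add hx hy
  algebraMap_mem' a := by
    rw [Algebra.algebraMap_eq_smul_one, ← algebraMap_smul E a (1 : gaussSpace p E 0)]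
    exact ((normLE_one 0).smul _).mono <| by simpa using hB.norm_algebraMap_le_one a

variable {hB : IsUnitBall O E}

lemma mem_gammaImm_iff (hB : IsUnitBall O E) {x : ℚ → E} :
    x ∈ GammaImm p O E ↔ ∃ y : hB.gammaImm p, y.1.1 = x := by
  constructor
  · rintro ⟨hx, hwf⟩
    have hx₁ : NormLE p 0 x 1 := fun n => by simpa only [termNorm_zero_left] using (hB _).2 (hx n)
    refine ⟨⟨⟨x, ⟨1, hx₁⟩, fun ε hε => ?_⟩, hx₁⟩, rfl⟩
    simpa only [termNorm_zero_left, Real.rpow_logb prime_cast_pos one_lt_prime_cast.ne' hε]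
      using hwf (Real.logb p ε)
  · rintro ⟨y, rfl⟩
    refine ⟨fun n => (hB _).1 (by simpa only [termNorm_zero_left] using y.2 n), fun r => ?_⟩
    simpa only [termNorm_zero_left] using y.1.2.2 _ (Real.rpow_pos_of_pos prime_cast_pos r)

lemma coe_algebraMap_mul (a : O) (x : hB.gammaImm p) :
    (algebraMap O (hB.gammaImm p) a * x).1.1 = algebraMap O E a • x.1.1 := by
  rw [← Algebra.smul_def, algebraMap_smul]
  rfl

lemma isLeftRegular_algebraMap {a : O} (ha : algebraMap O E a ≠ 0) :
    IsLeftRegular (algebraMap O (hB.gammaImm p) a) := fun x y hxy => by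
  have hxy' : (algebraMap O (hB.gammaImm p) a * x).1.1 = (algebraMap O _ a * y).1.1 :=
    congrArg (fun u : hB.gammaImm p => u.1.1) hxy
  rw [coe_algebraMap_mul, coe_algebraMap_mul] at hxy'
  exact Subtype.ext <| Subtype.ext <| smul_right_injective _ ha hxy'

lemma mem_span_algebraMap_iff {a : O} (ha : algebraMap O E a ≠ 0) {x : hB.gammaImm p} :
    x ∈ Ideal.span {algebraMap O (hB.gammaImm p) a} ↔ NormLE p 0 x.1.1 ‖algebraMap O E a‖ := by
  rw [Ideal.mem_span_singleton]
  constructor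
  · rintro ⟨y, rfl⟩
    rw [coe_algebraMap_mul]
    exact (y.2.smul _).mono (mul_one _).le
  · intro hx
    refine ⟨⟨(algebraMap O E a)⁻¹ • x.1, (hx.smul _).mono ?_⟩, Subtype.ext <| Subtype.ext ?_⟩
    · rw [norm_inv, inv_mul_cancel₀ (norm_ne_zero_iff.2 ha)]
    · rw [coe_algebraMap_mul]
      exact (smul_inv_smul₀ ha x.1.1).symm

lemma mem_span_algebraMap_pow_iff {a : O} (ha : algebraMap O E a ≠ 0) {x : hB.gammaImm p}
    (N : ℕ) :
    x ∈ Ideal.span {algebraMap O (hB.gammaImm p) a} ^ N ↔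
      NormLE p 0 x.1.1 (‖algebraMap O E a‖ ^ N) := by
  rw [Ideal.span_singleton_pow, ← map_pow,
    mem_span_algebraMap_iff (by rw [map_pow]; exact pow_ne_zero N ha), map_pow, norm_pow]

lemma isAdicComplete_span_algebraMap {a : O} (ha : algebraMap O E a ≠ 0)
    (ha₁ : ‖algebraMap O E a‖ < 1) :
    IsAdicComplete (Ideal.span {algebraMap O (hB.gammaImm p) a}) (hB.gammaImm p) where
  haus' x hx := by
    refine Subtype.ext <| Subtype.ext <| eq_zero_of_forall_normLE (p := p) (r := 0) fun ε hε => ?_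
    obtain ⟨N, hN⟩ := exists_pow_lt_of_lt_one hε ha₁
    have hxN := hx N
    rw [SModEq.zero, smul_eq_mul, Ideal.mul_top, mem_span_algebraMap_pow_iff ha] at hxN
    exact hxN.mono hN.le
  prec' f hf := by
    simp only [SModEq.sub_mem, smul_eq_mul, Ideal.mul_top, mem_span_algebraMap_pow_iff ha] at hf ⊢
    obtain ⟨x, hx⟩ := exists_normLE_sub_of_geometric (p := p) (r := 0) (K := 1)
      (S := fun k => (f k).1.1) (norm_nonneg _) ha₁ fun k => by
        rw [← neg_sub]
        exact ((hf k.le_succ).mono (one_mul _).ge).neg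
    have hx_mem : x ∈ gaussSpace p E 0 := mem_gaussSpace_of_forall_exists_sub fun ε hε => by
      obtain ⟨N, hN⟩ := exists_pow_lt_of_lt_one hε ha₁
      exact ⟨_, (f N).1.2, (hx N).mono ((one_mul _).trans_le hN.le)⟩
    have hx₁ : NormLE p 0 x 1 := by
      simpa using NormLE.add (hx 0) ((f 0).2.mono (mul_one (1 : ℝ)).ge)
    refine ⟨⟨⟨x, hx_mem⟩, hx₁⟩, fun N => ?_⟩
    have hxN := (hx N).neg
    rw [neg_sub, one_mul] at hxN
    exact hxN

end IsUnitBall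

lemma IsReduction.mul [IsLocalRing O] [IsFractionRing O E] {hB : IsUnitBall O E}
    {x y : hB.gammaImm p} {a b : HahnSeries ℚ (IsLocalRing.ResidueField O)}
    (ha : IsReduction x.1.1 a) (hb : IsReduction y.1.1 b) :
    IsReduction (x * y).1.1 (a * b) := fun n => by
  obtain ⟨c, hc⟩ := (hB.mem_gammaImm_iff.2 ⟨x * y, rfl⟩).1 n
  choose u hu hua using ha
  choose v hv hvb using hb
  obtain ⟨F, hF, hF₀⟩ := exists_finset_coeff_mul_eq_sum a b n
  simp only [← hua, ← hvb, ← map_mul, ← map_sum] at hF hF₀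
  refine ⟨c, hc, ?_⟩
  rw [hF, ← sub_eq_zero, ← map_sub, ← hB.norm_algebraMap_lt_one_iff, map_sub, hc, map_sum]
  simp only [map_mul, hu, hv]
  refine norm_tsum_sub_sum_lt (tendsto_mul_coeff_cofinite x.1.2 y.1.2 n) one_pos F fun i hi => ?_
  rw [← hu, ← hv, ← map_mul, hB.norm_algebraMap_lt_one_iff, hF₀ i hi]

end Gamma

section Residue

variable {p : ℕ} [Fact p.Prime] {O : Type*} [CommRing O] [IsDomain O] [IsDiscreteValuationRing O]
  {E : Type*} [NormedField E] [IsUltrametricDist E] [CompleteSpace E] [Algebra O E]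
  [IsFractionRing O E] {hB : IsUnitBall O E}

namespace IsUnitBall

lemma exists_isReduction (x : hB.gammaImm p) :
    ∃ a : HahnSeries ℚ (IsLocalRing.ResidueField O), IsReduction x.1.1 a := by
  obtain ⟨ϖ, hϖ⟩ := IsDiscreteValuationRing.exists_irreducible O
  obtain ⟨hx, -⟩ := hB.mem_gammaImm_iff.2 ⟨x, rfl⟩
  choose c hc using hx
  refine ⟨⟨fun n => IsLocalRing.residue O (c n), ?_⟩, fun n => ⟨c n, hc n, rfl⟩⟩
  have hϖ₀ : 0 < ‖algebraMap O E ϖ‖ := norm_pos_iff.2 (by simpa using hϖ.ne_zero)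
  refine ((x.1.2.2 _ hϖ₀).mono fun n hn => ?_).isPWO
  by_contra hle
  rw [Set.mem_ofPred_eq, not_lt, termNorm_zero_left, ← hc n] at hle
  exact hn (hB.norm_algebraMap_lt_one_iff.1
    (hle.trans_lt (hB.norm_algebraMap_irreducible_lt_one hϖ)))

/-- The reduction of `Γ^imm` modulo the maximal ideal of `O`. -/
def reduction (hB : IsUnitBall O E) (p : ℕ) [Fact p.Prime] :
    hB.gammaImm p →+* HahnSeries ℚ (IsLocalRing.ResidueField O) where
  toFun x := (exists_isReduction x).choose
  map_zero' := (exists_isReduction _).choose_spec.unique isReduction_zero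
  map_one' := (exists_isReduction _).choose_spec.unique <| by
    have h := isReduction_single (E := E) 0 (1 : O)
    rw [map_one, map_one] at h
    exact h
  map_add' x y := (exists_isReduction _).choose_spec.unique <|
    (exists_isReduction x).choose_spec.add (exists_isReduction y).choose_spec
  map_mul' x y := (exists_isReduction _).choose_spec.unique <|
    (exists_isReduction x).choose_spec.mul (exists_isReduction y).choose_spec

lemma reduction_eq_iff {x : hB.gammaImm p} {a : HahnSeries ℚ (IsLocalRing.ResidueField O)} :
    hB.reduction p x = a ↔ IsReduction x.1.1 a :=
  ⟨by rintro rfl; exact (exists_isReduction x).choose_spec,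
    fun h => (exists_isReduction x).choose_spec.unique h⟩

variable {ϖ : O}

lemma ker_reduction (hϖ : Irreducible ϖ) :
    RingHom.ker (hB.reduction p) = Ideal.span {algebraMap O (hB.gammaImm p) ϖ} := by
  ext x
  have hx := reduction_eq_iff.1 (rfl : hB.reduction p x = _)
  rw [RingHom.mem_ker, mem_span_algebraMap_iff (by simpa using hϖ.ne_zero), HahnSeries.ext_iff,
    funext_iff]
  refine forall_congr' fun n => ?_
  rw [termNorm_zero_left]
  exact (hx.coeff_eq_zero_iff hB n).trans
    ⟨hB.norm_le_of_norm_lt_one hϖ, (hB.norm_algebraMap_irreducible_lt_one hϖ).trans_le'⟩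

lemma isPrime_span_algebraMap (hϖ : Irreducible ϖ) :
    (Ideal.span {algebraMap O (hB.gammaImm p) ϖ}).IsPrime :=
  ker_reduction (hB := hB) (p := p) hϖ ▸ RingHom.ker_isPrime _

lemma charP_quotient_span_algebraMap (hϖ : Irreducible ϖ) (hp : ϖ ∣ (p : O)) :
    CharP (hB.gammaImm p ⧸ Ideal.span {algebraMap O (hB.gammaImm p) ϖ}) p := by
  have := Ideal.Quotient.nontrivial_iff.2
    (isPrime_span_algebraMap (hB := hB) (p := p) hϖ).ne_top
  rw [CharP.charP_iff_prime_eq_zero Fact.out, ← map_natCast (Ideal.Quotient.mk _),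
    Ideal.Quotient.eq_zero_iff_mem, Ideal.mem_span_singleton, ← map_natCast (algebraMap O _)]
  exact map_dvd _ hp

end IsUnitBall

end Residue

section AlgebraicHahn

variable (κ : Type*) [Field κ]

/-- The field `K^alg`, the algebraic closure of `κ((t))` in `κ((t^ℚ))`. -/
def algebraicHahn : Subfield (HahnSeries ℚ κ) :=
  letI := (laurentToHahn κ).toAlgebra
  (algebraicClosure (LaurentSeries κ) (HahnSeries ℚ κ)).toSubfield

variable {κ} {a : HahnSeries ℚ κ}

lemma mem_algebraicHahn : a ∈ algebraicHahn κ ↔ IsAlgebraicHahn a := by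
  let := (laurentToHahn κ).toAlgebra
  exact mem_algebraicClosure_iff

lemma mem_algebraicHahn_of_pow {n : ℕ} (hn : 0 < n) (h : a ^ n ∈ algebraicHahn κ) :
    a ∈ algebraicHahn κ := by
  let := (laurentToHahn κ).toAlgebra
  rw [mem_algebraicHahn] at h ⊢
  exact IsAlgebraic.of_pow (R := LaurentSeries κ) hn h

lemma single_mem_algebraicHahn (q : ℚ) (c : κ) : HahnSeries.single q c ∈ algebraicHahn κ := by
  let := (laurentToHahn κ).toAlgebra
  refine mem_algebraicHahn_of_pow q.den_pos ?_
  have hpow : HahnSeries.single q c ^ q.den =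
      laurentToHahn κ (HahnSeries.single q.num (c ^ q.den)) := by
    rw [HahnSeries.single_pow, nsmul_eq_mul, Rat.den_mul_eq_num]
    exact (HahnSeries.embDomain_single (f := ⟨⟨Int.cast, Int.cast_injective⟩, Int.cast_le⟩)).symm
  rw [hpow, mem_algebraicHahn]
  exact isAlgebraic_algebraMap (R := LaurentSeries κ) _

end AlgebraicHahn

section Teichmuller

variable {p : ℕ} [Fact p.Prime] {O : Type*} [CommRing O] [IsDomain O] [IsDiscreteValuationRing O]
  {E : Type*} [NormedField E] [IsUltrametricDist E] [CompleteSpace E] [Algebra O E]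
  [IsFractionRing O E] {hB : IsUnitBall O E}

lemma tPow_pow {r : ℝ} (q : ℚ) (n : ℕ) :
    (⟨tPow q, tPow_mem_gaussSpace r q⟩ : gaussSpace p E r) ^ n =
      ⟨tPow (n * q), tPow_mem_gaussSpace r _⟩ := by
  induction n with
  | zero =>
    simp only [pow_zero, Nat.cast_zero, zero_mul]
    rfl
  | succ n ih =>
    rw [pow_succ', ih]
    refine Subtype.ext <| funext fun i => ?_
    rw [coe_mul_gaussSpace, tPow_seriesMul]
    simp only [tPow, Pi.single_apply, Nat.cast_succ]
    exact if_congr (by constructor <;> intro h <;> linarith) rfl rfl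

namespace IsUnitBall

/-- The multiplicative monoid of the Teichmüller lifts in `Γ^imm` of the elements of `K^alg`. -/
def teichmullerAlg (hB : IsUnitBall O E) (p : ℕ) [Fact p.Prime] : Submonoid (hB.gammaImm p) :=
  (⨅ m : ℕ, MonoidHom.mrange (powMonoidHom (p ^ m))) ⊓
    (algebraicHahn (IsLocalRing.ResidueField O)).toSubmonoid.comap (hB.reduction p)

lemma mem_teichmullerAlg {u : hB.gammaImm p} : u ∈ hB.teichmullerAlg p ↔
    (∀ m : ℕ, ∃ v, v ^ p ^ m = u) ∧
      hB.reduction p u ∈ algebraicHahn (IsLocalRing.ResidueField O) := by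
  rw [teichmullerAlg, Submonoid.mem_inf, Submonoid.mem_iInf]
  rfl

lemma mem_algTeichmuller_iff (hB : IsUnitBall O E) {x : ℚ → E} :
    x ∈ algTeichmuller p O E ↔ ∃ u ∈ hB.teichmullerAlg p, u.1.1 = x := by
  constructor
  · rintro ⟨hx, hroot, a, hxa, ha⟩
    obtain ⟨u, rfl⟩ := hB.mem_gammaImm_iff.1 hx
    refine ⟨u, mem_teichmullerAlg.2 ⟨fun m => ?_, ?_⟩, rfl⟩
    · obtain ⟨v, hv, hvu⟩ := hroot m
      obtain ⟨v, rfl⟩ := hB.mem_gammaImm_iff.1 hv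
      exact ⟨v, Subtype.ext <| Subtype.ext <| by rw [← hvu]; exact coe_pow_gaussSpace _ _⟩
    · rwa [reduction_eq_iff.2 hxa, mem_algebraicHahn]
  · rintro ⟨u, hu, rfl⟩
    obtain ⟨hroot, halg⟩ := mem_teichmullerAlg.1 hu
    refine ⟨hB.mem_gammaImm_iff.2 ⟨u, rfl⟩, fun m => ?_,
      _, reduction_eq_iff.1 rfl, mem_algebraicHahn.1 halg⟩
    obtain ⟨v, rfl⟩ := hroot m
    exact ⟨v.1.1, hB.mem_gammaImm_iff.2 ⟨v, rfl⟩, (coe_pow_gaussSpace v.1 _).symm⟩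

lemma exists_pow_eq_of_mem_teichmullerAlg {ϖ : O} (hϖ : Irreducible ϖ) (hp : ϖ ∣ p)
    {u : hB.gammaImm p} (hu : u ∈ hB.teichmullerAlg p) (m : ℕ) :
    ∃ v ∈ hB.teichmullerAlg p, v ^ p ^ m = u := by
  obtain ⟨hroot, halg⟩ := mem_teichmullerAlg.1 hu
  have := charP_quotient_span_algebraMap (hB := hB) hϖ hp
  have := isPrime_span_algebraMap (hB := hB) (p := p) hϖ
  have := isAdicComplete_span_algebraMap (hB := hB) (p := p)
    (by simpa using hϖ.ne_zero : algebraMap O E ϖ ≠ 0) (hB.norm_algebraMap_irreducible_lt_one hϖ)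
  obtain ⟨v, hv, rfl⟩ := exists_pow_eq_of_mem_mrange_teichmuller
    ((mem_mrange_teichmuller_iff (I := Ideal.span {algebraMap O (hB.gammaImm p) ϖ})).2 hroot) m
  refine ⟨v, mem_teichmullerAlg.2 ⟨mem_mrange_teichmuller_iff.1 hv, ?_⟩, rfl⟩
  rw [map_pow] at halg
  exact mem_algebraicHahn_of_pow (pow_pos (Nat.Prime.pos Fact.out) m) halg

lemma tPow_mem_teichmullerAlg (hB : IsUnitBall O E) (q : ℚ) :
    ∃ u ∈ hB.teichmullerAlg p, u.1.1 = tPow q := by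
  have htPow (q : ℚ) : NormLE p 0 (tPow q : ℚ → E) 1 := by
    simpa [tPow] using normLE_single (p := p) (r := 0) q (1 : E)
  refine ⟨⟨⟨tPow q, tPow_mem_gaussSpace 0 q⟩, htPow q⟩, mem_teichmullerAlg.2 ⟨fun m => ?_, ?_⟩, rfl⟩
  · refine ⟨⟨⟨tPow (q / p ^ m), tPow_mem_gaussSpace 0 _⟩, htPow _⟩, Subtype.ext ?_⟩
    refine (tPow_pow _ _).trans (Subtype.ext ?_)
    rw [Nat.cast_pow, mul_div_cancel₀ _ (pow_ne_zero m (Nat.cast_ne_zero.2 (NeZero.ne p)))]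
  · have h := isReduction_single (E := E) q (1 : O)
    rw [map_one] at h
    rw [reduction_eq_iff.2 h]
    exact single_mem_algebraicHahn q _

section PerfectResidueField

variable [IsAdicComplete (IsLocalRing.maximalIdeal O) O] [PerfectField (IsLocalRing.ResidueField O)]

lemma exists_algebraMap_mem_teichmullerAlg {ϖ : O} (hϖ : Irreducible ϖ) (hp : ϖ ∣ p) (a : O) :
    ∃ b : O, algebraMap O (hB.gammaImm p) b ∈ hB.teichmullerAlg p ∧ ϖ ∣ a - b := by
  have hpm : (p : O) ∈ IsLocalRing.maximalIdeal O := by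
    rwa [hϖ.maximalIdeal_eq, Ideal.mem_span_singleton]
  have : CharP (IsLocalRing.ResidueField O) p := by
    rw [CharP.charP_iff_prime_eq_zero Fact.out, ← map_natCast (IsLocalRing.residue O),
      IsLocalRing.residue_eq_zero_iff]
    exact hpm
  have : CharP (O ⧸ IsLocalRing.maximalIdeal O) p := this
  have : PerfectRing (O ⧸ IsLocalRing.maximalIdeal O) p :=
    inferInstanceAs (PerfectRing (IsLocalRing.ResidueField O) p)
  obtain ⟨b, hb, hab⟩ :=
    exists_mem_mrange_teichmuller_sub_mem (p := p) (I := IsLocalRing.maximalIdeal O) a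
  rw [hϖ.maximalIdeal_eq, Ideal.mem_span_singleton] at hab
  refine ⟨b, mem_teichmullerAlg.2 ⟨fun m => ?_, ?_⟩, hab⟩
  · obtain ⟨c, -, rfl⟩ := exists_pow_eq_of_mem_mrange_teichmuller hb m
    exact ⟨algebraMap O _ c, by rw [map_pow]⟩
  · have hred :
        hB.reduction p (algebraMap O _ b) = HahnSeries.single 0 (IsLocalRing.residue O b) := by
      rw [reduction_eq_iff]
      convert isReduction_single (E := E) 0 b using 1
      rw [← mul_one (algebraMap O (hB.gammaImm p) b), coe_algebraMap_mul]
      exact (Pi.single_smul' 0 (algebraMap O E b) (1 : E)).symm.trans (by simp)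
    rw [hred]
    exact single_mem_algebraicHahn 0 _

end PerfectResidueField

end IsUnitBall

end Teichmuller

section GammaAlg

variable {p : ℕ} [Fact p.Prime] {O : Type*} [CommRing O] [IsDomain O] [IsDiscreteValuationRing O]
  {E : Type*} [NormedField E] [IsUltrametricDist E] [CompleteSpace E] [Algebra O E]
  [IsFractionRing O E] {hB : IsUnitBall O E}

namespace IsUnitBall

/-- The inclusion of `Γ^imm` into the space of all series. -/
def gammaImmVal (hB : IsUnitBall O E) (p : ℕ) [Fact p.Prime] : hB.gammaImm p →ₗ[O] (ℚ → E) :=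
  (gaussSpace p E 0).subtype.restrictScalars O ∘ₗ (hB.gammaImm p).val.toLinearMap

/-- The ring `Γ^alg`, as an `O`-algebra. -/
def gammaAlg (hB : IsUnitBall O E) (p : ℕ) [Fact p.Prime] : Subalgebra O (hB.gammaImm p) :=
  adicClosure ((IsLocalRing.maximalIdeal O).map (algebraMap O (hB.gammaImm p)))
    (Algebra.adjoin O (hB.teichmullerAlg p : Set (hB.gammaImm p)))

lemma gammaAlg_eq_adicClosure_span {ϖ : O} (hϖ : Irreducible ϖ) :
    hB.gammaAlg p = adicClosure (Ideal.span {algebraMap O (hB.gammaImm p) ϖ})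
      (Algebra.adjoin O (hB.teichmullerAlg p : Set (hB.gammaImm p))) := by
  rw [gammaAlg, hϖ.maximalIdeal_eq, Ideal.map_span, Set.image_singleton]

lemma mem_gammaAlg {x : hB.gammaImm p} : x ∈ hB.gammaAlg p ↔
    ∀ ε > 0, ∃ z ∈ Algebra.adjoin O (hB.teichmullerAlg p : Set (hB.gammaImm p)),
      NormLE p 0 (x.1.1 - z.1.1) ε := by
  obtain ⟨ϖ, hϖ⟩ := IsDiscreteValuationRing.exists_irreducible O
  have hϖ₀ : algebraMap O E ϖ ≠ 0 := by simpa using hϖ.ne_zero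
  simp only [gammaAlg_eq_adicClosure_span hϖ, mem_adicClosure, mem_span_algebraMap_pow_iff hϖ₀]
  refine ⟨fun h ε hε => ?_, fun h N => h _ (pow_pos (norm_pos_iff.2 hϖ₀) N)⟩
  obtain ⟨N, hN⟩ := exists_pow_lt_of_lt_one hε (hB.norm_algebraMap_irreducible_lt_one hϖ)
  obtain ⟨z, hz, hxz⟩ := h N
  exact ⟨z, hz, hxz.mono hN.le⟩

lemma span_algTeichmuller_eq_map (hB : IsUnitBall O E) :
    Submodule.span O (algTeichmuller p O E) =
      (Subalgebra.toSubmodule (Algebra.adjoin O (hB.teichmullerAlg p : Set (hB.gammaImm p)))).map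
        (hB.gammaImmVal p) := by
  rw [Algebra.adjoin_eq_span, Submonoid.closure_eq, Submodule.map_span]
  congr 1
  ext x
  exact hB.mem_algTeichmuller_iff

lemma mem_gammaAlg_iff (hB : IsUnitBall O E) {x : ℚ → E} :
    x ∈ GammaAlg p O E ↔ x ∈ (Subalgebra.toSubmodule (hB.gammaAlg p)).map (hB.gammaImmVal p) := by
  constructor
  · rintro ⟨hx, happrox⟩
    obtain ⟨x, rfl⟩ := hB.mem_gammaImm_iff.1 hx
    refine ⟨x, mem_gammaAlg.2 fun ε hε => ?_, rfl⟩
    obtain ⟨m, hm⟩ := exists_pow_lt_of_lt_one hε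
      (inv_lt_one_of_one_lt₀ (one_lt_prime_cast (p := p)))
    obtain ⟨z, hz, hxz⟩ := happrox m
    rw [hB.span_algTeichmuller_eq_map] at hz
    obtain ⟨z, hz, rfl⟩ := hz
    refine ⟨z, hz, fun n => ?_⟩
    rw [termNorm_zero_left]
    exact (hxz n).trans (inv_pow (p : ℝ) m ▸ hm.le)
  · rintro ⟨x, hx, rfl⟩
    refine ⟨hB.mem_gammaImm_iff.2 ⟨x, rfl⟩, fun m => ?_⟩
    obtain ⟨z, hz, hxz⟩ := mem_gammaAlg.1 hx _ (inv_pos.2 (pow_pos (prime_cast_pos (p := p)) m))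
    refine ⟨z.1.1, ?_, fun n => termNorm_zero_left p (x.1.1 - z.1.1) n ▸ hxz n⟩
    rw [hB.span_algTeichmuller_eq_map]
    exact ⟨z, hz, rfl⟩

lemma mem_gammaAlg_of_forall_exists_sub {x : hB.gammaImm p}
    (h : ∀ ε > 0, ∃ y ∈ hB.gammaAlg p, NormLE p 0 (x.1.1 - y.1.1) ε) : x ∈ hB.gammaAlg p :=
  mem_gammaAlg.2 fun ε hε => by
    obtain ⟨y, hy, hxy⟩ := h ε hε
    obtain ⟨z, hz, hyz⟩ := mem_gammaAlg.1 hy ε hε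
    exact ⟨z, hz, sub_add_sub_cancel x.1.1 y.1.1 z.1.1 ▸ hxy.add hyz⟩

lemma exists_gammaImmVal_eq_smul (hB : IsUnitBall O E) {x : ℚ → E} (hx : x ∈ gaussSpace p E 0) :
    ∃ a : O, a ≠ 0 ∧ ∃ y, hB.gammaImmVal p y = a • x := by
  obtain ⟨ϖ, hϖ⟩ := IsDiscreteValuationRing.exists_irreducible O
  obtain ⟨c, hc⟩ := hx.1
  obtain ⟨N, hN⟩ := exists_pow_lt_of_lt_one (inv_pos.2 (lt_max_of_lt_right one_pos : 0 < max c 1))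
    (hB.norm_algebraMap_irreducible_lt_one hϖ)
  refine ⟨ϖ ^ N, pow_ne_zero N hϖ.ne_zero,
    ⟨algebraMap O E (ϖ ^ N) • ⟨x, hx⟩, fun n => (hc.smul (algebraMap O E (ϖ ^ N)) n).trans ?_⟩,
    algebraMap_smul E (ϖ ^ N) x⟩
  rw [map_pow, norm_pow]
  exact (mul_le_mul hN.le (le_max_left c 1) hc.nonneg
    (inv_nonneg.2 (lt_max_of_lt_right one_pos).le)).trans_eq
      (inv_mul_cancel₀ (lt_max_of_lt_right one_pos).ne')

variable [IsAdicComplete (IsLocalRing.maximalIdeal O) O] [PerfectField (IsLocalRing.ResidueField O)]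

lemma mem_gammaAlg_of_irreducible_smul_mem (hp : (p : O) ∈ IsLocalRing.maximalIdeal O)
    {ϖ : O} (hϖ : Irreducible ϖ) {x : hB.gammaImm p} (hx : ϖ • x ∈ hB.gammaAlg p) :
    x ∈ hB.gammaAlg p := by
  rw [hϖ.maximalIdeal_eq, Ideal.mem_span_singleton] at hp
  rw [gammaAlg_eq_adicClosure_span hϖ] at hx ⊢
  have hreg : IsLeftRegular (algebraMap O (hB.gammaImm p) ϖ) :=
    isLeftRegular_algebraMap (by simpa using hϖ.ne_zero)
  have hϖ' := isPrime_span_algebraMap (hB := hB) (p := p) hϖ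
  refine mem_adicClosure_of_smul_mem hreg (fun z hz hzϖ N => ?_) hx
  refine exists_sub_smul_mem_pow hϖ' hp (fun a => ?_) (fun t ht N => ?_) hz hzϖ N
  · exact exists_algebraMap_mem_teichmullerAlg hϖ hp a
  · exact exists_pow_eq_of_mem_teichmullerAlg hϖ hp ht N

lemma mem_gammaAlg_of_smul_mem (hp : (p : O) ∈ IsLocalRing.maximalIdeal O) {a : O} (ha : a ≠ 0)
    {x : hB.gammaImm p} (hx : a • x ∈ hB.gammaAlg p) : x ∈ hB.gammaAlg p := by
  obtain ⟨ϖ, hϖ⟩ := IsDiscreteValuationRing.exists_irreducible O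
  obtain ⟨n, u, rfl⟩ := IsDiscreteValuationRing.eq_unit_mul_pow_irreducible ha hϖ
  induction n with
  | zero =>
    rw [pow_zero, mul_one] at hx
    simpa only [smul_smul, Units.inv_mul, one_smul] using
      Subalgebra.smul_mem _ hx (↑u⁻¹ : O)
  | succ n ih =>
    refine ih (mul_ne_zero u.ne_zero (pow_ne_zero n hϖ.ne_zero))
      (mem_gammaAlg_of_irreducible_smul_mem hp hϖ ?_)
    rwa [smul_smul, mul_left_comm, ← pow_succ']

end IsUnitBall

end GammaAlg

section GammaAlgLoc

variable {p : ℕ} {O : Type*} [CommRing O] [IsLocalRing O] {E : Type*} [NormedField E] [Algebra O E]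

variable (p O E) in
/-- The space `Γ^alg[1/p]`. -/
def gammaAlgLoc : Submodule E (ℚ → E) := Submodule.span E (GammaAlg p O E)

end GammaAlgLoc

section GammaAlgLoc

variable {p : ℕ} [Fact p.Prime] {O : Type*} [CommRing O] [IsDomain O] [IsDiscreteValuationRing O]
  {E : Type*} [NormedField E] [IsUltrametricDist E] [CompleteSpace E] [Algebra O E]
  {x y : ℚ → E}

lemma gammaAlgLoc_le_gaussSpace (hB : IsUnitBall O E) : gammaAlgLoc p O E ≤ gaussSpace p E 0 :=
  Submodule.span_le.2 fun _ hx => by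
    obtain ⟨y, rfl⟩ := hB.mem_gammaImm_iff.1 hx.1
    exact y.1.2

variable [IsFractionRing O E]

lemma mem_gammaAlgLoc_iff (hB : IsUnitBall O E) : x ∈ gammaAlgLoc p O E ↔
    ∃ a : O, a ≠ 0 ∧ ∃ y ∈ hB.gammaAlg p, hB.gammaImmVal p y = a • x := by
  have hΓ : GammaAlg p O E =
      ((Subalgebra.toSubmodule (hB.gammaAlg p)).map (hB.gammaImmVal p) : Set (ℚ → E)) :=
    Set.ext fun _ => hB.mem_gammaAlg_iff
  rw [gammaAlgLoc, IsLocalization.mem_span_iff (nonZeroDivisors O), hΓ, Submodule.span_eq]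
  constructor
  · rintro ⟨-, ⟨y, hy, rfl⟩, z, rfl⟩
    refine ⟨z, nonZeroDivisors.ne_zero z.2, y, hy, ?_⟩
    rw [← algebraMap_smul E (z : O), smul_smul, IsLocalization.mk'_spec', map_one, one_smul]
  · rintro ⟨a, ha, y, hy, hyx⟩
    refine ⟨_, ⟨y, hy, hyx⟩, ⟨a, mem_nonZeroDivisors_of_ne_zero ha⟩, ?_⟩
    rw [← algebraMap_smul E a x, smul_smul, IsLocalization.mk'_spec, map_one, one_smul]

lemma seriesMul_mem_gammaAlgLoc (hB : IsUnitBall O E) (hx : x ∈ gammaAlgLoc p O E)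
    (hy : y ∈ gammaAlgLoc p O E) : seriesMul x y ∈ gammaAlgLoc p O E := by
  rw [mem_gammaAlgLoc_iff hB] at hx hy ⊢
  obtain ⟨a, ha, u, hu, hux⟩ := hx
  obtain ⟨b, hb, v, hv, hvy⟩ := hy
  refine ⟨a * b, mul_ne_zero ha hb, u * v, mul_mem hu hv, ?_⟩
  calc hB.gammaImmVal p (u * v) = seriesMul (hB.gammaImmVal p u) (hB.gammaImmVal p v) := rfl
    _ = (a * b) • seriesMul x y := by
      rw [hux, hvy, ← algebraMap_smul E a x, ← algebraMap_smul E b y, smul_seriesMul,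
        seriesMul_smul, algebraMap_smul, algebraMap_smul, smul_smul]

lemma tPow_mem_gammaAlgLoc (hB : IsUnitBall O E) (q : ℚ) : tPow q ∈ gammaAlgLoc p O E := by
  obtain ⟨u, hu, huq⟩ := hB.tPow_mem_teichmullerAlg (p := p) q
  rw [← huq]
  exact Submodule.subset_span <| hB.mem_gammaAlg_iff.2
    ⟨u, le_adicClosure (Algebra.subset_adjoin hu), rfl⟩

variable [IsAdicComplete (IsLocalRing.maximalIdeal O) O] [PerfectField (IsLocalRing.ResidueField O)]

lemma gammaImmVal_mem_gammaAlgLoc_iff {hB : IsUnitBall O E}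
    (hp : (p : O) ∈ IsLocalRing.maximalIdeal O) {u : hB.gammaImm p} :
    hB.gammaImmVal p u ∈ gammaAlgLoc p O E ↔ u ∈ hB.gammaAlg p := by
  refine ⟨fun hu => ?_, fun hu => Submodule.subset_span (hB.mem_gammaAlg_iff.2 ⟨u, hu, rfl⟩)⟩
  obtain ⟨a, ha, v, hv, hvu⟩ := (mem_gammaAlgLoc_iff hB).1 hu
  rw [← map_smul] at hvu
  have hinj : Function.Injective (hB.gammaImmVal p) :=
    Subtype.val_injective.comp Subtype.val_injective
  exact IsUnitBall.mem_gammaAlg_of_smul_mem hp ha (hinj hvu ▸ hv)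

lemma isClosedAt_gammaAlgLoc (hB : IsUnitBall O E) (hp : (p : O) ∈ IsLocalRing.maximalIdeal O) :
    IsClosedAt p 0 (gammaAlgLoc p O E) := by
  intro x hx
  obtain ⟨a, ha, u, hu⟩ := hB.exists_gammaImmVal_eq_smul <| isClosedAt_gaussSpace 0 x fun ε hε =>
    (hx ε hε).imp fun y hy => ⟨gammaAlgLoc_le_gaussSpace hB hy.1, hy.2⟩
  refine (mem_gammaAlgLoc_iff hB).2 ⟨a, ha, u, ?_, hu⟩
  refine IsUnitBall.mem_gammaAlg_of_forall_exists_sub fun ε hε => ?_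
  obtain ⟨y, hy, hxy⟩ := hx (min ε 1) (lt_min hε one_pos)
  have huy : NormLE p 0 (u.1.1 - algebraMap O E a • y) (min ε 1) := by
    have h := (hxy.smul (algebraMap O E a)).mono
      (mul_le_of_le_one_left hxy.nonneg (hB.norm_algebraMap_le_one a))
    rw [smul_sub, algebraMap_smul, ← hu] at h
    exact h
  have hy₁ : NormLE p 0 (algebraMap O E a • y) 1 :=
    sub_sub_cancel u.1.1 (algebraMap O E a • y) ▸ u.2.sub (huy.mono (min_le_right ε 1))
  have hay := Submodule.smul_mem _ (algebraMap O E a) hy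
  refine ⟨⟨⟨_, gammaAlgLoc_le_gaussSpace hB hay⟩, hy₁⟩,
    (gammaImmVal_mem_gammaAlgLoc_iff hp).1 hay, huy.mono (min_le_left ε 1)⟩

end GammaAlgLoc

/-! ### The ring `Ω^alg_an` -/

lemma bddBelow_of_isWF {α : Type*} [LinearOrder α] [Nonempty α] {X : Set α}
    (hX : X.IsWF) : BddBelow X := by
  rcases X.eq_empty_or_nonempty with rfl | h
  · exact bddBelow_empty
  · exact ⟨hX.min h, fun _ hn => hX.min_le h hn⟩

section SeriesMulOn

variable {E : Type*} [NormedField E]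

/-- The sum of the products of the terms of exponents `i` and `k` of `x` and `y`, over the pairs
`(i, k)` in `A`. Removing pairs from the product turns a product of truncations into an
approximation of the truncation of the product. -/
def seriesMulOn (A : Set (ℚ × ℚ)) (x y : ℚ → E) : ℚ → E := fun n =>
  ∑' i, A.indicator (fun z => x z.1 * y z.2) (i, n - i)

lemma seriesMulOn_univ (x y : ℚ → E) : seriesMulOn Set.univ x y = seriesMul x y := by
  funext n
  simp only [seriesMulOn, seriesMul, Set.indicator_univ]

lemma indicator_Iio_seriesMul (j : ℚ) (x y : ℚ → E) :
    (Set.Iio j).indicator (seriesMul x y) = seriesMulOn {z | z.1 + z.2 < j} x y := by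
  funext n
  by_cases hn : n < j <;> simp [seriesMulOn, seriesMul, Set.indicator, hn]

variable {p : ℕ} [Fact p.Prime] {r ε : ℝ} {x y x' y' : ℚ → E}

lemma termNorm_indicator_Iio_le (hr : 0 ≤ r) (j : ℚ) (x : ℚ → E) (n : ℚ) :
    termNorm p 0 ((Set.Iio j).indicator x) n ≤ (weight p r j)⁻¹ * termNorm p r x n := by
  have hw : 0 < weight p r j := weight_pos r j
  by_cases hn : n < j
  · rw [termNorm_zero_left, Set.indicator_of_mem (Set.mem_Iio.2 hn), le_inv_mul_iff₀ hw, mul_comm]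
    exact mul_le_mul_of_nonneg_left (weight_le_weight
      (mul_le_mul_of_nonneg_left (Rat.cast_le.2 hn.le) hr)) (norm_nonneg _)
  · rw [termNorm_of_eq_zero p 0 (Set.indicator_of_notMem (Set.notMem_Iio.2 (not_lt.1 hn)) x)]
    exact mul_nonneg (inv_nonneg.2 hw.le) (termNorm_nonneg r x n)

lemma NormLE.indicator_Iio (hr : 0 ≤ r) {c : ℝ} (h : NormLE p r x c) (j : ℚ) :
    NormLE p 0 ((Set.Iio j).indicator x) ((weight p r j)⁻¹ * c) := fun n =>
  (termNorm_indicator_Iio_le hr j x n).trans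
    (mul_le_mul_of_nonneg_left (h n) (inv_nonneg.2 (weight_pos r j).le))

variable [IsUltrametricDist E]

section

variable [CompleteSpace E]

lemma summable_seriesMulOn (hx : x ∈ gaussSpace p E r) (hy : y ∈ gaussSpace p E r)
    (A : Set (ℚ × ℚ)) (n : ℚ) :
    Summable fun i => A.indicator (fun z => x z.1 * y z.2) (i, n - i) :=
  NonarchimedeanAddGroup.summable_of_tendsto_cofinite_zero <|
    squeeze_zero_norm (fun _ => norm_indicator_le_norm_self _ _)
      (tendsto_zero_iff_norm_tendsto_zero.1 (tendsto_mul_coeff_cofinite hx hy n))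

lemma seriesMulOn_diff_Ici (hx : x ∈ gaussSpace p E r) (hy : y ∈ gaussSpace p E r)
    (A : Set (ℚ × ℚ)) (f : ℚ × ℚ) : seriesMulOn (A \ Set.Ici f) x y =
      seriesMulOn A x y -
        seriesMulOn A ((Set.Ici f.1).indicator x) ((Set.Ici f.2).indicator y) := by
  funext n
  rw [Pi.sub_apply, seriesMulOn, seriesMulOn, seriesMulOn,
    ← (summable_seriesMulOn hx hy A n).tsum_sub (summable_seriesMulOn
      (indicator_mem_gaussSpace hx _) (indicator_mem_gaussSpace hy _) A n)]
  refine tsum_congr fun i => ?_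
  by_cases hA : (i, n - i) ∈ A <;> by_cases h₁ : f.1 ≤ i <;> by_cases h₂ : f.2 ≤ n - i <;>
    simp [Set.indicator, Prod.le_def, hA, h₁, h₂]

lemma normLE_seriesMulOn_sub (hx : x ∈ gaussSpace p E r) (hy : y ∈ gaussSpace p E r) {s : ℝ}
    (hx' : x' ∈ gaussSpace p E s) (hy' : y' ∈ gaussSpace p E s) {A B : Set (ℚ × ℚ)} (hε : 0 ≤ ε)
    (h : ∀ i k, ‖A.indicator (fun z => x z.1 * y z.2) (i, k) -
      B.indicator (fun z => x' z.1 * y' z.2) (i, k)‖ ≤ ε) :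
    NormLE p 0 (seriesMulOn A x y - seriesMulOn B x' y') ε := fun n => by
  rw [termNorm_zero_left, Pi.sub_apply, seriesMulOn, seriesMulOn,
    ← (summable_seriesMulOn hx hy A n).tsum_sub (summable_seriesMulOn hx' hy' B n)]
  exact IsUltrametricDist.norm_tsum_le_of_forall_le_of_nonneg hε fun i => h i (n - i)

end

lemma exists_finset_of_lt_norm_mul (hx : x ∈ gaussSpace p E 0) (hy : y ∈ gaussSpace p E 0) (j : ℚ)
    (hε : 0 < ε) : ∃ F : Finset (ℚ × ℚ), (∀ f ∈ F, j ≤ f.1 + f.2) ∧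
      ∀ i k, j ≤ i + k → ε < ‖x i * y k‖ → ∃ f ∈ F, f ≤ (i, k) := by
  obtain ⟨X, Y, hX, hY, hXY⟩ := exists_isWF_of_lt_termNorm_mul hx hy hε
  have hZ : ({z ∈ X ×ˢ Y | j ≤ z.1 + z.2} : Set (ℚ × ℚ)).IsPWO :=
    (hX.isPWO.prod hY.isPWO).mono (Set.sep_subset _ _)
  have hfin : {z | Minimal (· ∈ {z ∈ X ×ˢ Y | j ≤ z.1 + z.2}) z}.Finite :=
    (setOfPred_minimal_antichain _).finite_of_partiallyWellOrderedOn (hZ.mono fun z hz => hz.1)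
  refine ⟨hfin.toFinset, fun f hf => (hfin.mem_toFinset.1 hf).1.2, fun i k hik hlt => ?_⟩
  rw [norm_mul, ← termNorm_zero_left p x, ← termNorm_zero_left p y] at hlt
  obtain ⟨f, hf, hfm⟩ := hZ.exists_le_minimal (a := (i, k)) ⟨hXY i k hlt, hik⟩
  exact ⟨f, hfin.mem_toFinset.2 hfm, hf⟩

lemma indicator_Iio_mem_gaussSpace_zero (hr : 0 ≤ r) (hx : x ∈ gaussSpace p E r) (j : ℚ) :
    (Set.Iio j).indicator x ∈ gaussSpace p E 0 :=
  mem_gaussSpace_of_termNorm_le (inv_pos.2 (weight_pos r j)) hx (termNorm_indicator_Iio_le hr j x)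

lemma exists_norm_mul_sub_indicator_mul_le (hr : 0 ≤ r) (hx : x ∈ gaussSpace p E r)
    (hy : y ∈ gaussSpace p E r) (j : ℚ) (hε : 0 < ε) : ∃ a b : ℚ, ∀ i k, i + k < j →
      ‖x i * y k - (Set.Iio a).indicator x i * (Set.Iio b).indicator y k‖ ≤ ε := by
  have hw : 0 < weight p r j := weight_pos r j
  obtain ⟨X, Y, hX, hY, hXY⟩ := exists_isWF_of_lt_termNorm_mul hx hy (mul_pos hε hw)
  obtain ⟨x₀, hx₀⟩ := bddBelow_of_isWF hX
  obtain ⟨y₀, hy₀⟩ := bddBelow_of_isWF hY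
  refine ⟨j - y₀, j - x₀, fun i k hik => ?_⟩
  by_cases hab : i < j - y₀ ∧ k < j - x₀
  · rw [Set.indicator_of_mem (Set.mem_Iio.2 hab.1), Set.indicator_of_mem (Set.mem_Iio.2 hab.2),
      sub_self, norm_zero]
    exact hε.le
  have hzero : (Set.Iio (j - y₀)).indicator x i * (Set.Iio (j - x₀)).indicator y k = 0 := by
    rw [mul_eq_zero, Set.indicator_apply_eq_zero, Set.indicator_apply_eq_zero]
    exact (not_and_or.1 hab).imp (fun h h' => (h h').elim) fun h h' => (h h').elim
  have hsmall : termNorm p r x i * termNorm p r y k ≤ ε * weight p r j :=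
    le_of_not_gt fun hlt => hab
      ⟨by linarith [hy₀ (hXY i k hlt).2], by linarith [hx₀ (hXY i k hlt).1]⟩
  have hprod := norm_mul_mul_weight (p := p) r x y i (i + k)
  rw [add_sub_cancel_left] at hprod
  rw [hzero, sub_zero]
  refine le_of_mul_le_mul_right (le_trans ?_ (hprod.trans_le hsmall)) hw
  exact mul_le_mul_of_nonneg_left (weight_le_weight
    (mul_le_mul_of_nonneg_left (Rat.cast_le.2 hik.le) hr)) (norm_nonneg _)

variable [CompleteSpace E]

lemma exists_normLE_indicator_seriesMul_sub (hr : 0 ≤ r) (hx : x ∈ gaussSpace p E r)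
    (hy : y ∈ gaussSpace p E r) (j : ℚ) (hε : 0 < ε) :
    ∃ (a b : ℚ) (F : Finset (ℚ × ℚ)), NormLE p 0 ((Set.Iio j).indicator (seriesMul x y) -
      seriesMulOn {z | ∀ f ∈ F, ¬ f ≤ z}
        ((Set.Iio a).indicator x) ((Set.Iio b).indicator y)) ε := by
  obtain ⟨a, b, hab⟩ := exists_norm_mul_sub_indicator_mul_le hr hx hy j hε
  have hxa := indicator_Iio_mem_gaussSpace_zero hr hx a
  have hyb := indicator_Iio_mem_gaussSpace_zero hr hy b
  obtain ⟨F, hF, hFle⟩ := exists_finset_of_lt_norm_mul hxa hyb j hε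
  refine ⟨a, b, F, ?_⟩
  rw [indicator_Iio_seriesMul]
  refine normLE_seriesMulOn_sub hx hy hxa hyb hε.le fun i k => ?_
  rcases lt_or_ge (i + k) j with hik | hik
  · have hmem : ∀ f ∈ F, ¬ f ≤ (i, k) := fun f hf hle =>
      ((hF f hf).trans (add_le_add hle.1 hle.2)).not_gt hik
    rw [Set.indicator_of_mem (s := {z : ℚ × ℚ | z.1 + z.2 < j}) hik,
      Set.indicator_of_mem (s := {z | ∀ f ∈ F, ¬ f ≤ z}) hmem]
    exact hab i k hik
  · rw [Set.indicator_of_notMem (s := {z : ℚ × ℚ | z.1 + z.2 < j}) hik.not_gt, zero_sub, norm_neg,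
      Set.indicator_apply]
    split_ifs with hmem
    · exact le_of_not_gt fun hlt => (hFle i k hik hlt).elim fun f hf => hmem f hf.1 hf.2
    · exact norm_zero.trans_le hε.le

end SeriesMulOn

section TruncationsIn

variable {p : ℕ} {E : Type*} [NormedField E] {D : Submodule E (ℚ → E)} {x y : ℚ → E}

/-- The space of the series whose truncations `∑_{i < j} x_i t ^ i` all lie in `D`. -/
def truncationsIn (D : Submodule E (ℚ → E)) : Submodule E (ℚ → E) where
  carrier := {x | ∀ j : ℚ, (Set.Iio j).indicator x ∈ D}
  zero_mem' j := by
    rw [Set.indicator_zero']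
    exact D.zero_mem
  add_mem' hx hy j := by
    rw [Set.indicator_add']
    exact D.add_mem (hx j) (hy j)
  smul_mem' a x hx j := by
    rw [show (Set.Iio j).indicator (a • x) = a • (Set.Iio j).indicator x from
      Set.indicator_const_smul _ a x]
    exact D.smul_mem a (hx j)

lemma mem_truncationsIn : x ∈ truncationsIn D ↔ ∀ j : ℚ, (Set.Iio j).indicator x ∈ D := Iff.rfl

lemma indicator_mem_truncationsIn (hx : x ∈ truncationsIn D) (j : ℚ) :
    (Set.Iio j).indicator x ∈ truncationsIn D := fun i => by
  rw [Set.indicator_indicator, Set.Iio_inter_Iio]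
  exact hx _

lemma indicator_Ici_mem_inf_truncationsIn (hx : x ∈ D ⊓ truncationsIn D) (j : ℚ) :
    (Set.Ici j).indicator x ∈ D ⊓ truncationsIn D := by
  rw [← Set.compl_Iio, Set.indicator_compl]
  exact sub_mem hx ⟨hx.2 j, indicator_mem_truncationsIn hx.2 j⟩

lemma tPow_mem_truncationsIn {q : ℚ} (hq : tPow q ∈ D) : tPow q ∈ truncationsIn D := fun j => by
  classical
  have hsupp : Function.support (tPow q : ℚ → E) = {q} := Pi.support_single_of_ne one_ne_zero
  by_cases h : q < j
  · rwa [Set.indicator_eq_self.2 (hsupp.trans_subset (Set.singleton_subset_iff.2 h))]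
  · rw [Set.indicator_eq_zero'.2 (hsupp ▸ Set.disjoint_singleton_left.2 h)]
    exact D.zero_mem

variable [Fact p.Prime] [IsUltrametricDist E] [CompleteSpace E]

lemma seriesMulOn_mem_of_mem_truncationsIn (hD : D ≤ gaussSpace p E 0)
    (hmul : ∀ x ∈ D, ∀ y ∈ D, seriesMul x y ∈ D) (F : Finset (ℚ × ℚ))
    (hx : x ∈ D ⊓ truncationsIn D) (hy : y ∈ D ⊓ truncationsIn D) :
    seriesMulOn {z | ∀ f ∈ F, ¬ f ≤ z} x y ∈ D := by
  classical
  induction F using Finset.induction_on generalizing x y with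
  | empty =>
    have huniv : {z : ℚ × ℚ | ∀ f ∈ (∅ : Finset (ℚ × ℚ)), ¬ f ≤ z} = Set.univ := by simp
    rw [huniv, seriesMulOn_univ]
    exact hmul x hx.1 y hy.1
  | insert f F _ ih =>
    have hinsert : {z | ∀ g ∈ insert f F, ¬ g ≤ z} = {z | ∀ g ∈ F, ¬ g ≤ z} \ Set.Ici f :=
      Set.ext fun z => (Finset.forall_mem_insert f F _).trans and_comm
    rw [hinsert, seriesMulOn_diff_Ici (hD hx.1) (hD hy.1)]
    exact sub_mem (ih hx hy) (ih (indicator_Ici_mem_inf_truncationsIn hx f.1)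
      (indicator_Ici_mem_inf_truncationsIn hy f.2))

lemma isStable_truncationsIn (hD : D ≤ gaussSpace p E 0)
    (hmul : ∀ x ∈ D, ∀ y ∈ D, seriesMul x y ∈ D) (htPow : ∀ q : ℚ, tPow q ∈ D)
    (hclosed : IsClosedAt p 0 D) : IsStable p (truncationsIn D) where
  one_mem := tPow_mem_truncationsIn (htPow 0)
  tPow_mem _ _ j _ := ⟨tPow_mem_truncationsIn (htPow j), tPow_mem_truncationsIn (htPow (-j))⟩
  indicator_mem _ hx j := indicator_mem_truncationsIn hx j
  mul_mem r hr x hx y hy j := hclosed _ fun ε hε => by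
    obtain ⟨a, b, F, hF⟩ := exists_normLE_indicator_seriesMul_sub hr.le hx.2 hy.2 j hε
    exact ⟨_, seriesMulOn_mem_of_mem_truncationsIn hD hmul F
      ⟨hx.1 a, indicator_mem_truncationsIn hx.1 a⟩
      ⟨hy.1 b, indicator_mem_truncationsIn hy.1 b⟩, hF⟩
  isClosedAt r hr x hx := by
    refine ⟨fun j => hclosed _ fun ε hε => ?_, isClosedAt_gaussSpace r x fun ε hε =>
      (hx ε hε).imp fun y hy => ⟨hy.1.2, hy.2⟩⟩
    obtain ⟨y, hy, hxy⟩ := hx (weight p r j * ε) (mul_pos (weight_pos r j) hε)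
    refine ⟨_, hy.1 j, ?_⟩
    have h := hxy.indicator_Iio hr.le j
    rwa [Set.indicator_sub', inv_mul_cancel_left₀ (weight_pos r j).ne'] at h

end TruncationsIn

section OmegaAlgAn

variable {p : ℕ} [Fact p.Prime] {O : Type*} [CommRing O] [IsDomain O] [IsDiscreteValuationRing O]
  {E : Type*} [NormedField E] [IsUltrametricDist E] [CompleteSpace E] [Algebra O E]
  [IsFractionRing O E]

lemma exists_pow_smul_mem_gammaAlg_iff (hB : IsUnitBall O E) (hp₀ : (p : O) ≠ 0)
    (hp : (p : O) ∈ IsLocalRing.maximalIdeal O) {x : ℚ → E} :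
    (∃ m : ℕ, (p : E) ^ m • x ∈ GammaAlg p O E) ↔ x ∈ gammaAlgLoc p O E := by
  constructor
  · rintro ⟨m, hm⟩
    have hpE : (p : E) ^ m ≠ 0 :=
      pow_ne_zero m (by simpa using (IsFractionRing.injective O E).ne hp₀)
    simpa only [inv_smul_smul₀ hpE] using
      (gammaAlgLoc p O E).smul_mem ((p : E) ^ m)⁻¹ (Submodule.subset_span hm)
  · intro hx
    obtain ⟨a, ha, y, hy, hyx⟩ := (mem_gammaAlgLoc_iff hB).1 hx
    obtain ⟨ϖ, hϖ⟩ := IsDiscreteValuationRing.exists_irreducible O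
    obtain ⟨m, u, rfl⟩ := IsDiscreteValuationRing.eq_unit_mul_pow_irreducible ha hϖ
    rw [hϖ.maximalIdeal_eq, Ideal.mem_span_singleton] at hp
    obtain ⟨b, hb⟩ : (u * ϖ ^ m : O) ∣ (p : O) ^ m :=
      (Units.mul_left_dvd).2 (pow_dvd_pow_of_dvd hp m)
    refine ⟨m, hB.mem_gammaAlg_iff.2 ⟨b • y, Subalgebra.smul_mem _ hy b, ?_⟩⟩
    rw [map_smul, hyx, smul_smul, mul_comm, ← hb, ← algebraMap_smul E, map_pow, map_natCast]

lemma omegaAlgAn_eq_omega (hB : IsUnitBall O E) (hp₀ : (p : O) ≠ 0)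
    (hp : (p : O) ∈ IsLocalRing.maximalIdeal O) :
    OmegaAlgAn p O E = omega p (truncationsIn (gammaAlgLoc p O E)) := by
  have htrunc (x : ℚ → E) (j : ℚ) (m : ℕ) :
      (fun i : ℚ => if i < j then (p : E) ^ m * x i else 0) =
        (p : E) ^ m • (Set.Iio j).indicator x := by
    funext n
    by_cases hn : n < j <;> simp [hn]
  ext x
  rw [SetLike.mem_coe, mem_omega, mem_truncationsIn, OmegaAlgAn, omegaImmAn_eq_omega,
    Set.mem_ofPred_eq]
  simp only [htrunc, exists_pow_smul_mem_gammaAlg_iff hB hp₀ hp, SetLike.mem_coe, mem_omega,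
    Submodule.mem_top, true_and, and_comm]

variable [IsAdicComplete (IsLocalRing.maximalIdeal O) O] [PerfectField (IsLocalRing.ResidueField O)]

lemma isStable_truncationsIn_gammaAlgLoc (hB : IsUnitBall O E)
    (hp : (p : O) ∈ IsLocalRing.maximalIdeal O) :
    IsStable p (truncationsIn (gammaAlgLoc p O E)) :=
  isStable_truncationsIn (gammaAlgLoc_le_gaussSpace hB)
    (fun _ hx _ hy => seriesMul_mem_gammaAlgLoc hB hx hy) (tPow_mem_gammaAlgLoc hB)
    (isClosedAt_gammaAlgLoc hB hp)

end OmegaAlgAn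

/-! ### The coefficient ring `𝒪` -/

section AdicallyComplete

lemma isPrecomplete_of_finite {A : Type*} [CommRing A] (I : Ideal A) [IsPrecomplete I A]
    (M : Type*) [AddCommGroup M] [Module A M] [Module.Finite A M] : IsPrecomplete I M := by
  refine AdicCompletion.of_surjective_iff.1 fun y => ?_
  obtain ⟨z, rfl⟩ := AdicCompletion.ofTensorProduct_surjective_of_finite I M y
  induction z using TensorProduct.induction_on with
  | zero => exact ⟨0, by rw [map_zero, map_zero]⟩
  | tmul r m =>
    obtain ⟨a, rfl⟩ := AdicCompletion.of_surjective I A r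
    refine ⟨a • m, ?_⟩
    rw [AdicCompletion.ofTensorProduct_tmul, map_smul]
    exact (algebraMap_smul (AdicCompletion I A) a (AdicCompletion.of I M m)).symm
  | add z w hz hw =>
    obtain ⟨a, ha⟩ := hz
    obtain ⟨b, hb⟩ := hw
    exact ⟨a + b, by rw [map_add, map_add, ha, hb]⟩

lemma isPrecomplete_of_pow_le {R : Type*} [CommRing R] {I J : Ideal R} [IsPrecomplete I R]
    (hIJ : I ≤ J) {e : ℕ} (he : e ≠ 0) (hJI : J ^ e ≤ I) : IsPrecomplete J R := by
  refine ⟨fun f hf => ?_⟩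
  simp only [smul_eq_mul, Ideal.mul_top] at hf ⊢
  obtain ⟨L, hL⟩ := IsPrecomplete.prec' (I := I) (fun n => f (e * n)) fun {m n} hmn => by
    rw [smul_eq_mul, Ideal.mul_top]
    refine (hf (Nat.mul_le_mul_left e hmn)).mono ?_
    rw [pow_mul]
    exact Ideal.pow_right_mono hJI m
  refine ⟨L, fun n => (hf (Nat.le_mul_of_pos_left n (Nat.pos_of_ne_zero he))).trans ?_⟩
  have := hL n
  rw [smul_eq_mul, Ideal.mul_top] at this
  exact this.mono (Ideal.pow_right_mono hIJ n)

variable {R : Type*} [CommRing R] [IsDomain R] [IsDiscreteValuationRing R]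

lemma exists_maximalIdeal_pow_le_span_singleton {a : R} (ha : a ≠ 0) :
    ∃ e : ℕ, IsLocalRing.maximalIdeal R ^ e ≤ Ideal.span {a} := by
  obtain ⟨ϖ, hϖ⟩ := IsDiscreteValuationRing.exists_irreducible R
  obtain ⟨e, u, rfl⟩ := IsDiscreteValuationRing.eq_unit_mul_pow_irreducible ha hϖ
  refine ⟨e, ?_⟩
  rw [hϖ.maximalIdeal_eq, Ideal.span_singleton_pow, Ideal.span_singleton_mul_left_unit u.isUnit]

lemma isAdicComplete_maximalIdeal_of_isPrecomplete_span {a : R} (ha₀ : a ≠ 0)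
    (ha : a ∈ IsLocalRing.maximalIdeal R) [IsPrecomplete (Ideal.span {a}) R] :
    IsAdicComplete (IsLocalRing.maximalIdeal R) R := by
  obtain ⟨e, he⟩ := exists_maximalIdeal_pow_le_span_singleton ha₀
  have : IsPrecomplete (IsLocalRing.maximalIdeal R) R :=
    isPrecomplete_of_pow_le ((Ideal.span_singleton_le_iff_mem _).2 ha) e.succ_ne_zero
      ((Ideal.pow_le_pow_right e.le_succ).trans he)
  exact {}

end AdicallyComplete

section UnitBall

variable {O : Type*} [CommRing O] [IsDomain O] [IsDiscreteValuationRing O]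
  {E : Type*} [NormedField E] [Algebra O E] [IsFractionRing O E] {ϖ : O}

lemma IsUnitBall.norm_algebraMap_le_pow_iff (hB : IsUnitBall O E) (hϖ : Irreducible ϖ) {n : ℕ}
    {a : O} : ‖algebraMap O E a‖ ≤ ‖algebraMap O E ϖ‖ ^ n ↔ a ∈ IsLocalRing.maximalIdeal O ^ n := by
  have hϖ₀ : algebraMap O E ϖ ≠ 0 := by simpa using hϖ.ne_zero
  rw [hϖ.maximalIdeal_eq, Ideal.span_singleton_pow, Ideal.mem_span_singleton]
  refine ⟨fun ha => ?_, ?_⟩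
  · obtain ⟨b, hb⟩ := (hB (algebraMap O E a / algebraMap O E ϖ ^ n)).1 <| by
      rw [norm_div, norm_pow]
      exact div_le_one_of_le₀ ha (pow_nonneg (norm_nonneg _) n)
    refine ⟨b, IsFractionRing.injective O E ?_⟩
    rw [map_mul, map_pow, hb, mul_div_cancel₀ _ (pow_ne_zero n hϖ₀)]
  · rintro ⟨b, rfl⟩
    rw [map_mul, map_pow, norm_mul, norm_pow]
    exact mul_le_of_le_one_right (pow_nonneg (norm_nonneg _) n) (hB.norm_algebraMap_le_one b)

lemma IsUnitBall.completeSpace [IsPrecomplete (IsLocalRing.maximalIdeal O) O]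
    (hB : IsUnitBall O E) : CompleteSpace E := by
  obtain ⟨ϖ, hϖ⟩ := IsDiscreteValuationRing.exists_irreducible O
  have hϖ₀ : 0 < ‖algebraMap O E ϖ‖ := norm_pos_iff.2 (by simpa using hϖ.ne_zero)
  refine Metric.complete_of_convergent_controlled_sequences (fun n => ‖algebraMap O E ϖ‖ ^ n)
    (pow_pos hϖ₀) fun u hu => ?_
  have hu₀ : ∀ n, ∃ a : O, algebraMap O E a = u n - u 0 := fun n => (hB _).1 <| by
    simpa only [dist_eq_norm, pow_zero] using (hu 0 n 0 n.zero_le le_rfl).le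
  choose f hf using hu₀
  have hcauchy {m n : ℕ} (hmn : m ≤ n) :
      f m ≡ f n [SMOD (IsLocalRing.maximalIdeal O ^ m • ⊤ : Submodule O O)] := by
    rw [smul_eq_mul, Ideal.mul_top, SModEq.sub_mem, ← hB.norm_algebraMap_le_pow_iff hϖ, map_sub,
      hf, hf, sub_sub_sub_cancel_right, ← dist_eq_norm]
    exact (hu m m n le_rfl hmn).le
  obtain ⟨L, hL⟩ := IsPrecomplete.prec' f hcauchy
  refine ⟨u 0 + algebraMap O E L, tendsto_iff_norm_sub_tendsto_zero.2 <| squeeze_zero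
    (fun n => norm_nonneg _) (fun n => ?_) <| tendsto_pow_atTop_nhds_zero_of_lt_one hϖ₀.le
      (hB.norm_algebraMap_irreducible_lt_one hϖ)⟩
  have hLn := hL n
  rwa [smul_eq_mul, Ideal.mul_top, SModEq.sub_mem, ← hB.norm_algebraMap_le_pow_iff hϖ, map_sub,
    hf, sub_sub] at hLn

end UnitBall

section PrimeNorm

variable {p : ℕ} [Fact p.Prime] {O : Type*} [CommRing O] {E : Type*} [NormedField E] [Algebra O E]

lemma natCast_ne_zero_of_norm_eq_inv (hp : ‖(p : E)‖ = (p : ℝ)⁻¹) : (p : O) ≠ 0 := fun h => by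
  have hp₀ : (p : ℝ)⁻¹ ≠ 0 := inv_ne_zero (Nat.cast_ne_zero.2 (Fact.out : p.Prime).ne_zero)
  rw [← hp, ← map_natCast (algebraMap O E), h, map_zero, norm_zero] at hp₀
  exact hp₀ rfl

lemma IsUnitBall.natCast_mem_maximalIdeal [IsLocalRing O] [IsFractionRing O E]
    (hB : IsUnitBall O E) (hp : ‖(p : E)‖ = (p : ℝ)⁻¹) : (p : O) ∈ IsLocalRing.maximalIdeal O := by
  rw [← IsLocalRing.residue_eq_zero_iff, ← hB.norm_algebraMap_lt_one_iff, map_natCast, hp]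
  exact inv_lt_one_of_one_lt₀ (Nat.one_lt_cast.2 (Fact.out : p.Prime).one_lt)

end PrimeNorm

section WittVector

variable (p : ℕ) [Fact p.Prime] (k : Type*) [Field k] [CharP k p]

lemma isAdicComplete_of_finite_wittVector [PerfectRing k p] (O : Type*) [CommRing O] [IsDomain O]
    [IsDiscreteValuationRing O] [Algebra (WittVector p k) O] [Module.Finite (WittVector p k) O]
    (hp₀ : (p : O) ≠ 0) (hp : (p : O) ∈ IsLocalRing.maximalIdeal O) :
    IsAdicComplete (IsLocalRing.maximalIdeal O) O := by
  have hspan : (Ideal.span {(p : WittVector p k)}).map (algebraMap (WittVector p k) O) =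
      Ideal.span {(p : O)} := by
    rw [Ideal.map_span, Set.image_singleton, map_natCast]
  have : IsPrecomplete (Ideal.span {(p : O)}) O :=
    hspan ▸ IsPrecomplete.map_algebraMap_iff.2
      (isPrecomplete_of_finite (Ideal.span {(p : WittVector p k)}) O)
  exact isAdicComplete_maximalIdeal_of_isPrecomplete_span hp₀ hp

lemma perfectField_residueField_wittVector [PerfectRing k p] :
    PerfectField (IsLocalRing.ResidueField (WittVector p k)) := by
  have : PerfectField k := PerfectRing.toPerfectField k p
  exact .of_ringEquiv ((Ideal.quotEquivOfEq (WittVector.irreducible p).maximalIdeal_eq).trans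
    WittVector.quotientPEquiv).symm

lemma perfectField_residueField_of_finite_wittVector [PerfectRing k p] (O : Type*) [CommRing O]
    [IsLocalRing O] [Algebra (WittVector p k) O] [Module.Finite (WittVector p k) O]
    [FaithfulSMul (WittVector p k) O] : PerfectField (IsLocalRing.ResidueField O) := by
  have := perfectField_residueField_wittVector p k
  exact Algebra.IsAlgebraic.perfectField (IsLocalRing.ResidueField (WittVector p k))

end WittVector

section Main

variable {p : ℕ} [Fact p.Prime] {E : Type*} [NormedField E] [IsUltrametricDist E] [CompleteSpace E]
  {x : ℚ → E}

lemma hasSlopeFactorization_omegaAn (hE : HasDiscreteNorm E) (hx : x ∈ OmegaAn p E)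
    (hx₀ : x ≠ 0) : HasSlopeFactorization p (OmegaAn p E) x := by
  obtain ⟨j, hj⟩ := exists_isLeast_support_of_mem_omegaAn hx hx₀
  rw [omegaAn_eq_omega] at hx ⊢
  exact (isStable_supportedIn _).hasSlopeFactorization hE hx hj

lemma hasSlopeFactorization_omegaImmAn (hE : HasDiscreteNorm E) (hx : x ∈ OmegaImmAn p E)
    (hj : ∃ j : ℚ, IsLeast (Function.support x) j) :
    HasSlopeFactorization p (OmegaImmAn p E) x := by
  obtain ⟨j, hj⟩ := hj
  rw [omegaImmAn_eq_omega] at hx ⊢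
  exact isStable_top.hasSlopeFactorization hE hx hj

lemma hasSlopeFactorization_omegaAlgAn {O : Type*} [CommRing O] [IsDomain O]
    [IsDiscreteValuationRing O] [IsAdicComplete (IsLocalRing.maximalIdeal O) O]
    [PerfectField (IsLocalRing.ResidueField O)] [Algebra O E] [IsFractionRing O E]
    (hB : IsUnitBall O E) (hp₀ : (p : O) ≠ 0) (hp : (p : O) ∈ IsLocalRing.maximalIdeal O)
    (hx : x ∈ OmegaAlgAn p O E) (hj : ∃ j : ℚ, IsLeast (Function.support x) j) :
    HasSlopeFactorization p (OmegaAlgAn p O E) x := by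
  obtain ⟨j, hj⟩ := hj
  rw [omegaAlgAn_eq_omega hB hp₀ hp] at hx ⊢
  exact (isStable_truncationsIn_gammaAlgLoc hB hp).hasSlopeFactorization hB.hasDiscreteNorm hx hj

end Main

end SlopeFact

end

theorem mainTheorem4_general (p : ℕ) [Fact p.Prime] (O : Type*) [CommRing O] [IsDomain O]
    [IsDiscreteValuationRing O] [IsAdicComplete (IsLocalRing.maximalIdeal O) O]
    [PerfectField (IsLocalRing.ResidueField O)] (E : Type*) [NormedField E] [IsUltrametricDist E]
    [Algebra O E] [IsFractionRing O E] (hO : SlopeFact.IsUnitBall O E) (hp₀ : (p : O) ≠ 0)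
    (hp : (p : O) ∈ IsLocalRing.maximalIdeal O) :
    (∀ x ∈ SlopeFact.OmegaAn p E, x ≠ 0 →
      SlopeFact.HasSlopeFactorization p (SlopeFact.OmegaAn p E) x) ∧
    (∀ x ∈ SlopeFact.OmegaAlgAn p O E, (∃ j : ℚ, IsLeast (Function.support x) j) →
      SlopeFact.HasSlopeFactorization p (SlopeFact.OmegaAlgAn p O E) x) ∧
    (∀ x ∈ SlopeFact.OmegaImmAn p E, (∃ j : ℚ, IsLeast (Function.support x) j) →
      SlopeFact.HasSlopeFactorization p (SlopeFact.OmegaImmAn p E) x) := by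
  have : CompleteSpace E := hO.completeSpace
  exact ⟨fun _ => SlopeFact.hasSlopeFactorization_omegaAn hO.hasDiscreteNorm,
    fun _ => SlopeFact.hasSlopeFactorization_omegaAlgAn hO hp₀ hp,
    fun _ => SlopeFact.hasSlopeFactorization_omegaImmAn hO.hasDiscreteNorm⟩

theorem mainTheorem4 (p : ℕ) [Fact p.Prime]
    (k : Type*) [Field k] [IsAlgClosed k] [CharP k p]
    (O : Type*) [CommRing O] [IsDomain O] [IsDiscreteValuationRing O]
    [Algebra (WittVector p k) O] [Module.Finite (WittVector p k) O]
    [FaithfulSMul (WittVector p k) O]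
    (E : Type*) [NormedField E] [IsUltrametricDist E] [Algebra O E] [IsFractionRing O E]
    (hO : ∀ a : E, ‖a‖ ≤ 1 ↔ a ∈ Set.range (algebraMap O E))
    (hp : ‖(p : E)‖ = (p : ℝ)⁻¹) :
    (∀ x ∈ SlopeFact.OmegaAn p E, x ≠ 0 →
      SlopeFact.HasSlopeFactorization p (SlopeFact.OmegaAn p E) x) ∧
    (∀ x ∈ SlopeFact.OmegaAlgAn p O E, (∃ j : ℚ, IsLeast (Function.support x) j) →
      SlopeFact.HasSlopeFactorization p (SlopeFact.OmegaAlgAn p O E) x) ∧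
    (∀ x ∈ SlopeFact.OmegaImmAn p E, (∃ j : ℚ, IsLeast (Function.support x) j) →
      SlopeFact.HasSlopeFactorization p (SlopeFact.OmegaImmAn p E) x) := by
  have hp₀ : (p : O) ≠ 0 := SlopeFact.natCast_ne_zero_of_norm_eq_inv hp
  have hp_mem := SlopeFact.IsUnitBall.natCast_mem_maximalIdeal hO hp
  have := SlopeFact.isAdicComplete_of_finite_wittVector p k O hp₀ hp_mem
  have := SlopeFact.perfectField_residueField_of_finite_wittVector p k O
  exact mainTheorem4_general p O E hO hp₀ hp_mem
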